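/- **Setting.** For $n\ge 0$ let $\mathcal B^{\#}(n,n)$ be the set of set partitions of $n$ upper and $n$ lower points, placed on two horizontal lines, that are noncrossing and have only blocks of size one or two; here the boundary points are labelled counterclockwise by alternating letters $a,b$, starting with $a$ in the upper right corner, and every block of size two must connect an $a$ to a $b$. For $\delta\in\mathbb C$ let $A_n=A_{(\mathcal B^{\#},\delta)}(n)$ be the algebra with basis $(e_p)_{p\in\mathcal B^{\#}(n,n)}$ and product $e_pe_q=\delta^{r}e_{s}$, where $s$ is obtained by drawing $p$ on top of $q$, connecting blocks that meet in the middle, and erasing the $r$ blocks that are not connected to an upper or lower point. Adding a through string on the right of every diagram gives embeddings $A_n\hookrightarrow A_{n+1}$. Assume that $\delta$ is generic, i.e. that $A_n$ is semisimple for all $n\ge 0$. Let $\alpha(n)$ be the alternating word of length $n$ in $a,b$ that ends in $a$, and $W_{\alpha(n)}$ the set of its subwords (words obtained by deleting letters); $W^{(k,l)}_{\alpha(n)}$ is the set of those with $k$ letters $a$ and $l$ letters $b$. An *$n$-link state* is a partition of $n$ points in a row, labelled from left to right by $\alpha(n)$, into pairs and into singletons of two types, *proper singletons* and *defects*, such that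 pairs connect an $a$ to a $b$, pairs do not cross, and no pair braces a defect. Its *boundary word* is the subword of $\alpha(n)$ that labels its defects from left to right; an $(n,k,l)$-link state is one with $k$ defects labelled $a$ and $l$ labelled $b$. $A_n$ acts on the span $M_n$ of the link states by drawing $p$ above $v$, connecting lines, and deleting the lines without upper point, where each deleted line without defect gives a factor $\delta$ and deleted lines with a defect give a factor $1$. Let $M_{(n,d)}\subseteq M_n$ be the submodule spanned by the link states with at most $d$ defects, $V_{(n,0)}=M_{(n,0)}$ and $V_{(n,d)}=M_{(n,d)}/M_{(n,d-1)}$ for $1\le d\le n$. The *branching graph* of $(A_n)_{n\ge0}$ has as vertices of level $n$ the isomorphism classes of simple $A_n$-modules, and the number of edges between $v$ in level $n$ and $w$ in level $n+1$ is the multiplicity of $v$ in the restriction of $w$ to $A_n$. The *pascalization* $\mathcal P(\Gamma)$ of a graph $\Gamma$ with levels $V_0,V_1,\dots$ and edges between consecutive levels only has as vertices of level $n$ the pairs $(n,v)$ with $v\in V_k$, $k\le n$, $k\equiv n \bmod 2$, and the number of edges between $(n,v)$ and $(n+1,w)$ is the number of edges between $v$ and $w$ in $\Gamma$. The *Fibonacci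 tree* $\mathbb{FT}$ has in level $0$ the empty word, in level $n\ge1$ the words of length $n$ in $a,b$ that start with $a$ and contain no two consecutive letters $b$, and a word $w$ in level $n$ is connected to those of $wa,wb$ that lie in level $n+1$. The *derooted Fibonacci tree* $\mathbb{FT}^*$ is $\mathbb{FT}$ without its root, $\mathbb{FT}^*_n=\mathbb{FT}_{n+1}$. **Statement.** For every $n\ge0$: 1. $M_{(n,0)}$ is an irreducible $A_n$-module. 2. For $0\le d\le n$, $V_{(n,d)}=\bigoplus V_{(n,k,l)}$, the sum being over $k\le\lceil n/2\rceil$, $l\le\lfloor n/2\rfloor$ with $k+l=d$, where the linear span $V_{(n,k,l)}$ of the classes of the $(n,k,l)$-link states is a submodule. 3. For $k\le\lceil n/2\rceil$, $l\le\lfloor n/2\rfloor$, $V_{(n,k,l)}=\bigoplus_{w\in W^{(k,l)}_{\alpha(n)}}V_w$, where the linear span $V_w$ of the classes of the link states with boundary word $w$ is a submodule, and the $V_w$ are irreducible and pairwise inequivalent. 4. The modules $V_w$, $w\in W_{\alpha(n)}$, form a full family of pairwise inequivalent irreducible $A_n$-modules: each is irreducible, $V_w\not\cong V_{w'}$ for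 $w\ne w'$, and every irreducible $A_n$-module is isomorphic to some $V_w$. Moreover, the branching graph of $(A_n)_{n\ge0}$ is isomorphic, as a graph with levels and edge multiplicities, to the pascalization $\mathcal P(\mathbb{FT}^*)$ of the derooted Fibonacci tree. -/

import Mathlib

/-! ## Set partition diagrams and their composition -/

namespace Diagram

/-- Stacking: the partition `p` with rows `X`, `Y` is drawn above the partition `q` with rows
`Y`, `Z`, and blocks meeting in the middle row `Y` are connected. -/
def glue {X Y Z : Type} (p : Setoid (X ⊕ Y)) (q : Setoid (Y ⊕ Z)) : Setoid (X ⊕ (Y ⊕ Z)) :=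
  p.map (Sum.map id Sum.inl) ⊔ q.map Sum.inr

/-- The inclusion of the outer rows into the three rows. -/
def outer {X Y Z : Type} : X ⊕ Z → X ⊕ (Y ⊕ Z) := Sum.map id Sum.inr

/-- The composed partition: `p` on top of `q`, restricted to the outer rows. -/
def comp {X Y Z : Type} (p : Setoid (X ⊕ Y)) (q : Setoid (Y ⊕ Z)) : Setoid (X ⊕ Z) :=
  (glue p q).comap outer

/-- The number of blocks of `s` that contain no point of the form `o x`. -/
noncomputable def deadCount {E O : Type} (s : Setoid E) (o : O → E) : ℕ :=
  Nat.card {c : Quotient s // ∀ x, Quotient.mk s (o x) ≠ c}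

/-- The number of blocks that are erased when `p` is composed with `q`, that is, of blocks of the
stacked picture that are not connected to an outer point. -/
noncomputable def loops {X Y Z : Type} (p : Setoid (X ⊕ Y)) (q : Setoid (Y ⊕ Z)) : ℕ :=
  deadCount (glue p q) outer

theorem map_le_iff {A B : Type} {f : A → B} {s : Setoid A} {t : Setoid B} :
    s.map f ≤ t ↔ ∀ x y, s x y → t (f x) (f y) := by
  constructor
  · intro h x y hxy
    exact h (Relation.EqvGen.rel _ _ ⟨x, y, hxy, rfl, rfl⟩)
  · intro h
    apply Setoid.eqvGen_le
    rintro _ _ ⟨x, y, hxy, rfl, rfl⟩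
    exact h x y hxy

theorem map_rel {A B : Type} {f : A → B} {s : Setoid A} {x y : A} (h : s x y) :
    s.map f (f x) (f y) := map_le_iff.1 le_rfl x y h

theorem map_inj_iff {A B : Type} {f : A → B} (hf : f.Injective) (s : Setoid A) (x y : B) :
    s.map f x y ↔ x = y ∨ ∃ a b, f a = x ∧ f b = y ∧ s a b := by
  rw [Setoid.coe_map_of_ker_le s f (Setoid.ker_eq_bot_iff.2 hf ▸ bot_le)]
  constructor
  · rintro (⟨a, b, h, rfl, rfl⟩ | h)
    · exact Or.inr ⟨a, b, rfl, rfl, h⟩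
    · exact Or.inl h
  · rintro (h | ⟨a, b, rfl, rfl, h⟩)
    · exact Or.inr h
    · exact Or.inl ⟨a, b, h, rfl, rfl⟩

theorem map_map {A B C : Type} (f : A → B) (g : B → C) (s : Setoid A) :
    (s.map f).map g = s.map (g ∘ f) := by
  apply le_antisymm
  · rw [map_le_iff]
    have : s.map f ≤ (s.map (g ∘ f)).comap g := map_le_iff.2 fun x y h => map_rel (f := g ∘ f) h
    exact fun x y h => this h
  · exact map_le_iff.2 fun x y h => map_rel (map_rel h)

theorem map_sup {A B : Type} (f : A → B) (s t : Setoid A) :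
    (s ⊔ t).map f = s.map f ⊔ t.map f := by
  apply le_antisymm
  · rw [map_le_iff]
    have : s ⊔ t ≤ (s.map f ⊔ t.map f).comap f :=
      sup_le (fun x y h => (le_sup_left : s.map f ≤ _) (map_rel h))
        (fun x y h => (le_sup_right : t.map f ≤ _) (map_rel h))
    exact fun x y h => this h
  · exact sup_le (map_le_iff.2 fun x y h => map_rel ((le_sup_left : s ≤ s ⊔ t) h))
      (map_le_iff.2 fun x y h => map_rel ((le_sup_right : t ≤ s ⊔ t) h))

/-- The equivalence relation on `E` generated by `s` and by `t` on the points `i x`. -/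
theorem sup_map_iff {E N : Type} (s : Setoid E) (t : Setoid N) (i : N → E)
    (h : s.comap i ≤ t) (e e' : E) :
    (s ⊔ t.map i) e e' ↔ s e e' ∨ ∃ x y, s e (i x) ∧ t x y ∧ s (i y) e' := by
  constructor
  · let u : Setoid E :=
      { r := fun e e' => s e e' ∨ ∃ x y, s e (i x) ∧ t x y ∧ s (i y) e'
        iseqv :=
          { refl := fun e => Or.inl (s.refl e)
            symm := by
              rintro a b (h1 | ⟨x, y, h1, h2, h3⟩)
              · exact Or.inl (s.symm h1)
              · exact Or.inr ⟨y, x, s.symm h3, t.symm h2, s.symm h1⟩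
            trans := by
              rintro a b c (h1 | ⟨x, y, h1, h2, h3⟩) (h4 | ⟨z, w, h4, h5, h6⟩)
              · exact Or.inl (s.trans h1 h4)
              · exact Or.inr ⟨z, w, s.trans h1 h4, h5, h6⟩
              · exact Or.inr ⟨x, y, h1, h2, s.trans h3 h4⟩
              · exact Or.inr ⟨x, w, h1, t.trans h2 (t.trans (h (s.trans h3 h4)) h5), h6⟩ } }
    have hu : s ⊔ t.map i ≤ u :=
      sup_le (fun x y hxy => Or.inl hxy)
        (map_le_iff.2 fun x y hxy => Or.inr ⟨x, y, s.refl _, hxy, s.refl _⟩)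
    exact fun hh => hu hh
  · have hs : s ≤ s ⊔ t.map i := le_sup_left
    have ht : t.map i ≤ s ⊔ t.map i := le_sup_right
    rintro (h1 | ⟨x, y, h1, h2, h3⟩)
    · exact hs h1
    · exact (s ⊔ t.map i).trans (hs h1) ((s ⊔ t.map i).trans (ht (map_rel h2)) (hs h3))

theorem sup_map_eq {E N B : Type} (s : Setoid E) (q : Setoid B) (i : N → E) (j : B → N) :
    s ⊔ q.map (i ∘ j) = s ⊔ (s.comap i ⊔ q.map j).map i := by
  have h : (s.comap i).map i ≤ s := map_le_iff.2 fun x y h => h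
  rw [map_sup, map_map, ← sup_assoc, sup_eq_left.2 h]

theorem comap_sup_map {E N B : Type} (s : Setoid E) (q : Setoid B) (i : N → E) (j : B → N) :
    (s ⊔ q.map (i ∘ j)).comap i = s.comap i ⊔ q.map j := by
  rw [sup_map_eq]
  set t := s.comap i ⊔ q.map j with ht
  have h : s.comap i ≤ t := le_sup_left
  ext x y
  change (s ⊔ t.map i) (i x) (i y) ↔ _
  rw [sup_map_iff s t i h]
  constructor
  · rintro (h1 | ⟨z, w, h1, h2, h3⟩)
    · exact h h1
    · exact t.trans (h h1) (t.trans h2 (h h3))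
  · exact fun h1 => Or.inr ⟨x, y, s.refl _, h1, s.refl _⟩

theorem deadCount_comp {E N O : Type} [Finite E] (S : Setoid E) (i : N → E) (o : O → N) :
    deadCount S (i ∘ o) = deadCount S i + deadCount (S.comap i) o := by
  classical
  unfold deadCount
  let P : {c : Quotient S // ∀ x, Quotient.mk S (i (o x)) ≠ c} → Prop :=
    fun c => ∀ x, Quotient.mk S (i x) ≠ c.1
  have e1 : {c // P c} ≃ {c : Quotient S // ∀ x, Quotient.mk S (i x) ≠ c} :=
    { toFun := fun c => ⟨c.1.1, c.2⟩
      invFun := fun c => ⟨⟨c.1, fun x => c.2 (o x)⟩, c.2⟩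
      left_inv := fun c => rfl
      right_inv := fun c => rfl }
  let f : Quotient (S.comap i) → Quotient S := Quotient.map i fun _ _ h => h
  have hf : Function.Injective f := by
    rintro ⟨a⟩ ⟨b⟩ h
    have h' : Quotient.mk S (i a) = Quotient.mk S (i b) := h
    exact Quotient.sound (s := S.comap i) (Quotient.exact h' : S (i a) (i b))
  have e2 : {c : Quotient (S.comap i) // ∀ x, Quotient.mk (S.comap i) (o x) ≠ c} ≃
      {c // ¬ P c} := by
    refine Equiv.ofBijective (fun c => ⟨⟨f c.1, fun x hx => c.2 x (hf hx)⟩, ?_⟩) ⟨?_, ?_⟩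
    · obtain ⟨c, hc⟩ := c
      induction c using Quotient.ind with
      | _ a => exact fun h => h a rfl
    · intro a b hab
      have := congrArg (fun c => c.1.1) hab
      exact Subtype.ext (hf this)
    · rintro ⟨⟨c, hc⟩, hP⟩
      simp only [P, not_forall, not_not] at hP
      obtain ⟨x, hx⟩ := hP
      subst hx
      exact ⟨⟨Quotient.mk _ x, fun y hy => hc y (congrArg f hy)⟩, rfl⟩
  have : Finite (Quotient S) := Quotient.finite S
  change Nat.card {c : Quotient S // ∀ x, Quotient.mk S (i (o x)) ≠ c} = _
  rw [Nat.card_congr (Equiv.sumCompl P).symm, Nat.card_sum, Nat.card_congr e1, Nat.card_congr e2]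

/-- Blocks without a point `i x` do not change when only points `i x` are joined. -/
theorem deadCount_sup_map {E N : Type} (s : Setoid E) (t : Setoid N) (i : N → E) :
    deadCount (s ⊔ t.map i) i = deadCount s i := by
  have h0 : s ⊔ t.map i = s ⊔ (s.comap i ⊔ t).map i := by
    have h : (s.comap i).map i ≤ s := map_le_iff.2 fun x y h => h
    rw [map_sup, ← sup_assoc, sup_eq_left.2 h]
  rw [h0]
  set u := s.comap i ⊔ t
  have hu : s.comap i ≤ u := le_sup_left
  unfold deadCount
  refine (Nat.card_congr (Equiv.ofBijective
    (fun c : {c : Quotient s // ∀ x, Quotient.mk s (i x) ≠ c} =>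
      (⟨Setoid.map_of_le le_sup_left c.1, ?_⟩ :
        {c : Quotient (s ⊔ u.map i) // ∀ x, Quotient.mk _ (i x) ≠ c})) ⟨?_, ?_⟩)).symm
  · obtain ⟨c, hc⟩ := c
    induction c using Quotient.ind with
    | _ a =>
      intro x hx
      have := (sup_map_iff s u i hu _ _).1 (Quotient.exact hx)
      rcases this with h | ⟨y, z, _, _, h⟩
      · exact hc x (Quotient.sound h)
      · exact hc z (Quotient.sound h)
  · rintro ⟨a, ha⟩ ⟨b, hb⟩ hab
    induction a using Quotient.ind
    induction b using Quotient.ind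
    have := congrArg Subtype.val hab
    rcases (sup_map_iff s u i hu _ _).1 (Quotient.exact this) with h | ⟨y, z, _, _, h⟩
    · exact Subtype.ext (Quotient.sound h)
    · exact absurd (Quotient.sound h) (hb z)
  · rintro ⟨c, hc⟩
    induction c using Quotient.ind with
    | _ a =>
      refine ⟨⟨Quotient.mk s a, fun x hx => hc x ?_⟩, rfl⟩
      exact Quotient.sound ((le_sup_left : s ≤ s ⊔ u.map i) (Quotient.exact hx))

/-- Adding isolated points `i x` to a picture. -/
theorem deadCount_map {D E N O : Type} (g : Setoid D) (k : D → E) (hk : k.Injective)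
    (o : O → D) (i : N → E) (h1 : ∀ x, ∃ y, i y = k (o x))
    (h2 : ∀ d y, i y = k d → ∃ x, o x = d) (h3 : ∀ e, (∃ d, k d = e) ∨ ∃ y, i y = e) :
    deadCount (g.map k) i = deadCount g o := by
  unfold deadCount
  have key : ∀ a b, g.map k (k a) (k b) ↔ g a b := fun a b => by
    rw [map_inj_iff hk]
    constructor
    · rintro (h | ⟨c, d, hc, hd, h⟩)
      · rw [hk h]
      · rwa [← hk hc, ← hk hd]
    · exact fun h => Or.inr ⟨a, b, rfl, rfl, h⟩
  let f : Quotient g → Quotient (g.map k) := Quotient.map k fun _ _ h => map_rel h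
  refine (Nat.card_congr (Equiv.ofBijective
    (fun c : {c : Quotient g // ∀ x, Quotient.mk g (o x) ≠ c} =>
      (⟨f c.1, ?_⟩ : {c : Quotient (g.map k) // ∀ x, Quotient.mk _ (i x) ≠ c})) ⟨?_, ?_⟩)).symm
  · obtain ⟨c, hc⟩ := c
    induction c using Quotient.ind with
    | _ a =>
      intro y hy
      have hy' : g.map k (i y) (k a) := Quotient.exact hy
      rw [map_inj_iff hk] at hy'
      rcases hy' with h | ⟨c, d, hc', hd, h⟩
      · obtain ⟨x, hx⟩ := h2 a y h
        exact hc x (by rw [hx])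
      · obtain ⟨x, hx⟩ := h2 c y hc'.symm
        apply hc x
        rw [hx]
        apply Quotient.sound
        rwa [← hk hd]
  · rintro ⟨a, ha⟩ ⟨b, hb⟩ hab
    induction a using Quotient.ind
    induction b using Quotient.ind
    have := congrArg Subtype.val hab
    exact Subtype.ext (Quotient.sound ((key _ _).1 (Quotient.exact this)))
  · rintro ⟨c, hc⟩
    induction c using Quotient.ind with
    | _ e =>
      rcases h3 e with ⟨d, rfl⟩ | ⟨y, rfl⟩
      · refine ⟨⟨Quotient.mk g d, fun x hx => ?_⟩, rfl⟩
        obtain ⟨y, hy⟩ := h1 x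
        apply hc y
        rw [hy]
        exact Quotient.sound (map_rel (Quotient.exact hx))
      · exact absurd rfl (hc y)

theorem comap_map_square {D E N O : Type} (g : Setoid D) (k : D → E) (hk : k.Injective)
    (o : O → D) (i : N → E) (hi : i.Injective) (m : O → N) (hm : m.Injective)
    (h1 : ∀ x, i (m x) = k (o x)) (h2 : ∀ d y, i y = k d → ∃ x, o x = d ∧ m x = y) :
    (g.map k).comap i = (g.comap o).map m := by
  ext a b
  rw [map_inj_iff hm]
  change g.map k (i a) (i b) ↔ _
  rw [map_inj_iff hk]
  constructor
  · rintro (h | ⟨c, d, hc, hd, h⟩)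
    · exact Or.inl (hi h)
    · obtain ⟨x, rfl, rfl⟩ := h2 c a hc.symm
      obtain ⟨y, rfl, rfl⟩ := h2 d b hd.symm
      exact Or.inr ⟨x, y, rfl, rfl, h⟩
  · rintro (h | ⟨c, d, rfl, rfl, h⟩)
    · exact Or.inl (by rw [h])
    · exact Or.inr ⟨o c, o d, (h1 c).symm, (h1 d).symm, h⟩

section assoc

variable {X Y Z W : Type} (p : Setoid (X ⊕ Y)) (q : Setoid (Y ⊕ Z)) (r : Setoid (Z ⊕ W))

/-- The picture with four rows. -/
def glue3 : Setoid (X ⊕ (Y ⊕ (Z ⊕ W))) :=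
  p.map (Sum.map id Sum.inl) ⊔ q.map (Sum.inr ∘ Sum.map id Sum.inl) ⊔ r.map (Sum.inr ∘ Sum.inr)

/-- Forgetting the second row. -/
def skip2 : X ⊕ (Z ⊕ W) → X ⊕ (Y ⊕ (Z ⊕ W)) := Sum.map id Sum.inr

/-- Forgetting the third row. -/
def skip3 : X ⊕ (Y ⊕ W) → X ⊕ (Y ⊕ (Z ⊕ W)) := Sum.map id (Sum.map id Sum.inr)

/-- Forgetting the fourth row. -/
def skip4 : X ⊕ (Y ⊕ Z) → X ⊕ (Y ⊕ (Z ⊕ W)) := Sum.map id (Sum.map id Sum.inl)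

theorem outer_injective : Function.Injective (outer : X ⊕ Z → X ⊕ (Y ⊕ Z)) :=
  Function.Injective.sumMap Function.injective_id Sum.inr_injective

theorem skip2_injective : Function.Injective (skip2 : X ⊕ (Z ⊕ W) → X ⊕ (Y ⊕ (Z ⊕ W))) :=
  Function.Injective.sumMap Function.injective_id Sum.inr_injective

theorem skip3_injective : Function.Injective (skip3 : X ⊕ (Y ⊕ W) → X ⊕ (Y ⊕ (Z ⊕ W))) :=
  Function.Injective.sumMap Function.injective_id
    (Function.Injective.sumMap Function.injective_id Sum.inr_injective)

theorem skip4_injective : Function.Injective (skip4 : X ⊕ (Y ⊕ Z) → X ⊕ (Y ⊕ (Z ⊕ W))) :=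
  Function.Injective.sumMap Function.injective_id
    (Function.Injective.sumMap Function.injective_id Sum.inl_injective)

theorem glue3_left : glue3 p q r = (glue p q).map skip4 ⊔ r.map (skip2 ∘ Sum.inr) := by
  rw [glue, map_sup, map_map, map_map]
  unfold glue3
  congr 2
  congr 1
  funext x; rcases x with x | x <;> rfl

theorem glue3_right : glue3 p q r = (glue q r).map Sum.inr ⊔ p.map (skip3 ∘ Sum.map id Sum.inl) := by
  rw [glue, map_sup, map_map, map_map]
  unfold glue3
  rw [sup_assoc, sup_comm]
  congr 2
  · funext x; rcases x with x | x <;> rfl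

theorem glue3_comap_left : (glue3 p q r).comap skip2 = glue (comp p q) r := by
  rw [glue3_left, comap_sup_map]
  unfold comp
  rw [glue]
  congr 1
  apply comap_map_square _ _ skip4_injective _ _ skip2_injective
  · exact Function.Injective.sumMap Function.injective_id Sum.inl_injective
  · rintro (x | x) <;> rfl
  · rintro (d | d | d) (y | y | y) h <;> simp [skip2, skip4, outer] at h ⊢ <;> exact h.symm

theorem glue3_comap_right : (glue3 p q r).comap skip3 = glue p (comp q r) := by
  rw [glue3_right, comap_sup_map]
  unfold comp
  rw [glue, sup_comm]
  congr 1
  apply comap_map_square _ _ Sum.inr_injective _ _ skip3_injective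
  · exact Sum.inr_injective
  · rintro (x | x) <;> rfl
  · rintro (d | d | d) (y | y | y) h <;> simp [skip3, outer] at h ⊢ <;> exact h

theorem skip_outer :
    (skip2 ∘ outer : X ⊕ W → X ⊕ (Y ⊕ (Z ⊕ W))) = skip3 ∘ outer := by
  funext x; rcases x with x | x <;> rfl

theorem comp_assoc : comp (comp p q) r = comp p (comp q r) := by
  rw [comp, ← glue3_comap_left, ← Setoid.comap_comp, skip_outer, Setoid.comap_comp,
    glue3_comap_right, ← comp]

theorem loops_assoc [Finite X] [Finite Y] [Finite Z] [Finite W] :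
    loops p q + loops (comp p q) r = loops q r + loops p (comp q r) := by
  have h1 : deadCount (glue3 p q r) (skip2 ∘ outer) = loops p q + loops (comp p q) r := by
    rw [deadCount_comp, glue3_comap_left, glue3_left]
    congr 1
    rw [← map_map, deadCount_sup_map]
    apply deadCount_map _ _ skip4_injective
    · rintro (x | x)
      · exact ⟨Sum.inl x, rfl⟩
      · exact ⟨Sum.inr (Sum.inl x), rfl⟩
    · rintro (d | d | d) (y | y | y) h <;> simp [skip2, skip4, outer] at h ⊢
    · rintro (e | e | e | e) <;> simp [skip2, skip4]
  have h2 : deadCount (glue3 p q r) (skip3 ∘ outer) = loops q r + loops p (comp q r) := by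
    rw [deadCount_comp, glue3_comap_right, glue3_right]
    congr 1
    rw [← map_map, deadCount_sup_map]
    apply deadCount_map _ _ Sum.inr_injective
    · rintro (x | x)
      · exact ⟨Sum.inr (Sum.inl x), rfl⟩
      · exact ⟨Sum.inr (Sum.inr x), rfl⟩
    · rintro (d | d | d) (y | y | y) h <;> simp [skip3, outer] at h ⊢
    · rintro (e | e | e | e) <;> simp [skip3]
  rw [← h1, ← h2, skip_outer]

end assoc

/-- The identity diagram: every upper point is joined to the lower point below it. -/
def idDiagram (X : Type) : Setoid (X ⊕ X) := Setoid.ker (Sum.elim id id)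

theorem glue_id_left {X Z : Type} (q : Setoid (X ⊕ Z)) :
    glue (idDiagram X) q = q.comap (Sum.elim Sum.inl id) := by
  apply le_antisymm
  · refine sup_le (map_le_iff.2 ?_) (map_le_iff.2 fun x y h => h)
    rintro (x | x) (y | y) h <;> (obtain rfl : x = y := h) <;> exact q.refl _
  · have hf : ∀ e, glue (idDiagram X) q e (Sum.inr (Sum.elim Sum.inl id e)) := by
      rintro (x | x)
      · exact (le_sup_left : _ ≤ glue (idDiagram X) q)
          (map_rel (f := Sum.map id Sum.inl) (x := Sum.inl x) (y := Sum.inr x) rfl)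
      · exact (glue (idDiagram X) q).refl _
    intro e e' h
    exact (glue (idDiagram X) q).trans (hf e) ((glue (idDiagram X) q).trans
      ((le_sup_right : _ ≤ glue (idDiagram X) q) (map_rel h)) ((glue (idDiagram X) q).symm (hf e')))

theorem comp_id_left {X Z : Type} (q : Setoid (X ⊕ Z)) : comp (idDiagram X) q = q := by
  rw [comp, glue_id_left, ← Setoid.comap_comp]
  have : (Sum.elim Sum.inl id ∘ outer : X ⊕ Z → X ⊕ Z) = id := by
    funext x; rcases x with x | x <;> rfl
  rw [this, Setoid.comap_id]

theorem loops_id_left {X Z : Type} (q : Setoid (X ⊕ Z)) : loops (idDiagram X) q = 0 := by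
  rw [loops, glue_id_left, deadCount]
  have : IsEmpty {c : Quotient (q.comap (Sum.elim Sum.inl id)) //
      ∀ x, Quotient.mk (q.comap (Sum.elim Sum.inl id)) (outer x) ≠ c} := by
    constructor
    rintro ⟨c, hc⟩
    induction c using Quotient.ind with
    | _ a =>
      rcases a with x | x | x
      · exact hc (Sum.inl x) rfl
      · exact hc (Sum.inl x) (Quotient.sound (q.refl _))
      · exact hc (Sum.inr x) rfl
  exact Nat.card_of_isEmpty

theorem glue_id_right {X Z : Type} (p : Setoid (X ⊕ Z)) :
    glue p (idDiagram Z) = p.comap (Sum.map id (Sum.elim id id)) := by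
  apply le_antisymm
  · refine sup_le (map_le_iff.2 ?_) (map_le_iff.2 ?_)
    · rintro (x | x) (y | y) h <;> exact h
    · rintro (x | x) (y | y) h <;> (obtain rfl : x = y := h) <;> exact p.refl _
  · have hf : ∀ e, glue p (idDiagram Z) e
        (Sum.map id Sum.inl (Sum.map id (Sum.elim id id) e : X ⊕ Z)) := by
      rintro (x | x | x)
      · exact (glue p (idDiagram Z)).refl _
      · exact (glue p (idDiagram Z)).refl _
      · exact (le_sup_right : _ ≤ glue p (idDiagram Z))
          (map_rel (f := Sum.inr) (x := Sum.inr x) (y := Sum.inl x) rfl)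
    intro e e' h
    exact (glue p (idDiagram Z)).trans (hf e) ((glue p (idDiagram Z)).trans
      ((le_sup_left : _ ≤ glue p (idDiagram Z)) (map_rel h)) ((glue p (idDiagram Z)).symm (hf e')))

theorem comp_id_right {X Z : Type} (p : Setoid (X ⊕ Z)) : comp p (idDiagram Z) = p := by
  rw [comp, glue_id_right, ← Setoid.comap_comp]
  have : (Sum.map id (Sum.elim id id) ∘ outer : X ⊕ Z → X ⊕ Z) = id := by
    funext x; rcases x with x | x <;> rfl
  rw [this, Setoid.comap_id]

theorem loops_id_right {X Z : Type} (p : Setoid (X ⊕ Z)) : loops p (idDiagram Z) = 0 := by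
  rw [loops, glue_id_right, deadCount]
  have : IsEmpty {c : Quotient (p.comap (Sum.map id (Sum.elim id id))) //
      ∀ x, Quotient.mk (p.comap (Sum.map id (Sum.elim id id))) (outer x) ≠ c} := by
    constructor
    rintro ⟨c, hc⟩
    induction c using Quotient.ind with
    | _ a =>
      rcases a with x | x | x
      · exact hc (Sum.inl x) rfl
      · exact hc (Sum.inr x) (Quotient.sound (p.refl _))
      · exact hc (Sum.inr x) rfl
  exact Nat.card_of_isEmpty

end Diagram

namespace Diagram

/-- The place of a boundary point in the order `1 < 2 < … < k < l' < … < 1'`. -/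
def pos {k l : ℕ} : Fin k ⊕ Fin l → ℕ := Sum.elim (fun i => i) (fun j => k + j.rev)

/-- Noncrossing partitions with `k` upper and `l` lower points. -/
def IsNoncrossing {k l : ℕ} (s : Setoid (Fin k ⊕ Fin l)) : Prop :=
  ∀ x y z t, pos x < pos y → pos y < pos z → pos z < pos t → s x z → s y t → s x y

theorem pos_injective {k l : ℕ} : Function.Injective (pos : Fin k ⊕ Fin l → ℕ) := by
  rintro (⟨i, hi⟩ | ⟨i, hi⟩) (⟨j, hj⟩ | ⟨j, hj⟩) h <;> simp [pos, Fin.val_rev] at h ⊢ <;> omega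

open Classical in
/-- The indicator of a proposition modulo two. -/
noncomputable def ind (P : Prop) : ZMod 2 := if P then 1 else 0

theorem ind_true {P : Prop} (h : P) : ind P = 1 := by simp [ind, h]

theorem ind_false {P : Prop} (h : ¬ P) : ind P = 0 := by simp [ind, h]

theorem ind_parity {a b c d : ℕ} (n1 : a ≠ c) (n2 : b ≠ c) (n3 : a ≠ d) (n4 : b ≠ d)
    (c1 : ¬ (a < c ∧ c < b ∧ b < d)) (c2 : ¬ (b < c ∧ c < a ∧ a < d))
    (c3 : ¬ (a < d ∧ d < b ∧ b < c)) (c4 : ¬ (b < d ∧ d < a ∧ a < c))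
    (c5 : ¬ (c < a ∧ a < d ∧ d < b)) (c6 : ¬ (c < b ∧ b < d ∧ d < a))
    (c7 : ¬ (d < a ∧ a < c ∧ c < b)) (c8 : ¬ (d < b ∧ b < c ∧ c < a)) :
    ind (a < c) + ind (b < c) = ind (a < d) + ind (b < d) := by
  have e : (1 : ZMod 2) + 1 = 0 := rfl
  by_cases h1 : a < c <;> by_cases h2 : b < c <;> by_cases h3 : a < d <;> by_cases h4 : b < d <;>
    simp only [ind, h1, h2, h3, h4, if_true, if_false, e, add_zero, zero_add] <;>
    exfalso <;> omega

theorem IsNoncrossing.parity {k l : ℕ} {s : Setoid (Fin k ⊕ Fin l)} (hs : IsNoncrossing s)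
    {a b c d : Fin k ⊕ Fin l} (hab : s a b) (hcd : s c d) (hac : ¬ s a c) :
    ind (pos a < pos c) + ind (pos b < pos c) = ind (pos a < pos d) + ind (pos b < pos d) := by
  have hbc : ¬ s b c := fun h => hac (s.trans hab h)
  have had : ¬ s a d := fun h => hac (s.trans h (s.symm hcd))
  have hbd : ¬ s b d := fun h => hbc (s.trans h (s.symm hcd))
  have hne : ∀ {u v}, ¬ s u v → pos u ≠ pos v := fun h h' => h (pos_injective h' ▸ s.refl _)
  have hba := s.symm hab
  have hdc := s.symm hcd
  exact ind_parity (hne hac) (hne hbc) (hne had) (hne hbd)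
    (fun h => hac (hs a c b d h.1 h.2.1 h.2.2 hab hcd))
    (fun h => hbc (hs b c a d h.1 h.2.1 h.2.2 hba hcd))
    (fun h => had (hs a d b c h.1 h.2.1 h.2.2 hab hdc))
    (fun h => hbd (hs b d a c h.1 h.2.1 h.2.2 hba hdc))
    (fun h => hac (s.symm (hs c a d b h.1 h.2.1 h.2.2 hcd hab)))
    (fun h => hbc (s.symm (hs c b d a h.1 h.2.1 h.2.2 hcd hba)))
    (fun h => had (s.symm (hs d a c b h.1 h.2.1 h.2.2 hdc hab)))
    (fun h => hbd (s.symm (hs d b c a h.1 h.2.1 h.2.2 hdc hba)))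

section noncrossing

variable {k l m : ℕ}

/-- A count modulo two of the position of a point `z` relative to `y` in a picture with three
rows. -/
noncomputable def side : Fin k ⊕ (Fin l ⊕ Fin m) → Fin k ⊕ (Fin l ⊕ Fin m) → ZMod 2
  | Sum.inl i, Sum.inl i' => ind (i' < i)
  | Sum.inl _, Sum.inr _ => 0
  | Sum.inr _, Sum.inl _ => 1
  | Sum.inr (Sum.inl j), Sum.inr (Sum.inl j') => ind (j < j')
  | Sum.inr (Sum.inl _), Sum.inr (Sum.inr _) => 1
  | Sum.inr (Sum.inr _), Sum.inr (Sum.inl _) => 1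
  | Sum.inr (Sum.inr i), Sum.inr (Sum.inr i') => ind (i < i')

theorem zmod_two_self (a : ZMod 2) : a + a = 0 := CharTwo.add_self_eq_zero a

/-- The functions counting on which side of a path from `z` to `z'` a point lies. -/
def Sided (p : Setoid (Fin k ⊕ Fin l)) (q : Setoid (Fin l ⊕ Fin m))
    (z z' : Fin k ⊕ (Fin l ⊕ Fin m)) : Prop :=
  ∃ (f : Fin k ⊕ Fin l → ZMod 2) (g : Fin l ⊕ Fin m → ZMod 2),
    (∀ c d, p c d → ¬ glue p q z (Sum.map id Sum.inl c) → f c = f d) ∧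
    (∀ c d, q c d → ¬ glue p q z (Sum.inr c) → g c = g d) ∧
    (∀ i, ¬ glue p q z (Sum.inl i) → f (Sum.inl i) = side (Sum.inl i) z + side (Sum.inl i) z') ∧
    (∀ j, ¬ glue p q z (Sum.inr (Sum.inl j)) → f (Sum.inr j) + g (Sum.inl j) =
      side (Sum.inr (Sum.inl j)) z + side (Sum.inr (Sum.inl j)) z') ∧
    (∀ j, ¬ glue p q z (Sum.inr (Sum.inr j)) → g (Sum.inr j) =
      side (Sum.inr (Sum.inr j)) z + side (Sum.inr (Sum.inr j)) z')

variable {p : Setoid (Fin k ⊕ Fin l)} {q : Setoid (Fin l ⊕ Fin m)}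

theorem glue_upper {x y : Fin k ⊕ Fin l} (h : p x y) :
    glue p q (Sum.map id Sum.inl x) (Sum.map id Sum.inl y) :=
  (le_sup_left : _ ≤ glue p q) (map_rel h)

theorem glue_lower {x y : Fin l ⊕ Fin m} (h : q x y) : glue p q (Sum.inr x) (Sum.inr y) :=
  (le_sup_right : _ ≤ glue p q) (map_rel h)

theorem sided (hp : IsNoncrossing p) (hq : IsNoncrossing q) {z z' : Fin k ⊕ (Fin l ⊕ Fin m)}
    (h : glue p q z z') : Sided p q z z' := by
  let u : Setoid (Fin k ⊕ (Fin l ⊕ Fin m)) :=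
    { r := fun z z' => glue p q z z' ∧ Sided p q z z'
      iseqv :=
        { refl := fun z => ⟨(glue p q).refl z, fun _ => 0, fun _ => 0, fun _ _ _ _ => rfl,
            fun _ _ _ _ => rfl, fun _ _ => (zmod_two_self _).symm,
            fun _ _ => (zmod_two_self 0).trans (zmod_two_self _).symm, fun _ _ => (zmod_two_self _).symm⟩
          symm := by
            rintro z z' ⟨h, f, g, h1, h2, h3, h4, h5⟩
            have hz : ∀ e, ¬ glue p q z' e → ¬ glue p q z e :=
              fun e he he' => he ((glue p q).trans ((glue p q).symm h) he')
            exact ⟨(glue p q).symm h, f, g, fun c d hcd hc => h1 c d hcd (hz _ hc),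
              fun c d hcd hc => h2 c d hcd (hz _ hc),
              fun i hi => by rw [h3 i (hz _ hi), add_comm],
              fun i hi => by rw [h4 i (hz _ hi), add_comm],
              fun i hi => by rw [h5 i (hz _ hi), add_comm]⟩
          trans := by
            rintro z z' z'' ⟨h, f, g, h1, h2, h3, h4, h5⟩ ⟨h', f', g', h1', h2', h3', h4', h5'⟩
            have hz : ∀ e, ¬ glue p q z e → ¬ glue p q z' e :=
              fun e he he' => he ((glue p q).trans h he')
            have key : ∀ a b c : ZMod 2, a + b + (b + c) = a + c := by decide
            have key2 : ∀ a b c d : ZMod 2, a + b + (c + d) = a + c + (b + d) := by decide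
            exact ⟨(glue p q).trans h h', fun c => f c + f' c, fun c => g c + g' c,
              fun c d hcd hc => by
                simp only; rw [h1 c d hcd hc, h1' c d hcd (hz _ hc)],
              fun c d hcd hc => by
                simp only; rw [h2 c d hcd hc, h2' c d hcd (hz _ hc)],
              fun i hi => by simp only; rw [h3 i hi, h3' i (hz _ hi), key],
              fun i hi => by simp only; rw [key2, h4 i hi, h4' i (hz _ hi), key],
              fun i hi => by simp only; rw [h5 i hi, h5' i (hz _ hi), key]⟩ } }
  have hu : glue p q ≤ u := by
    refine sup_le (map_le_iff.2 ?_) (map_le_iff.2 ?_)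
    · intro x y hxy
      refine ⟨glue_upper hxy, fun c => ind (pos x < pos c) + ind (pos y < pos c), fun _ => 0,
        ?_, fun _ _ _ _ => rfl, ?_, ?_, ?_⟩
      · intro c d hcd hc
        exact hp.parity hxy hcd fun h => hc (glue_upper h)
      · intro i _
        have aux : ∀ x : Fin k ⊕ Fin l, ind (pos x < pos (Sum.inl i : Fin k ⊕ Fin l)) =
            side (Sum.inl i) (Sum.map id Sum.inl x : Fin k ⊕ (Fin l ⊕ Fin m)) := by
          rintro (x | x)
          · rfl
          · exact ind_false (by simp [pos]; omega)
        simp only [aux]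
      · intro j _
        have aux : ∀ x : Fin k ⊕ Fin l, ind (pos x < pos (Sum.inr j : Fin k ⊕ Fin l)) =
            side (Sum.inr (Sum.inl j)) (Sum.map id Sum.inl x : Fin k ⊕ (Fin l ⊕ Fin m)) := by
          rintro (x | x)
          · exact ind_true (by simp [pos]; omega)
          · simp only [side, Sum.map_inr, pos, Sum.elim_inr]
            refine congrArg ind (propext ?_)
            rw [Fin.lt_def, Fin.val_rev, Fin.val_rev]
            omega
        simp only [aux, add_zero]
      · intro j _
        have aux : ∀ x : Fin k ⊕ Fin l,
            side (Sum.inr (Sum.inr j)) (Sum.map id Sum.inl x : Fin k ⊕ (Fin l ⊕ Fin m)) = 1 := by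
          rintro (x | x) <;> rfl
        simp only [aux]; rfl
    · intro x y hxy
      refine ⟨glue_lower hxy, fun _ => 0, fun c => ind (pos x < pos c) + ind (pos y < pos c),
        fun _ _ _ _ => rfl, ?_, ?_, ?_, ?_⟩
      · intro c d hcd hc
        exact hq.parity hxy hcd fun h => hc (glue_lower h)
      · intro i _
        have aux : ∀ x : Fin l ⊕ Fin m,
            side (Sum.inl i) (Sum.inr x : Fin k ⊕ (Fin l ⊕ Fin m)) = 0 := fun _ => rfl
        simp only [aux]; rfl
      · intro j hj
        have aux : ∀ x : Fin l ⊕ Fin m, x ≠ Sum.inl j →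
            ind (pos x < pos (Sum.inl j : Fin l ⊕ Fin m)) =
            1 + side (Sum.inr (Sum.inl j)) (Sum.inr x : Fin k ⊕ (Fin l ⊕ Fin m)) := by
          rintro (x | x) hx
          · have hx' : x ≠ j := fun h => hx (by rw [h])
            have e : (1 : ZMod 2) + 1 = 0 := rfl
            simp only [side, pos, Sum.elim_inl]
            rcases lt_or_gt_of_ne hx' with h | h
            · rw [ind_true (by simpa using h), ind_false (by simpa using h.le), add_zero]
            · rw [ind_false (by simpa using h.le), ind_true (by simpa using h), e]
          · rw [ind_false (by simp [pos]; omega)]; rfl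
        have hx : x ≠ Sum.inl j := by rintro rfl; exact hj ((glue p q).refl _)
        have hy : y ≠ Sum.inl j := by rintro rfl; exact hj (glue_lower hxy)
        have key : ∀ a b : ZMod 2, 0 + (1 + a + (1 + b)) = a + b := by decide
        simp only [aux x hx, aux y hy, key]
      · intro j _
        have aux : ∀ x : Fin l ⊕ Fin m, ind (pos x < pos (Sum.inr j : Fin l ⊕ Fin m)) =
            side (Sum.inr (Sum.inr j)) (Sum.inr x : Fin k ⊕ (Fin l ⊕ Fin m)) := by
          rintro (x | x)
          · exact ind_true (by simp [pos]; omega)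
          · simp only [side, pos, Sum.elim_inr]
            refine congrArg ind (propext ?_)
            rw [Fin.lt_def, Fin.val_rev, Fin.val_rev]
            omega
        simp only [aux]
  exact (hu h).2

theorem side_outer (x y : Fin k ⊕ Fin m) :
    side (outer y : Fin k ⊕ (Fin l ⊕ Fin m)) (outer x) = ind (pos x < pos y) := by
  rcases x with x | x <;> rcases y with y | y
  · rfl
  · exact (ind_true (by simp [pos]; omega)).symm
  · exact (ind_false (by simp [pos]; omega)).symm
  · simp only [side, outer, Sum.map_inr, pos, Sum.elim_inr]
    refine congrArg ind (propext ?_)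
    rw [Fin.lt_def, Fin.val_rev, Fin.val_rev]
    omega

/-- The composition of noncrossing partitions is noncrossing. -/
theorem IsNoncrossing.comp (hp : IsNoncrossing p) (hq : IsNoncrossing q) :
    IsNoncrossing (comp p q) := by
  intro x y z t hxy hyz hzt hxz hyt
  by_contra hne
  replace hne : ¬ glue p q (outer x) (outer y) := hne
  replace hyt : glue p q (outer y) (outer t) := hyt
  obtain ⟨f, g, h1, h2, h3, h4, h5⟩ := sided hp hq (show glue p q (outer x) (outer z) from hxz)
  have h4' : ∀ j, ¬ glue p q (outer x) (Sum.inr (Sum.inl j)) →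
      f (Sum.inr j) = g (Sum.inl j) := by
    intro j hj
    have := h4 j hj
    have aux : ∀ x : Fin k ⊕ Fin m,
        side (Sum.inr (Sum.inl j)) (outer x : Fin k ⊕ (Fin l ⊕ Fin m)) = 1 := by
      rintro (x | x) <;> rfl
    rw [aux, aux] at this
    have key : ∀ a b : ZMod 2, a + b = 1 + 1 → a = b := by decide
    exact key _ _ this
  let val : Fin k ⊕ (Fin l ⊕ Fin m) → ZMod 2 :=
    Sum.elim (fun i => f (Sum.inl i)) (Sum.elim (fun j => f (Sum.inr j)) (fun j => g (Sum.inr j)))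
  let v : Setoid (Fin k ⊕ (Fin l ⊕ Fin m)) :=
    { r := fun e e' => glue p q e e' ∧ (¬ glue p q (outer x) e → val e = val e')
      iseqv :=
        { refl := fun e => ⟨(glue p q).refl e, fun _ => rfl⟩
          symm := by
            rintro a b ⟨h, h'⟩
            exact ⟨(glue p q).symm h,
              fun hb => (h' fun ha => hb ((glue p q).trans ha h)).symm⟩
          trans := by
            rintro a b c ⟨h, h'⟩ ⟨i, i'⟩
            exact ⟨(glue p q).trans h i, fun ha => (h' ha).trans
              (i' fun hb => ha ((glue p q).trans hb ((glue p q).symm h)))⟩ } }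
  have hv : glue p q ≤ v := by
    refine sup_le (map_le_iff.2 ?_) (map_le_iff.2 ?_)
    · intro c d hcd
      refine ⟨glue_upper hcd, fun hc => ?_⟩
      have aux : ∀ c : Fin k ⊕ Fin l, val (Sum.map id Sum.inl c) = f c := by
        rintro (c | c) <;> rfl
      rw [aux, aux]
      exact h1 c d hcd hc
    · intro c d hcd
      refine ⟨glue_lower hcd, fun hc => ?_⟩
      have aux : ∀ c : Fin l ⊕ Fin m, ¬ glue p q (outer x) (Sum.inr c) →
          val (Sum.inr c) = g c := by
        rintro (c | c) hc
        · exact h4' c hc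
        · rfl
      rw [aux c hc, aux d fun hd => hc ((glue p q).trans hd ((glue p q).symm (glue_lower hcd)))]
      exact h2 c d hcd hc
  have hval := (hv hyt).2 hne
  have hne' : ¬ glue p q (outer x) (outer t) :=
    fun h => hne ((glue p q).trans h ((glue p q).symm hyt))
  have aux : ∀ e : Fin k ⊕ Fin m, ¬ glue p q (outer x) (outer e) →
      val (outer e) = ind (pos x < pos e) + ind (pos z < pos e) := by
    intro e he
    rw [← side_outer (l := l), ← side_outer (l := l)]
    rcases e with e | e
    · exact h3 e he
    · exact h5 e he
  rw [aux y hne, aux t hne', ind_true hxy, ind_false (by omega), ind_true (by omega),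
    ind_true hzt] at hval
  exact absurd hval (by decide)

end noncrossing

/-! ### Following the lines of a picture -/

section run

variable {E : Type} (s : Bool → Setoid E) (x : E) (t₀ : Bool)

/-- The points reached after `k` steps when following a line from the point `x`; the Boolean tells
whether the next step uses the upper or the lower partition. -/
inductive Run : ℕ → E → Bool → Prop
  | start : Run 0 x t₀
  | step (k : ℕ) (z z' : E) (t : Bool) : Run k z t → s t z z' → z ≠ z' → Run (k + 1) z' (!t)

variable {s x t₀}

theorem Run.mem {k : ℕ} {z : E} {t : Bool} (h : Run s x t₀ k z t) : (s false ⊔ s true) x z := by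
  induction h with
  | start => exact Setoid.refl' _ _
  | step k z z' t _ h1 _ ih =>
    refine Setoid.trans' _ ih ?_
    cases t
    · exact (le_sup_left : s false ≤ _) h1
    · exact (le_sup_right : s true ≤ _) h1

/-- All points on the line through `x` lie in blocks with at most two points. -/
def SmallBlocks (s : Bool → Setoid E) (x : E) : Prop :=
  ∀ t u v w, (s false ⊔ s true) x u → s t u v → s t u w → u = v ∨ u = w ∨ v = w

theorem Run.det (hs : SmallBlocks s x) {k : ℕ} {z z' : E} {t t' : Bool}
    (h : Run s x t₀ k z t) (h' : Run s x t₀ k z' t') : z = z' ∧ t = t' := by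
  induction h generalizing z' t' with
  | start => cases h'; exact ⟨rfl, rfl⟩
  | step k u v t h1 h2 h3 ih =>
    cases h' with
    | step k u' v' t' h1' h2' h3' =>
      obtain ⟨rfl, rfl⟩ := ih h1'
      rcases hs _ _ _ _ h1.mem h2 h2' with h | h | h
      · exact absurd h h3
      · exact absurd h h3'
      · exact ⟨h, rfl⟩

theorem Run.before {k j : ℕ} {z : E} {t : Bool} (h : Run s x t₀ (k + j) z t) :
    ∃ z' t', Run s x t₀ k z' t' := by
  induction j generalizing z t with
  | zero => exact ⟨z, t, h⟩
  | succ j ih =>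
    cases h with
    | step _ u _ t h1 _ _ => exact ih h1

theorem Run.total (hs : SmallBlocks s x) (hx : ∀ z, s (!t₀) x z → x = z) {z : E}
    (h : (s false ⊔ s true) x z) : ∃ k t, Run s x t₀ k z t := by
  have key : ∀ t u v, (∃ k t, Run s x t₀ k u t) → s t u v → ∃ k t, Run s x t₀ k v t := by
    rintro t u v ⟨k, t', hk⟩ huv
    by_cases huv' : u = v
    · exact ⟨k, t', huv' ▸ hk⟩
    by_cases ht : t' = t
    · subst ht
      exact ⟨k + 1, !t', Run.step k u v t' hk huv huv'⟩
    · cases hk with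
      | start =>
        have : t = !t₀ := by cases t <;> cases t₀ <;> simp_all
        subst this
        exact absurd (hx v huv) huv'
      | step k w _ t' h1 h2 h3 =>
        have : t = t' := by cases t <;> cases t' <;> simp_all
        subst this
        have hu : (s false ⊔ s true) x u := (Run.step k w u t h1 h2 h3).mem
        rcases hs t u w v hu ((s t).symm h2) huv with h | h | h
        · exact absurd h.symm h3
        · exact absurd h huv'
        · exact ⟨k, t, h ▸ h1⟩
  let u : Setoid E :=
    { r := fun a b => (∃ k t, Run s x t₀ k a t) ↔ (∃ k t, Run s x t₀ k b t)
      iseqv := ⟨fun _ => Iff.rfl, fun h => h.symm, fun h h' => h.trans h'⟩ }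
  have hu : s false ⊔ s true ≤ u :=
    sup_le (fun a b h => ⟨fun ha => key _ _ _ ha h, fun hb => key _ _ _ hb ((s _).symm h)⟩)
      (fun a b h => ⟨fun ha => key _ _ _ ha h, fun hb => key _ _ _ hb ((s _).symm h)⟩)
  exact (hu h).1 ⟨0, t₀, Run.start⟩

/-- An end point other than `x` is reached by its only line. -/
theorem Run.end {k : ℕ} {y : E} {t ty : Bool} (h : Run s x t₀ k y t) (hxy : x ≠ y)
    (hy : ∀ z, s ty y z → y = z) : t = ty := by
  cases h with
  | start => exact absurd rfl hxy
  | step k w _ t' h1 h2 h3 =>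
    by_contra hne
    have : ty = t' := by cases ty <;> cases t' <;> simp_all
    subst this
    exact h3 (hy w ((s ty).symm h2)).symm

/-- A line has at most two end points. -/
theorem eq_of_ends (hs : SmallBlocks s x) (hx : ∀ z, s (!t₀) x z → x = z) {y y' : E}
    {ty ty' : Bool} (hy : ∀ z, s ty y z → y = z) (hy' : ∀ z, s ty' y' z → y' = z)
    (hxy : x ≠ y) (hxy' : x ≠ y') (h : (s false ⊔ s true) x y) (h' : (s false ⊔ s true) x y') :
    y = y' := by
  obtain ⟨k, t, hk⟩ := Run.total hs hx h
  obtain ⟨k', t', hk'⟩ := Run.total hs hx h'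
  obtain rfl := hk.end hxy hy
  obtain rfl := hk'.end hxy' hy'
  have no : ∀ {k z t} (_ : Run s x t₀ k z t) (_ : ∀ w, s t z w → z = w) {k' z' t'}
      (_ : Run s x t₀ k' z' t'), k' ≤ k := by
    intro k z t hr hz k' z' t' hr'
    by_contra hlt
    obtain ⟨j, rfl⟩ : ∃ j, k' = k + 1 + j := ⟨k' - (k + 1), by omega⟩
    obtain ⟨w, tw, hw⟩ := hr'.before
    cases hw with
    | step _ u _ tu h1 h2 h3 =>
      obtain ⟨rfl, rfl⟩ := hr.det hs h1
      exact h3 (hz _ h2)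
  obtain rfl : k = k' := le_antisymm (no hk' hy' hk) (no hk hy hk')
  exact (hk.det hs hk').1

/-- Labels along a line. -/
theorem Run.label {L : Type} {lab : Bool → E → L}
    (hl : ∀ t u v w, s t u v → u ≠ v → (s false ⊔ s true) x u → lab t u = w → lab (!t) v = w)
    {k : ℕ} {z : E} {t : Bool} (h : Run s x t₀ k z t) : lab t z = lab t₀ x := by
  induction h with
  | start => rfl
  | step k u v t h1 h2 h3 ih => exact hl t u v _ h2 h3 h1.mem ih

end run

end Diagram

/-! ## The diagrams of the freely modified bistochastic quantum group -/

/-- The two labels. -/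
inductive Letter
  | a
  | b
  deriving DecidableEq

namespace Diagram

/-- The labels alternate counterclockwise, starting with `a` in the upper right corner: the label
of the `i`-th of `n` upper points. -/
def upperLabel {n : ℕ} (i : Fin n) : Letter := if Even (i.rev : ℕ) then Letter.a else Letter.b

/-- The label of the `j`-th of `n` lower points below `n` upper points. -/
def lowerLabel {n : ℕ} (j : Fin n) : Letter := if Even (n + (j : ℕ)) then Letter.a else Letter.b

/-- The label of a boundary point. -/
def label {n : ℕ} : Fin n ⊕ Fin n → Letter := Sum.elim upperLabel lowerLabel

/-- The set partitions of `n` upper and `n` lower points that are noncrossing, have blocks of size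
one or two only, and whose blocks of size two connect an `a` to a `b`. (As the number of points is
even, the number of blocks of size one is then even.) -/
structure IsABAdmissible {n : ℕ} (s : Setoid (Fin n ⊕ Fin n)) : Prop where
  noncrossing : IsNoncrossing s
  card_block_le : ∀ x y z, s x y → s x z → x = y ∨ x = z ∨ y = z
  label_ne : ∀ x y, s x y → x ≠ y → label x ≠ label y

/-- The extra point below a link state. A link state is encoded as a partition of its `n` points
and of this extra point, whose block consists of itself and of the defects. -/
def infty {n : ℕ} : Fin n ⊕ Fin 1 := Sum.inr 0

/-- Link states: the points that are not defects form pairs (of an `a` and a `b`) and proper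
singletons, and nothing crosses, that is, pairs do not cross each other and
no pair braces a defect. -/
structure IsLinkState {n : ℕ} (v : Setoid (Fin n ⊕ Fin 1)) : Prop where
  noncrossing : IsNoncrossing v
  card_block_le : ∀ i j k : Fin n, ¬ v (Sum.inl i) infty → v (Sum.inl i) (Sum.inl j) →
    v (Sum.inl i) (Sum.inl k) → i = j ∨ i = k ∨ j = k
  label_ne : ∀ i j : Fin n, ¬ v (Sum.inl i) infty → v (Sum.inl i) (Sum.inl j) → i ≠ j →
    upperLabel i ≠ upperLabel j

/-! ### Closure under composition -/

section closure

variable {n : ℕ}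

/-- Interchange of `a` and `b`. -/
def bar : Letter → Letter
  | Letter.a => Letter.b
  | Letter.b => Letter.a

theorem bar_ne (x : Letter) : bar x ≠ x := by cases x <;> simp [bar]

theorem eq_bar_iff {x y : Letter} : x = bar y ↔ x ≠ y := by cases x <;> cases y <;> simp [bar]

theorem bar_bar (x : Letter) : bar (bar x) = x := by cases x <;> rfl

theorem lowerLabel_eq (i : Fin n) : lowerLabel i = bar (upperLabel i) := by
  unfold lowerLabel upperLabel
  have h : Even (n + (i : ℕ)) ↔ ¬ Even (i.rev : ℕ) := by
    rw [Fin.val_rev, Nat.even_iff, Nat.even_iff]; omega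
  by_cases h' : Even (i.rev : ℕ)
  · rw [if_pos h', if_neg fun h'' => h.1 h'' h']; rfl
  · rw [if_neg h', if_pos (h.2 h')]; rfl

theorem IsABAdmissible.idDiagram : IsABAdmissible (idDiagram (Fin n)) := by
  have h : ∀ x y : Fin n ⊕ Fin n, Diagram.idDiagram (Fin n) x y →
      x = y ∨ (∃ i, x = Sum.inl i ∧ y = Sum.inr i) ∨ (∃ i, x = Sum.inr i ∧ y = Sum.inl i) := by
    rintro (x | x) (y | y) h <;> obtain rfl : x = y := h <;> simp
  refine ⟨?_, ?_, ?_⟩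
  · intro x y z t hxy hyz hzt hxz hyt
    rcases h x z hxz with rfl | ⟨i, rfl, rfl⟩ | ⟨i, rfl, rfl⟩
    · omega
    · rcases h y t hyt with rfl | ⟨j, rfl, rfl⟩ | ⟨j, rfl, rfl⟩ <;>
        simp only [pos, Sum.elim_inl, Sum.elim_inr, Fin.val_rev] at hxy hyz hzt <;> omega
    · simp only [pos, Sum.elim_inl, Sum.elim_inr, Fin.val_rev] at hxy hyz; omega
  · intro x y z hxy hxz
    rcases h x y hxy with h1 | ⟨i, h1, h2⟩ | ⟨i, h1, h2⟩
    · exact Or.inl h1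
    all_goals
      rcases h x z hxz with h3 | ⟨j, h3, h4⟩ | ⟨j, h3, h4⟩
      · exact Or.inr (Or.inl h3)
      all_goals
        subst h1 h2 h4
        simp at h3
        try simp [h3]
  · intro x y hxy hne
    rcases h x y hxy with rfl | ⟨i, rfl, rfl⟩ | ⟨i, rfl, rfl⟩
    · exact absurd rfl hne
    · simp only [label, Sum.elim_inl, Sum.elim_inr, lowerLabel_eq]; exact (bar_ne _).symm
    · simp only [label, Sum.elim_inl, Sum.elim_inr, lowerLabel_eq]; exact bar_ne _

/-- The two layers of a picture. -/
def layer {X Y Z : Type} (p : Setoid (X ⊕ Y)) (q : Setoid (Y ⊕ Z)) :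
    Bool → Setoid (X ⊕ (Y ⊕ Z))
  | false => p.map (Sum.map id Sum.inl)
  | true => q.map Sum.inr

theorem inl_injective' {X Y Z : Type} :
    Function.Injective (Sum.map id Sum.inl : X ⊕ Y → X ⊕ (Y ⊕ Z)) :=
  Function.Injective.sumMap Function.injective_id Sum.inl_injective

section layer

variable {X Y Z : Type} {p : Setoid (X ⊕ Y)} {q : Setoid (Y ⊕ Z)}

theorem layer_upper {u v : X ⊕ (Y ⊕ Z)} (h : layer p q false u v) :
    u = v ∨ ∃ x y, Sum.map id Sum.inl x = u ∧ Sum.map id Sum.inl y = v ∧ p x y :=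
  (map_inj_iff inl_injective' p u v).1 h

theorem layer_lower {u v : X ⊕ (Y ⊕ Z)} (h : layer p q true u v) :
    u = v ∨ ∃ x y, Sum.inr x = u ∧ Sum.inr y = v ∧ q x y :=
  (map_inj_iff Sum.inr_injective q u v).1 h

theorem isolated_upper (x : X) (z : X ⊕ (Y ⊕ Z)) (h : layer p q true (Sum.inl x) z) :
    Sum.inl x = z := by
  rcases layer_lower h with h | ⟨_, _, h, _⟩
  · exact h
  · simp at h

theorem isolated_lower (x : Z) (z : X ⊕ (Y ⊕ Z)) (h : layer p q false (Sum.inr (Sum.inr x)) z) :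
    Sum.inr (Sum.inr x) = z := by
  rcases layer_upper h with h | ⟨c, _, h, _⟩
  · exact h
  · rcases c with c | c <;> simp at h

theorem small_upper (hp : ∀ x y z, p x y → p x z → x = y ∨ x = z ∨ y = z)
    {u v w : X ⊕ (Y ⊕ Z)} (h1 : layer p q false u v) (h2 : layer p q false u w) :
    u = v ∨ u = w ∨ v = w := by
  rcases layer_upper h1 with h | ⟨a, b, rfl, rfl, h⟩
  · exact Or.inl h
  rcases layer_upper h2 with h' | ⟨a', c, ha, rfl, h'⟩
  · exact Or.inr (Or.inl h')
  obtain rfl := inl_injective' ha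
  rcases hp _ _ _ h h' with h | h | h <;> simp [h]

theorem isolated_outer (x : X ⊕ Z) : ∃ t, ∀ z, layer p q t (outer x) z → outer x = z := by
  rcases x with x | x
  · exact ⟨true, isolated_upper x⟩
  · exact ⟨false, isolated_lower x⟩

end layer

/-- The label of a point of a three-row picture, as seen from the upper and the lower partition. -/
def lab {Z : Type} (f : Z → Letter) : Bool → Fin n ⊕ (Fin n ⊕ Z) → Letter
  | false => Sum.elim upperLabel (Sum.elim lowerLabel fun j => bar (f j))
  | true => Sum.elim (fun i => bar (upperLabel i)) (Sum.elim upperLabel f)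

theorem lab_not {Z : Type} (f : Z → Letter) (t : Bool) (x : Fin n ⊕ (Fin n ⊕ Z)) :
    lab f (!t) x = bar (lab f t x) := by
  rcases x with x | x | x <;> cases t <;> simp [lab, lowerLabel_eq, bar_bar]

theorem lab_upper {Z : Type} {p : Setoid (Fin n ⊕ Fin n)} {q : Setoid (Fin n ⊕ Z)}
    (hp : IsABAdmissible p) (f : Z → Letter) {u v : Fin n ⊕ (Fin n ⊕ Z)}
    (h : layer p q false u v) (hne : u ≠ v) : lab f false u ≠ lab f false v := by
  rcases layer_upper h with h' | ⟨x, y, rfl, rfl, h'⟩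
  · exact absurd h' hne
  · have aux : ∀ x : Fin n ⊕ Fin n, lab f false (Sum.map id Sum.inl x) = label x := by
      rintro (x | x) <;> rfl
    rw [aux, aux]
    exact hp.label_ne x y h' fun h => hne (by rw [h])

variable {p q : Setoid (Fin n ⊕ Fin n)}

theorem IsABAdmissible.smallBlocks (hp : IsABAdmissible p) (hq : IsABAdmissible q)
    (x : Fin n ⊕ (Fin n ⊕ Fin n)) : SmallBlocks (layer p q) x := by
  intro t u v w _ h1 h2
  cases t
  · exact small_upper hp.card_block_le h1 h2
  · rcases layer_lower h1 with h | ⟨a, b, rfl, rfl, h⟩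
    · exact Or.inl h
    rcases layer_lower h2 with h' | ⟨a', c, ha, rfl, h'⟩
    · exact Or.inr (Or.inl h')
    obtain rfl := Sum.inr_injective ha
    rcases hq.card_block_le _ _ _ h h' with h | h | h <;> simp [h]

/-- The diagrams are closed under composition. -/
theorem IsABAdmissible.comp (hp : IsABAdmissible p) (hq : IsABAdmissible q) :
    IsABAdmissible (comp p q) := by
  refine ⟨hp.noncrossing.comp hq.noncrossing, ?_, ?_⟩
  · intro x y z hxy hxz
    by_contra! hne
    obtain ⟨tx, hx⟩ := isolated_outer (p := p) (q := q) x
    obtain ⟨ty, hy⟩ := isolated_outer (p := p) (q := q) y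
    obtain ⟨tz, hz⟩ := isolated_outer (p := p) (q := q) z
    have := eq_of_ends (t₀ := !tx) (hp.smallBlocks hq (outer x)) (by rw [Bool.not_not]; exact hx) hy hz
      (fun h => hne.1 (outer_injective h)) (fun h => hne.2.1 (outer_injective h)) hxy hxz
    exact hne.2.2 (outer_injective this)
  · intro x y hxy hne
    have hend : ∀ x : Fin n ⊕ Fin n, ∃ t, (∀ z, layer p q t (outer x) z → outer x = z) ∧
        lab lowerLabel (!t) (outer x) = label x := by
      rintro (x | x)
      · exact ⟨true, isolated_upper x, rfl⟩
      · exact ⟨false, isolated_lower x, rfl⟩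
    obtain ⟨tx, hx, lx⟩ := hend x
    obtain ⟨ty, hy, ly⟩ := hend y
    obtain ⟨k, t, hr⟩ := Run.total (t₀ := !tx) (hp.smallBlocks hq (outer x)) (by rw [Bool.not_not]; exact hx) hxy
    obtain rfl := hr.end (fun h => hne (outer_injective h)) hy
    have hl := hr.label (lab := lab lowerLabel) (by
      rintro t u v w h hne' _ rfl
      rw [lab_not, eq_comm, eq_bar_iff]
      cases t
      · exact lab_upper hp _ h hne'
      · rcases layer_lower h with h' | ⟨x, y, rfl, rfl, h'⟩
        · exact absurd h' hne'
        · have aux : ∀ x : Fin n ⊕ Fin n,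
              lab (n := n) lowerLabel true (Sum.inr x) = label x := by
            rintro (x | x) <;> rfl
          rw [aux, aux]
          exact hq.label_ne x y h' fun h => hne' (by rw [h]))
    rw [lx] at hl
    rw [← hl, ← ly, lab_not]
    exact (bar_ne _).symm

variable {v : Setoid (Fin n ⊕ Fin 1)}

theorem eq_infty (x : Fin 1) : (Sum.inr x : Fin n ⊕ Fin 1) = infty := by
  rw [Subsingleton.elim x 0]; rfl

theorem IsLinkState.lower (_hv : IsLinkState v) {x u w : Fin n ⊕ (Fin n ⊕ Fin 1)}
    (hx : ¬ glue p v x (Sum.inr infty)) (hu : glue p v x u)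
    (h : layer p v true u w) :
    u = w ∨ ∃ i j, u = Sum.inr (Sum.inl i) ∧ w = Sum.inr (Sum.inl j) ∧
      v (Sum.inl i) (Sum.inl j) ∧ ¬ v (Sum.inl i) infty := by
  rcases layer_lower h with h' | ⟨a, b, rfl, rfl, h'⟩
  · exact Or.inl h'
  have ha : ¬ v a infty := fun h => hx ((glue p v).trans hu (glue_lower h))
  rcases a with a | a
  · rcases b with b | b
    · exact Or.inr ⟨a, b, rfl, rfl, h', ha⟩
    · rw [eq_infty] at h'; exact absurd h' ha
  · rw [eq_infty] at ha; exact absurd (v.refl _) ha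

theorem IsLinkState.smallBlocks (hp : IsABAdmissible p) (hv : IsLinkState v)
    {x : Fin n ⊕ (Fin n ⊕ Fin 1)} (hx : ¬ glue p v x (Sum.inr infty)) :
    SmallBlocks (layer p v) x := by
  intro t u w w' hu h1 h2
  cases t
  · exact small_upper hp.card_block_le h1 h2
  · rcases hv.lower hx hu h1 with h | ⟨i, j, rfl, rfl, h, hi⟩
    · exact Or.inl h
    rcases hv.lower hx hu h2 with h | ⟨i', k, hi', rfl, h', _⟩
    · exact Or.inr (Or.inl h)
    obtain rfl : i = i' := by simpa using hi'
    rcases hv.card_block_le i j k hi h h' with h | h | h <;> simp [h]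

/-- A diagram drawn above a link state gives a link state. -/
theorem IsLinkState.comp (hp : IsABAdmissible p) (hv : IsLinkState v) :
    IsLinkState (comp p v) := by
  refine ⟨hp.noncrossing.comp hv.noncrossing, ?_, ?_⟩
  · intro i j k hi hij hik
    by_contra! hne
    have := eq_of_ends (t₀ := false) (hv.smallBlocks hp (x := Sum.inl i) hi) (isolated_upper i)
      (isolated_upper j) (isolated_upper k) (by simpa using hne.1) (by simpa using hne.2.1) hij hik
    exact hne.2.2 (by simpa using this)
  · intro i j hi hij hne
    have hne' : (Sum.inl i : Fin n ⊕ (Fin n ⊕ Fin 1)) ≠ Sum.inl j := by simpa using hne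
    obtain ⟨k, t, hr⟩ := Run.total (t₀ := false) (hv.smallBlocks hp (x := Sum.inl i) hi)
      (isolated_upper i) hij
    have ht := hr.end hne' (isolated_upper j)
    have hl := hr.label (lab := lab fun _ => Letter.a) (by
      rintro t u w _ h hne' hu rfl
      rw [lab_not, eq_comm, eq_bar_iff]
      cases t
      · exact lab_upper hp _ h hne'
      · rcases hv.lower hi hu h with h | ⟨c, d, rfl, rfl, h, hc⟩
        · exact absurd h hne'
        · exact hv.label_ne c d hc h fun h => hne' (by rw [h]))
    rw [ht] at hl
    change bar (upperLabel j) = upperLabel i at hl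
    rw [← hl]
    exact bar_ne _

/-- The defects of a link state. -/
def Defect (v : Setoid (Fin n ⊕ Fin 1)) (i : Fin n) : Prop := v (Sum.inl i) infty

/-- The number of defects. -/
noncomputable def defectCount (v : Setoid (Fin n ⊕ Fin 1)) : ℕ := Nat.card {i // Defect v i}

/-- The action of diagrams does not increase the number of defects. -/
theorem defectCount_comp_le (hp : IsABAdmissible p) (hv : IsLinkState v) :
    defectCount (comp p v) ≤ defectCount v := by
  let w : Setoid (Fin n ⊕ Fin 1) :=
    { r := fun x y => x = y ∨ (v x y ∧ ¬ v x infty)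
      iseqv :=
        { refl := fun x => Or.inl rfl
          symm := by
            rintro x y (rfl | ⟨h, h'⟩)
            · exact Or.inl rfl
            · exact Or.inr ⟨v.symm h, fun hy => h' (v.trans h hy)⟩
          trans := by
            rintro x y z (rfl | ⟨h, h'⟩) (rfl | ⟨i, i'⟩)
            · exact Or.inl rfl
            · exact Or.inr ⟨i, i'⟩
            · exact Or.inr ⟨h, h'⟩
            · exact Or.inr ⟨v.trans h i, h'⟩ } }
  have hw : ∀ x y, w x y → x = y ∨ ∃ i j, x = Sum.inl i ∧ y = Sum.inl j ∧
      v (Sum.inl i) (Sum.inl j) ∧ ¬ v (Sum.inl i) infty := by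
    rintro x y (h | ⟨h, h'⟩)
    · exact Or.inl h
    · rcases x with x | x
      · rcases y with y | y
        · exact Or.inr ⟨x, y, rfl, rfl, h, h'⟩
        · rw [eq_infty] at h; exact absurd h h'
      · rw [eq_infty] at h'; exact absurd (v.refl _) h'
  -- the extra point is isolated once the defects are cut off
  have hinf : ∀ e, glue p w e (Sum.inr infty) → e = Sum.inr infty := by
    let u : Setoid (Fin n ⊕ (Fin n ⊕ Fin 1)) :=
      { r := fun a b => a = Sum.inr infty ↔ b = Sum.inr infty
        iseqv := ⟨fun _ => Iff.rfl, fun h => h.symm, fun h h' => h.trans h'⟩ }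
    have hu : glue p w ≤ u := by
      refine sup_le (map_le_iff.2 ?_) (map_le_iff.2 ?_)
      · rintro (x | x) (y | y) _ <;>
          change (_ = _) ↔ (_ = _) <;> simp [infty]
      · rintro x y h
        change (_ = _) ↔ (_ = _)
        rcases hw x y h with rfl | ⟨i, j, rfl, rfl, _⟩ <;> simp [infty]
    exact fun e he => (hu he).2 rfl
  have hsmall : ∀ x, SmallBlocks (layer p w) x := by
    intro x t a b c _ h1 h2
    cases t
    · exact small_upper hp.card_block_le h1 h2
    · rcases layer_lower h1 with h | ⟨a, b, rfl, rfl, h⟩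
      · exact Or.inl h
      rcases layer_lower h2 with h' | ⟨a', c, ha, rfl, h'⟩
      · exact Or.inr (Or.inl h')
      obtain rfl := Sum.inr_injective ha
      rcases hw _ _ h with h | ⟨i, j, rfl, rfl, h, hi⟩
      · simp [h]
      rcases hw _ _ h' with h' | ⟨i', k, hi', rfl, h', _⟩
      · simp [h']
      obtain rfl : i = i' := by simpa using hi'
      rcases hv.card_block_le i j k hi h h' with h | h | h <;> simp [h]
  have hex : ∀ i : {i // Defect (Diagram.comp p v) i}, ∃ j : {j // Defect v j},
      glue p w (Sum.inl i.1) (Sum.inr (Sum.inl j.1)) := by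
    rintro ⟨i, hi⟩
    let D : Fin n ⊕ (Fin n ⊕ Fin 1) → Prop := fun e => ∃ d, v d infty ∧ glue p w e (Sum.inr d)
    let u : Setoid (Fin n ⊕ (Fin n ⊕ Fin 1)) :=
      { r := fun a b => glue p w a b ∨ (D a ∧ D b)
        iseqv :=
          { refl := fun a => Or.inl ((glue p w).refl a)
            symm := by
              rintro a b (h | ⟨h, h'⟩)
              · exact Or.inl ((glue p w).symm h)
              · exact Or.inr ⟨h', h⟩
            trans := by
              rintro a b c (h | ⟨h, h'⟩) (i | ⟨i, i'⟩)
              · exact Or.inl ((glue p w).trans h i)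
              · obtain ⟨d, hd, hd'⟩ := i
                exact Or.inr ⟨⟨d, hd, (glue p w).trans h hd'⟩, i'⟩
              · obtain ⟨d, hd, hd'⟩ := h'
                exact Or.inr ⟨h, ⟨d, hd, (glue p w).trans ((glue p w).symm i) hd'⟩⟩
              · exact Or.inr ⟨h, i'⟩ } }
    have hu : glue p v ≤ u := by
      refine sup_le (map_le_iff.2 fun x y h => Or.inl (glue_upper h)) (map_le_iff.2 ?_)
      intro x y h
      by_cases hx : v x infty
      · exact Or.inr ⟨⟨x, hx, (glue p w).refl _⟩, ⟨y, v.trans (v.symm h) hx, (glue p w).refl _⟩⟩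
      · exact Or.inl (glue_lower (Or.inr ⟨h, hx⟩))
    have hcon : ¬ glue p w (Sum.inl i) (Sum.inr infty) := fun h => by
      have := hinf _ h
      simp at this
    rcases hu (show glue p v (Sum.inl i) (Sum.inr infty) from hi) with h | ⟨⟨d, hd, hd'⟩, _⟩
    · exact absurd h hcon
    · rcases d with d | d
      · exact ⟨⟨d, hd⟩, hd'⟩
      · rw [eq_infty] at hd'; exact absurd hd' hcon
  choose f hf using hex
  refine Nat.card_le_card_of_injective f ?_
  intro i i' hii
  by_contra hne
  have hj : ∀ z, layer p w true (Sum.inr (Sum.inl (f i).1)) z → Sum.inr (Sum.inl (f i).1) = z := by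
    intro z hz
    rcases layer_lower hz with h | ⟨c, d, hc, rfl, h⟩
    · exact h
    · obtain rfl := Sum.inr_injective hc
      rcases hw _ _ h with h | ⟨a, b, ha, rfl, _, hv'⟩
      · rw [h]
      · obtain rfl : (f i).1 = a := by simpa using ha
        exact absurd (f i).2 hv'
  have h1 := hf i
  have h2 := hf i'
  rw [← hii] at h2
  have := eq_of_ends (t₀ := false) (hsmall (Sum.inl i.1)) (isolated_upper i.1)
    (isolated_upper i'.1) hj (fun h => hne (Subtype.ext (by simpa using h))) (by simp)
    ((glue p w).trans h1 ((glue p w).symm h2)) h1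
  simp at this

end closure

end Diagram

/-! ### Adding a through string on the right -/

namespace Diagram

section strand

variable {n : ℕ}

/-- Removing the last point of a row. -/
def strip : Fin (n + 1) → Option (Fin n) := Fin.lastCases none some

/-- Removing the rightmost points of both rows. -/
def unstrand : Fin (n + 1) ⊕ Fin (n + 1) → Option (Fin n ⊕ Fin n) :=
  Sum.elim (fun i => (strip i).map Sum.inl) (fun i => (strip i).map Sum.inr)

/-- The diagram `p` with a through string added on the right: the two new points, which are those
removed by `unstrand`, form a block, and the other points are related as in `p`. -/
def addStrand (p : Setoid (Fin n ⊕ Fin n)) : Setoid (Fin (n + 1) ⊕ Fin (n + 1)) :=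
  (p.map some).comap unstrand

@[simp] theorem strip_last : strip (Fin.last n) = none := by simp [strip]

@[simp] theorem strip_castSucc (i : Fin n) : strip i.castSucc = some i := by simp [strip]

/-- The inclusion of the old points. -/
def castS : Fin n ⊕ Fin n → Fin (n + 1) ⊕ Fin (n + 1) := Sum.map Fin.castSucc Fin.castSucc

@[simp] theorem unstrand_castS (x : Fin n ⊕ Fin n) : unstrand (castS x) = some x := by
  rcases x with x | x <;> simp [unstrand, castS]

theorem eq_castS_or (x : Fin (n + 1) ⊕ Fin (n + 1)) :
    (∃ y, x = castS y) ∨ x = Sum.inl (Fin.last n) ∨ x = Sum.inr (Fin.last n) := by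
  rcases x with x | x <;> induction x using Fin.lastCases with
  | last => simp
  | cast i => first | exact Or.inl ⟨Sum.inl i, rfl⟩ | exact Or.inl ⟨Sum.inr i, rfl⟩

theorem unstrand_last_left : unstrand (Sum.inl (Fin.last n)) = none := by simp [unstrand]

theorem unstrand_last_right : unstrand (Sum.inr (Fin.last n)) = none := by simp [unstrand]

theorem map_some_iff {A : Type} (p : Setoid A) (x y : A) :
    p.map some (some x) (some y) ↔ p x y := by
  rw [map_inj_iff (Option.some_injective A)]
  constructor
  · rintro (h | ⟨a, b, ha, hb, h⟩)
    · obtain rfl := Option.some_injective _ h; exact p.refl _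
    · obtain rfl := Option.some_injective _ ha
      obtain rfl := Option.some_injective _ hb
      exact h
  · exact fun h => Or.inr ⟨x, y, rfl, rfl, h⟩

theorem map_some_none {A : Type} (p : Setoid A) (x : A) : ¬ p.map some none (some x) := by
  rw [map_inj_iff (Option.some_injective A)]
  rintro (h | ⟨a, b, ha, hb, h⟩)
  · simp at h
  · simp at ha

theorem addStrand_iff {p : Setoid (Fin n ⊕ Fin n)} {x y : Fin (n + 1) ⊕ Fin (n + 1)} :
    addStrand p x y ↔ (∃ a b, x = castS a ∧ y = castS b ∧ p a b) ∨
      ((x = Sum.inl (Fin.last n) ∨ x = Sum.inr (Fin.last n)) ∧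
        (y = Sum.inl (Fin.last n) ∨ y = Sum.inr (Fin.last n))) := by
  change p.map some (unstrand x) (unstrand y) ↔ _
  have hc : ∀ (a : Fin n ⊕ Fin n), castS a ≠ Sum.inl (Fin.last n) ∧ castS a ≠ Sum.inr (Fin.last n) := by
    intro a
    constructor <;> intro h <;> have := congrArg unstrand h <;>
      simp [unstrand_last_left, unstrand_last_right] at this
  have hn : ∀ {x : Fin (n + 1) ⊕ Fin (n + 1)},
      (x = Sum.inl (Fin.last n) ∨ x = Sum.inr (Fin.last n)) → unstrand x = none := by
    rintro _ (rfl | rfl)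
    · exact unstrand_last_left
    · exact unstrand_last_right
  have hinj : Function.Injective (castS : Fin n ⊕ Fin n → _) := fun a b h => by
    have := congrArg unstrand h
    simpa using this
  rcases eq_castS_or x with ⟨a, rfl⟩ | hx <;> rcases eq_castS_or y with ⟨b, rfl⟩ | hy
  · simp only [unstrand_castS, map_some_iff, hc, or_self, and_self, or_false]
    constructor
    · exact fun h => ⟨a, b, rfl, rfl, h⟩
    · rintro ⟨a', b', ha, hb, h⟩
      rwa [hinj ha, hinj hb]
  · rw [hn hy, unstrand_castS]
    constructor
    · exact fun h => absurd ((p.map some).symm h) (map_some_none p a)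
    · rintro (⟨a', b', _, rfl, _⟩ | ⟨h, _⟩)
      · simp [hc] at hy
      · simp [hc] at h
  · rw [hn hx, unstrand_castS]
    constructor
    · exact fun h => absurd h (map_some_none p b)
    · rintro (⟨a', b', rfl, _, _⟩ | ⟨_, h⟩)
      · simp [hc] at hx
      · simp [hc] at h
  · rw [hn hx, hn hy]
    exact ⟨fun _ => Or.inr ⟨hx, hy⟩, fun _ => (p.map some).refl _⟩

theorem pos_castS_lt {a b : Fin n ⊕ Fin n} : pos (castS a) < pos (castS b) ↔ pos a < pos b := by
  rcases a with a | a <;> rcases b with b | b <;>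
    simp only [castS, pos, Sum.map_inl, Sum.map_inr, Sum.elim_inl, Sum.elim_inr, Fin.val_rev,
      Fin.val_castSucc] <;> omega

theorem label_castS (a : Fin n ⊕ Fin n) : label (castS a) = bar (label a) := by
  have h : ∀ i : Fin n, upperLabel i.castSucc = bar (upperLabel i) := by
    intro i
    unfold upperLabel
    have h : Even (i.castSucc.rev : ℕ) ↔ ¬ Even (i.rev : ℕ) := by
      rw [Fin.val_rev, Fin.val_rev, Fin.val_castSucc, Nat.even_iff, Nat.even_iff]; omega
    by_cases h' : Even (i.rev : ℕ)
    · rw [if_pos h', if_neg fun h'' => h.1 h'' h']; rfl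
    · rw [if_neg h', if_pos (h.2 h')]; rfl
  rcases a with a | a
  · exact h a
  · change lowerLabel a.castSucc = bar (lowerLabel a)
    rw [lowerLabel_eq, lowerLabel_eq, h]

theorem IsABAdmissible.addStrand {p : Setoid (Fin n ⊕ Fin n)} (hp : IsABAdmissible p) :
    IsABAdmissible (addStrand p) := by
  have hl : ∀ x z : Fin (n + 1) ⊕ Fin (n + 1),
      (x = Sum.inl (Fin.last n) ∨ x = Sum.inr (Fin.last n)) →
      (z = Sum.inl (Fin.last n) ∨ z = Sum.inr (Fin.last n)) → ∀ y, pos x < y → y < pos z → False := by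
    rintro _ _ (rfl | rfl) (rfl | rfl) y h1 h2 <;>
      simp [pos] at h1 h2 <;> omega
  have hinj : Function.Injective (castS : Fin n ⊕ Fin n → _) := fun a b h => by
    have := congrArg unstrand h
    simpa using this
  refine ⟨?_, ?_, ?_⟩
  · intro x y z t hxy hyz hzt hxz hyt
    rcases addStrand_iff.1 hxz with ⟨a, c, rfl, rfl, hac⟩ | ⟨hx, hz⟩
    · rcases addStrand_iff.1 hyt with ⟨b, d, rfl, rfl, hbd⟩ | ⟨hy, ht⟩
      · rw [pos_castS_lt] at hxy hyz hzt
        exact addStrand_iff.2 (Or.inl ⟨a, b, rfl, rfl, hp.noncrossing a b c d hxy hyz hzt hac hbd⟩)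
      · exact (hl _ _ hy ht _ hyz hzt).elim
    · exact (hl _ _ hx hz _ hxy hyz).elim
  · intro x y z hxy hxz
    rcases addStrand_iff.1 hxy with ⟨a, b, rfl, rfl, h⟩ | ⟨hx, hy⟩
    · rcases addStrand_iff.1 hxz with ⟨a', c, ha, rfl, h'⟩ | ⟨hx, _⟩
      · obtain rfl := hinj ha
        rcases hp.card_block_le a b c h h' with h | h | h <;> simp [h]
      · rcases a with a | a <;> simp [castS, Fin.ext_iff] at hx <;> omega
    · rcases addStrand_iff.1 hxz with ⟨a', c, rfl, rfl, h'⟩ | ⟨_, hz⟩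
      · rcases a' with a | a <;> simp [castS, Fin.ext_iff] at hx <;> omega
      · rcases hx with rfl | rfl <;> rcases hy with rfl | rfl <;> rcases hz with rfl | rfl <;> simp
  · intro x y hxy hne
    rcases addStrand_iff.1 hxy with ⟨a, b, rfl, rfl, h⟩ | ⟨hx, hy⟩
    · rw [label_castS, label_castS]
      intro hb
      exact hp.label_ne a b h (fun h => hne (by rw [h])) (by rw [← bar_bar (label a), hb, bar_bar])
    · rcases hx with rfl | rfl <;> rcases hy with rfl | rfl
      · exact absurd rfl hne
      · simp only [label, Sum.elim_inl, Sum.elim_inr, lowerLabel_eq]; exact (bar_ne _).symm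
      · simp only [label, Sum.elim_inl, Sum.elim_inr, lowerLabel_eq]; exact bar_ne _
      · exact absurd rfl hne

/-- The inclusion of the old points of three rows. -/
def castS3 : Fin n ⊕ (Fin n ⊕ Fin n) → Fin (n + 1) ⊕ (Fin (n + 1) ⊕ Fin (n + 1)) :=
  Sum.map Fin.castSucc castS

/-- Removing the rightmost points of three rows. -/
def unstrand3 : Fin (n + 1) ⊕ (Fin (n + 1) ⊕ Fin (n + 1)) → Option (Fin n ⊕ (Fin n ⊕ Fin n)) :=
  Sum.elim (fun i => (strip i).map Sum.inl) (fun x => (unstrand x).map Sum.inr)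

@[simp] theorem unstrand3_castS3 (x : Fin n ⊕ (Fin n ⊕ Fin n)) :
    unstrand3 (castS3 x) = some x := by
  rcases x with x | x <;> simp [unstrand3, castS3]

theorem glue_addStrand (p q : Setoid (Fin n ⊕ Fin n)) :
    glue (addStrand p) (addStrand q) = ((glue p q).map some).comap unstrand3 := by
  have hup : ∀ x : Fin (n + 1) ⊕ Fin (n + 1),
      unstrand3 (Sum.map id Sum.inl x) = (unstrand x).map (Sum.map id Sum.inl) := by
    rintro (x | x) <;> simp only [unstrand3, unstrand, Sum.map_inl, Sum.map_inr, Sum.elim_inl,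
      Sum.elim_inr, id] <;> cases strip x <;> rfl
  apply le_antisymm
  · refine sup_le (map_le_iff.2 ?_) (map_le_iff.2 ?_)
    · intro x y h
      change (glue p q).map some (unstrand3 _) (unstrand3 _)
      rw [hup, hup]
      replace h : p.map some (unstrand x) (unstrand y) := h
      rw [map_inj_iff (Option.some_injective _)] at h
      rcases h with h | ⟨a, b, ha, hb, h⟩
      · rw [h]
      · rw [← ha, ← hb]; exact map_rel (glue_upper h)
    · intro x y h
      change (glue p q).map some (unstrand3 _) (unstrand3 _)
      replace h : q.map some (unstrand x) (unstrand y) := h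
      rw [map_inj_iff (Option.some_injective _)] at h
      simp only [unstrand3, Sum.elim_inr]
      rcases h with h | ⟨a, b, ha, hb, h⟩
      · rw [h]
      · rw [← ha, ← hb]; exact map_rel (glue_lower h)
  · set G := glue (addStrand p) (addStrand q) with hG
    have h1 : glue p q ≤ G.comap castS3 := by
      refine sup_le (map_le_iff.2 ?_) (map_le_iff.2 ?_)
      · intro x y h
        have := glue_upper (q := addStrand q)
          (addStrand_iff.2 (Or.inl ⟨x, y, rfl, rfl, h⟩) : addStrand p (castS x) (castS y))
        have aux : ∀ x : Fin n ⊕ Fin n, (Sum.map id Sum.inl (castS x) :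
            Fin (n + 1) ⊕ (Fin (n + 1) ⊕ Fin (n + 1))) = castS3 (Sum.map id Sum.inl x) := by
          rintro (x | x) <;> rfl
        rw [aux, aux] at this
        exact this
      · intro x y h
        exact glue_lower (p := addStrand p)
          (addStrand_iff.2 (Or.inl ⟨x, y, rfl, rfl, h⟩) : addStrand q (castS x) (castS y))
    have hlast : ∀ e, (∃ d, e = castS3 d) ∨
        (unstrand3 e = none ∧ G e (Sum.inl (Fin.last n))) := by
      have hm : G (Sum.inr (Sum.inl (Fin.last n))) (Sum.inl (Fin.last n)) :=
        glue_upper (x := Sum.inr (Fin.last n)) (y := Sum.inl (Fin.last n))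
          (addStrand_iff.2 (Or.inr ⟨Or.inr rfl, Or.inl rfl⟩))
      rintro (e | e)
      · induction e using Fin.lastCases with
        | last => exact Or.inr ⟨by simp [unstrand3], G.refl _⟩
        | cast i => exact Or.inl ⟨Sum.inl i, rfl⟩
      · rcases eq_castS_or e with ⟨y, rfl⟩ | rfl | rfl
        · exact Or.inl ⟨Sum.inr y, rfl⟩
        · exact Or.inr ⟨by simp [unstrand3, unstrand_last_left], hm⟩
        · refine Or.inr ⟨by simp [unstrand3, unstrand_last_right], G.trans ?_ hm⟩
          exact glue_lower (addStrand_iff.2 (Or.inr ⟨Or.inr rfl, Or.inl rfl⟩))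
    intro e e' h
    replace h : (glue p q).map some (unstrand3 e) (unstrand3 e') := h
    rcases hlast e with ⟨d, rfl⟩ | ⟨h2, h3⟩ <;> rcases hlast e' with ⟨d', rfl⟩ | ⟨h4, h5⟩
    · rw [unstrand3_castS3, unstrand3_castS3, map_some_iff] at h
      exact h1 h
    · rw [unstrand3_castS3, h4] at h
      exact absurd (Setoid.symm' _ h) (map_some_none _ _)
    · rw [unstrand3_castS3, h2] at h
      exact absurd h (map_some_none _ _)
    · exact G.trans h3 (G.symm h5)

theorem comp_addStrand (p q : Setoid (Fin n ⊕ Fin n)) :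
    comp (addStrand p) (addStrand q) = addStrand (comp p q) := by
  ext x y
  change glue (addStrand p) (addStrand q) (outer x) (outer y) ↔ _
  rw [glue_addStrand]
  change (glue p q).map some (unstrand3 (outer x)) (unstrand3 (outer y)) ↔
    (comp p q).map some (unstrand x) (unstrand y)
  have hup : ∀ x : Fin (n + 1) ⊕ Fin (n + 1), unstrand3 (outer x) = (unstrand x).map outer := by
    rintro (x | x) <;> simp only [unstrand3, unstrand, outer, Sum.map_inl, Sum.map_inr,
      Sum.elim_inl, Sum.elim_inr, id] <;> cases strip x <;> rfl
  rw [hup, hup]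
  cases unstrand x <;> cases unstrand y
  · exact ⟨fun _ => Setoid.refl' _ _, fun _ => Setoid.refl' _ _⟩
  · exact ⟨fun h => absurd h (map_some_none _ _), fun h => absurd h (map_some_none _ _)⟩
  · exact ⟨fun h => absurd (Setoid.symm' _ h) (map_some_none _ _),
      fun h => absurd (Setoid.symm' _ h) (map_some_none _ _)⟩
  · rw [Option.map_some, Option.map_some, map_some_iff, map_some_iff]; rfl

theorem loops_addStrand (p q : Setoid (Fin n ⊕ Fin n)) :
    loops (addStrand p) (addStrand q) = loops p q := by
  unfold loops
  rw [glue_addStrand]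
  unfold deadCount
  set G' := ((glue p q).map some).comap (unstrand3 (n := n)) with hG'
  have key : ∀ a b, G' (castS3 a) (castS3 b) ↔ glue p q a b := fun a b => by
    change (glue p q).map some (unstrand3 (castS3 a)) (unstrand3 (castS3 b)) ↔ _
    rw [unstrand3_castS3, unstrand3_castS3, map_some_iff]
  have hout : ∀ x : Fin n ⊕ Fin n, (outer (castS x) :
      Fin (n + 1) ⊕ (Fin (n + 1) ⊕ Fin (n + 1))) = castS3 (outer x) := by
    rintro (x | x) <;> rfl
  let f : Quotient (glue p q) → Quotient G' := Quotient.map castS3 fun a b h => (key a b).2 h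
  refine (Nat.card_congr (Equiv.ofBijective
    (fun c : {c : Quotient (glue p q) // ∀ x, Quotient.mk (glue p q) (outer x) ≠ c} =>
      (⟨f c.1, ?_⟩ : {c : Quotient G' // ∀ x, Quotient.mk _ (outer x) ≠ c})) ⟨?_, ?_⟩)).symm
  · obtain ⟨c, hc⟩ := c
    induction c using Quotient.ind with
    | _ a =>
      intro y hy
      have hy' : G' (outer y) (castS3 a) := Quotient.exact hy
      rcases eq_castS_or y with ⟨x, rfl⟩ | rfl | rfl
      · rw [hout, key] at hy'
        exact hc x (Quotient.sound hy')
      · change (glue p q).map some (unstrand3 (Sum.inl (Fin.last n))) (unstrand3 (castS3 a)) at hy'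
        rw [unstrand3_castS3] at hy'
        simp only [unstrand3, Sum.elim_inl, strip_last, Option.map_none] at hy'
        exact map_some_none _ _ hy'
      · change (glue p q).map some (unstrand3 (Sum.inr (Sum.inr (Fin.last n))))
          (unstrand3 (castS3 a)) at hy'
        rw [unstrand3_castS3] at hy'
        simp only [unstrand3, Sum.elim_inr, unstrand_last_right, Option.map_none] at hy'
        exact map_some_none _ _ hy'
  · rintro ⟨a, ha⟩ ⟨b, hb⟩ hab
    induction a using Quotient.ind
    induction b using Quotient.ind
    have := congrArg Subtype.val hab
    exact Subtype.ext (Quotient.sound ((key _ _).1 (Quotient.exact this)))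
  · rintro ⟨c, hc⟩
    induction c using Quotient.ind with
    | _ e =>
      have hcast : ∀ d, (∀ x, Quotient.mk G' (outer x) ≠ Quotient.mk G' (castS3 d)) →
          ∀ x, Quotient.mk (glue p q) (outer x) ≠ Quotient.mk (glue p q) d := by
        intro d hd x hx
        apply hd (castS x)
        rw [hout]
        exact Quotient.sound ((key _ _).2 (Quotient.exact hx))
      rcases e with e | e
      · exact absurd rfl (hc (Sum.inl e))
      · rcases eq_castS_or e with ⟨y, rfl⟩ | rfl | rfl
        · exact ⟨⟨Quotient.mk _ (Sum.inr y), hcast (Sum.inr y) hc⟩, rfl⟩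
        · refine absurd (Quotient.sound ?_) (hc (Sum.inl (Fin.last n)))
          change (glue p q).map some (unstrand3 (Sum.inl (Fin.last n)))
            (unstrand3 (Sum.inr (Sum.inl (Fin.last n))))
          simp only [unstrand3, Sum.elim_inl, Sum.elim_inr, strip_last, unstrand_last_left,
            Option.map_none]
          exact Setoid.refl' _ _
        · exact absurd rfl (hc (Sum.inr (Fin.last n)))

theorem addStrand_id : addStrand (idDiagram (Fin n)) = idDiagram (Fin (n + 1)) := by
  ext x y
  rw [addStrand_iff]
  constructor
  · rintro (⟨a, b, rfl, rfl, h⟩ | ⟨rfl | rfl, rfl | rfl⟩)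
    · rcases a with a | a <;> rcases b with b | b <;> (obtain rfl : a = b := h) <;> rfl
    all_goals rfl
  · intro h
    have aux : ∀ x : Fin (n + 1) ⊕ Fin (n + 1), Sum.elim id id x = Fin.last n →
        x = Sum.inl (Fin.last n) ∨ x = Sum.inr (Fin.last n) := by
      rintro (x | x) h <;> simp at h <;> simp [h]
    replace h : (Sum.elim id id x : Fin (n + 1)) = Sum.elim id id y := h
    have hc : ∀ a : Fin n ⊕ Fin n, (Sum.elim id id (castS a) : Fin (n + 1)) =
        (Sum.elim id id a : Fin n).castSucc := by
      rintro (a | a) <;> rfl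
    rcases eq_castS_or x with ⟨a, rfl⟩ | hx
    · rcases eq_castS_or y with ⟨b, rfl⟩ | hy
      · rw [hc, hc] at h
        exact Or.inl ⟨a, b, rfl, rfl, Fin.castSucc_injective _ h⟩
      · have : (Sum.elim id id y : Fin (n + 1)) = Fin.last n := by
          rcases hy with rfl | rfl <;> rfl
        exact Or.inr ⟨aux _ (h.trans this), hy⟩
    · have : (Sum.elim id id x : Fin (n + 1)) = Fin.last n := by
        rcases hx with rfl | rfl <;> rfl
      exact Or.inr ⟨hx, aux _ (h.symm.trans this)⟩

end strand

end Diagram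

/-! ## The diagram algebras and their inclusions -/

section algebra

open Diagram

/-- The basis diagrams of the algebra on `n` upper and `n` lower points. -/
def ABDiagram (n : ℕ) : Type := {s : Setoid (Fin n ⊕ Fin n) // IsABAdmissible s}

/-- Link states on `n` points. -/
def LinkState (n : ℕ) : Type := {v : Setoid (Fin n ⊕ Fin 1) // IsLinkState v}

/-- The bilinear map with prescribed values on basis vectors. -/
noncomputable def bilin {P Q M N L : Type} [AddCommGroup M] [AddCommGroup N] [AddCommGroup L]
    [Module ℂ M] [Module ℂ N] [Module ℂ L] (B : Module.Basis P ℂ M) (C : Module.Basis Q ℂ N)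
    (f : P → Q → L) : M →ₗ[ℂ] N →ₗ[ℂ] L :=
  B.constr ℂ fun p => C.constr ℂ fun q => f p q

theorem bilin_basis {P Q M N L : Type} [AddCommGroup M] [AddCommGroup N] [AddCommGroup L]
    [Module ℂ M] [Module ℂ N] [Module ℂ L] (B : Module.Basis P ℂ M) (C : Module.Basis Q ℂ N)
    (f : P → Q → L) (p : P) (q : Q) : bilin B C f (B p) (C q) = f p q := by
  rw [bilin, Module.Basis.constr_basis, Module.Basis.constr_basis]

theorem basis_induction {P M : Type} [AddCommGroup M] [Module ℂ M] (B : Module.Basis P ℂ M)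
    {C : M → Prop} (x : M) (zero : C 0) (add : ∀ x y, C x → C y → C (x + y))
    (smul : ∀ (c : ℂ) x, C x → C (c • x)) (basis : ∀ p, C (B p)) : C x := by
  have hx : x ∈ Submodule.span ℂ (Set.range B) := by rw [B.span_eq]; trivial
  induction hx using Submodule.span_induction with
  | zero => exact zero
  | add x y _ _ hx hy => exact add x y hx hy
  | smul c x _ hx => exact smul c x hx
  | mem x hx => obtain ⟨p, rfl⟩ := hx; exact basis p

/-- The diagram algebra with loop parameter `δ`: the free vector space on the diagrams. -/
def DiagAlg (_δ : ℂ) (n : ℕ) : Type := ABDiagram n →₀ ℂ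

/-- The free vector space on the link states. -/
def LinkModule (_δ : ℂ) (n : ℕ) : Type := LinkState n →₀ ℂ

noncomputable instance (δ : ℂ) (n : ℕ) : AddCommGroup (DiagAlg δ n) :=
  inferInstanceAs (AddCommGroup (ABDiagram n →₀ ℂ))

noncomputable instance (δ : ℂ) (n : ℕ) : Module ℂ (DiagAlg δ n) :=
  inferInstanceAs (Module ℂ (ABDiagram n →₀ ℂ))

noncomputable instance (δ : ℂ) (n : ℕ) : AddCommGroup (LinkModule δ n) :=
  inferInstanceAs (AddCommGroup (LinkState n →₀ ℂ))

noncomputable instance (δ : ℂ) (n : ℕ) : Module ℂ (LinkModule δ n) :=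
  inferInstanceAs (Module ℂ (LinkState n →₀ ℂ))

/-- The basis of diagrams. -/
noncomputable def diagBasis (δ : ℂ) (n : ℕ) : Module.Basis (ABDiagram n) ℂ (DiagAlg δ n) :=
  Module.Basis.ofRepr (LinearEquiv.refl ℂ (ABDiagram n →₀ ℂ))

/-- The basis of link states. -/
noncomputable def linkBasis (δ : ℂ) (n : ℕ) : Module.Basis (LinkState n) ℂ (LinkModule δ n) :=
  Module.Basis.ofRepr (LinearEquiv.refl ℂ (LinkState n →₀ ℂ))

variable {δ : ℂ} {n : ℕ}

/-- `p` drawn on top of `q`. -/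
def ABDiagram.comp (p q : ABDiagram n) : ABDiagram n := ⟨Diagram.comp p.1 q.1, p.2.comp q.2⟩

/-- The identity diagram. -/
def ABDiagram.one (n : ℕ) : ABDiagram n := ⟨idDiagram (Fin n), IsABAdmissible.idDiagram⟩

/-- `p` drawn on top of the link state `v`. A block without upper point that contains the extra
point, that is, a line with a defect, is not counted as a loop. -/
def LinkState.act (p : ABDiagram n) (v : LinkState n) : LinkState n :=
  ⟨Diagram.comp p.1 v.1, IsLinkState.comp p.2 v.2⟩

/-- Multiplication of the diagram algebra: `e_p * e_q = δ ^ loops • e_(p on top of q)`. -/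
noncomputable def DiagAlg.mulMap (δ : ℂ) (n : ℕ) :
    DiagAlg δ n →ₗ[ℂ] DiagAlg δ n →ₗ[ℂ] DiagAlg δ n :=
  bilin (diagBasis δ n) (diagBasis δ n) fun p q => δ ^ loops p.1 q.1 • diagBasis δ n (p.comp q)

/-- Action on link states: `e_p • v = δ ^ loops • (p on top of v)`. -/
noncomputable def DiagAlg.smulMap (δ : ℂ) (n : ℕ) :
    DiagAlg δ n →ₗ[ℂ] LinkModule δ n →ₗ[ℂ] LinkModule δ n :=
  bilin (diagBasis δ n) (linkBasis δ n) fun p v => δ ^ loops p.1 v.1 • linkBasis δ n (v.act p)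

noncomputable instance : Mul (DiagAlg δ n) := ⟨fun x y => DiagAlg.mulMap δ n x y⟩

noncomputable instance : SMul (DiagAlg δ n) (LinkModule δ n) :=
  ⟨fun x m => DiagAlg.smulMap δ n x m⟩

noncomputable instance : One (DiagAlg δ n) := ⟨diagBasis δ n (ABDiagram.one n)⟩

theorem DiagAlg.mul_def (x y : DiagAlg δ n) : x * y = DiagAlg.mulMap δ n x y := rfl

theorem DiagAlg.smul_def (x : DiagAlg δ n) (m : LinkModule δ n) :
    x • m = DiagAlg.smulMap δ n x m := rfl

theorem DiagAlg.one_def : (1 : DiagAlg δ n) = diagBasis δ n (ABDiagram.one n) := rfl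

theorem DiagAlg.basis_mul (p q : ABDiagram n) :
    diagBasis δ n p * diagBasis δ n q = δ ^ loops p.1 q.1 • diagBasis δ n (p.comp q) :=
  bilin_basis _ _ _ p q

theorem DiagAlg.basis_smul (p : ABDiagram n) (v : LinkState n) :
    diagBasis δ n p • linkBasis δ n v = δ ^ loops p.1 v.1 • linkBasis δ n (v.act p) :=
  bilin_basis _ _ _ p v

theorem DiagAlg.add_mul' (x y z : DiagAlg δ n) : (x + y) * z = x * z + y * z := by
  simp only [DiagAlg.mul_def, map_add, LinearMap.add_apply]

theorem DiagAlg.mul_add' (x y z : DiagAlg δ n) : x * (y + z) = x * y + x * z := by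
  simp only [DiagAlg.mul_def, map_add]

theorem DiagAlg.zero_mul' (x : DiagAlg δ n) : 0 * x = 0 := by
  simp only [DiagAlg.mul_def, map_zero, LinearMap.zero_apply]

theorem DiagAlg.mul_zero' (x : DiagAlg δ n) : x * 0 = 0 := by
  simp only [DiagAlg.mul_def, map_zero]

theorem DiagAlg.smul_mul' (c : ℂ) (x y : DiagAlg δ n) : c • x * y = c • (x * y) := by
  simp only [DiagAlg.mul_def, map_smul, LinearMap.smul_apply]

theorem DiagAlg.mul_smul_comm' (c : ℂ) (x y : DiagAlg δ n) : x * c • y = c • (x * y) := by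
  simp only [DiagAlg.mul_def, map_smul]

theorem DiagAlg.add_act (x y : DiagAlg δ n) (m : LinkModule δ n) :
    (x + y) • m = x • m + y • m := by
  simp only [DiagAlg.smul_def, map_add, LinearMap.add_apply]

theorem DiagAlg.act_add (x : DiagAlg δ n) (m m' : LinkModule δ n) :
    x • (m + m') = x • m + x • m' := by
  simp only [DiagAlg.smul_def, map_add]

theorem DiagAlg.zero_act (m : LinkModule δ n) : (0 : DiagAlg δ n) • m = 0 := by
  simp only [DiagAlg.smul_def, map_zero, LinearMap.zero_apply]

theorem DiagAlg.act_zero (x : DiagAlg δ n) : x • (0 : LinkModule δ n) = 0 := by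
  simp only [DiagAlg.smul_def, map_zero]

theorem DiagAlg.smul_act (c : ℂ) (x : DiagAlg δ n) (m : LinkModule δ n) :
    (c • x) • m = c • (x • m) := by
  simp only [DiagAlg.smul_def, map_smul, LinearMap.smul_apply]

theorem DiagAlg.act_smul (c : ℂ) (x : DiagAlg δ n) (m : LinkModule δ n) :
    x • (c • m) = c • (x • m) := by
  simp only [DiagAlg.smul_def, map_smul]

theorem DiagAlg.mul_assoc' (x y z : DiagAlg δ n) : x * y * z = x * (y * z) := by
  induction x using basis_induction (diagBasis δ n) with
  | zero => simp only [DiagAlg.zero_mul']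
  | add x x' h h' => simp only [DiagAlg.add_mul', h, h']
  | smul c x h => simp only [DiagAlg.smul_mul', h]
  | basis p =>
    induction y using basis_induction (diagBasis δ n) with
    | zero => simp only [DiagAlg.zero_mul', DiagAlg.mul_zero']
    | add x x' h h' => simp only [DiagAlg.add_mul', DiagAlg.mul_add', h, h']
    | smul c x h => simp only [DiagAlg.smul_mul', DiagAlg.mul_smul_comm', h]
    | basis q =>
      induction z using basis_induction (diagBasis δ n) with
      | zero => simp only [DiagAlg.mul_zero']
      | add x x' h h' => simp only [DiagAlg.mul_add', h, h']
      | smul c x h => simp only [DiagAlg.mul_smul_comm', h]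
      | basis r =>
        have h : (p.comp q).comp r = p.comp (q.comp r) := Subtype.ext (comp_assoc p.1 q.1 r.1)
        have h' := loops_assoc p.1 q.1 r.1
        simp only [DiagAlg.basis_mul, DiagAlg.smul_mul', DiagAlg.mul_smul_comm', smul_smul, h,
          ← pow_add]
        exact congrArg (fun k => δ ^ k • diagBasis δ n (p.comp (q.comp r))) h'

theorem DiagAlg.mul_act (x y : DiagAlg δ n) (m : LinkModule δ n) :
    (x * y) • m = x • (y • m) := by
  induction x using basis_induction (diagBasis δ n) with
  | zero => simp only [DiagAlg.zero_mul', DiagAlg.zero_act]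
  | add x x' h h' => simp only [DiagAlg.add_mul', DiagAlg.add_act, h, h']
  | smul c x h => simp only [DiagAlg.smul_mul', DiagAlg.smul_act, h]
  | basis p =>
    induction y using basis_induction (diagBasis δ n) with
    | zero => simp only [DiagAlg.mul_zero', DiagAlg.zero_act, DiagAlg.act_zero]
    | add x x' h h' => simp only [DiagAlg.mul_add', DiagAlg.add_act, DiagAlg.act_add, h, h']
    | smul c x h => simp only [DiagAlg.mul_smul_comm', DiagAlg.smul_act, DiagAlg.act_smul, h]
    | basis q =>
      induction m using basis_induction (linkBasis δ n) with
      | zero => simp only [DiagAlg.act_zero]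
      | add x x' h h' => simp only [DiagAlg.act_add, h, h']
      | smul c x h => simp only [DiagAlg.act_smul, h]
      | basis v =>
        have h : LinkState.act (p.comp q) v = (v.act q).act p :=
          Subtype.ext (comp_assoc p.1 q.1 v.1)
        have h' := loops_assoc p.1 q.1 v.1
        simp only [DiagAlg.basis_mul, DiagAlg.basis_smul, DiagAlg.smul_act, DiagAlg.act_smul,
          smul_smul, h, ← pow_add]
        exact congrArg (fun k => δ ^ k • linkBasis δ n ((v.act q).act p)) h'

theorem DiagAlg.one_mul' (x : DiagAlg δ n) : 1 * x = x := by
  induction x using basis_induction (diagBasis δ n) with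
  | zero => exact DiagAlg.mul_zero' _
  | add x x' h h' => rw [DiagAlg.mul_add', h, h']
  | smul c x h => rw [DiagAlg.mul_smul_comm', h]
  | basis p =>
    have h : (ABDiagram.one n).comp p = p := Subtype.ext (comp_id_left p.1)
    have h' : loops (ABDiagram.one n).1 p.1 = 0 := loops_id_left p.1
    rw [DiagAlg.one_def, DiagAlg.basis_mul, h, h', pow_zero, one_smul]

theorem DiagAlg.mul_one' (x : DiagAlg δ n) : x * 1 = x := by
  induction x using basis_induction (diagBasis δ n) with
  | zero => exact DiagAlg.zero_mul' _
  | add x x' h h' => rw [DiagAlg.add_mul', h, h']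
  | smul c x h => rw [DiagAlg.smul_mul', h]
  | basis p =>
    have h : p.comp (ABDiagram.one n) = p := Subtype.ext (comp_id_right p.1)
    have h' : loops p.1 (ABDiagram.one n).1 = 0 := loops_id_right p.1
    rw [DiagAlg.one_def, DiagAlg.basis_mul, h, h', pow_zero, one_smul]

theorem DiagAlg.one_act (m : LinkModule δ n) : (1 : DiagAlg δ n) • m = m := by
  induction m using basis_induction (linkBasis δ n) with
  | zero => exact DiagAlg.act_zero _
  | add x x' h h' => rw [DiagAlg.act_add, h, h']
  | smul c x h => rw [DiagAlg.act_smul, h]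
  | basis v =>
    have h : v.act (ABDiagram.one n) = v := Subtype.ext (comp_id_left v.1)
    have h' : loops (ABDiagram.one n).1 v.1 = 0 := loops_id_left v.1
    rw [DiagAlg.one_def, DiagAlg.basis_smul, h, h', pow_zero, one_smul]

noncomputable instance : Ring (DiagAlg δ n) :=
  { (inferInstance : AddCommGroup (DiagAlg δ n)),
    (inferInstance : Mul (DiagAlg δ n)), (inferInstance : One (DiagAlg δ n)) with
    left_distrib := DiagAlg.mul_add'
    right_distrib := DiagAlg.add_mul'
    zero_mul := DiagAlg.zero_mul'
    mul_zero := DiagAlg.mul_zero'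
    mul_assoc := DiagAlg.mul_assoc'
    one_mul := DiagAlg.one_mul'
    mul_one := DiagAlg.mul_one' }

noncomputable instance : Algebra ℂ (DiagAlg δ n) :=
  Algebra.ofModule DiagAlg.smul_mul' DiagAlg.mul_smul_comm'

noncomputable instance : Module (DiagAlg δ n) (LinkModule δ n) where
  one_smul := DiagAlg.one_act
  mul_smul := DiagAlg.mul_act
  smul_zero := DiagAlg.act_zero
  smul_add := DiagAlg.act_add
  add_smul := DiagAlg.add_act
  zero_smul := DiagAlg.zero_act

instance : IsScalarTower ℂ (DiagAlg δ n) (LinkModule δ n) := ⟨DiagAlg.smul_act⟩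

/-- A diagram with a through string added on the right. -/
def ABDiagram.addStrand (p : ABDiagram n) : ABDiagram (n + 1) :=
  ⟨Diagram.addStrand p.1, p.2.addStrand⟩

/-- The linear map that adds a through string on the right of every diagram. -/
noncomputable def DiagAlg.inclLinear (δ : ℂ) (n : ℕ) : DiagAlg δ n →ₗ[ℂ] DiagAlg δ (n + 1) :=
  (diagBasis δ n).constr ℂ fun p => diagBasis δ (n + 1) p.addStrand

theorem DiagAlg.inclLinear_basis (p : ABDiagram n) :
    DiagAlg.inclLinear δ n (diagBasis δ n p) = diagBasis δ (n + 1) p.addStrand :=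
  Module.Basis.constr_basis _ _ _ _

/-- The inclusion of algebras that adds a through string on the right of every diagram. -/
noncomputable def DiagAlg.incl (δ : ℂ) (n : ℕ) : DiagAlg δ n →ₐ[ℂ] DiagAlg δ (n + 1) :=
  AlgHom.ofLinearMap (DiagAlg.inclLinear δ n)
    (by
      have h : (ABDiagram.one n).addStrand = ABDiagram.one (n + 1) := Subtype.ext addStrand_id
      rw [DiagAlg.one_def, DiagAlg.inclLinear_basis, h, DiagAlg.one_def])
    (by
      intro x y
      induction x using basis_induction (diagBasis δ n) with
      | zero => rw [zero_mul, map_zero, zero_mul]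
      | add x x' h h' => rw [add_mul, map_add, h, h', map_add, add_mul]
      | smul c x h => rw [smul_mul_assoc, map_smul, h, map_smul, smul_mul_assoc]
      | basis p =>
        induction y using basis_induction (diagBasis δ n) with
        | zero => rw [mul_zero, map_zero, mul_zero]
        | add x x' h h' => rw [mul_add, map_add, h, h', map_add, mul_add]
        | smul c x h => rw [mul_smul_comm, map_smul, h, map_smul, mul_smul_comm]
        | basis q =>
          have h : (p.comp q).addStrand = p.addStrand.comp q.addStrand :=
            Subtype.ext (comp_addStrand p.1 q.1).symm
          have h' : loops p.addStrand.1 q.addStrand.1 = loops p.1 q.1 :=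
            loops_addStrand p.1 q.1
          rw [DiagAlg.basis_mul, map_smul, DiagAlg.inclLinear_basis, DiagAlg.inclLinear_basis,
            DiagAlg.inclLinear_basis, DiagAlg.basis_mul, h, h'])

end algebra

/-! ## The modules spanned by link states -/

section modules

open Diagram

/-- The alternating word of length `n` that ends in `a`. -/
def alternatingWord (n : ℕ) : List Letter := List.ofFn (upperLabel : Fin n → Letter)

/-- The subwords of the alternating word of length `n` ending in `a`. -/
def subwords (n : ℕ) : Set (List Letter) := {w | w.Sublist (alternatingWord n)}

/-- The subwords with `k` letters `a` and `l` letters `b`. -/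
def subwordsOf (n k l : ℕ) : Set (List Letter) :=
  {w ∈ subwords n | w.count Letter.a = k ∧ w.count Letter.b = l}

/-- The number of defects of a link state. -/
noncomputable def LinkState.defects {n : ℕ} (v : LinkState n) : ℕ := defectCount v.1

/-- The number of defects of a link state with label `x`. -/
noncomputable def LinkState.defectsWith {n : ℕ} (v : LinkState n) (x : Letter) : ℕ :=
  Nat.card {i // Defect v.1 i ∧ upperLabel i = x}

open Classical in
/-- The boundary word: the labels of the defects from left to right. -/
noncomputable def LinkState.word {n : ℕ} (v : LinkState n) : List Letter :=
  ((List.finRange n).filter fun i => Defect v.1 i).map upperLabel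

variable (δ : ℂ) (n : ℕ)

/-- `M_(n,d)`: the span of the link states with at most `d` defects, a submodule of the module
spanned by all link states. -/
noncomputable def linkSub (d : ℕ) : Submodule (DiagAlg δ n) (LinkModule δ n) :=
  { Submodule.span ℂ {x | ∃ v : LinkState n, v.defects ≤ d ∧ x = linkBasis δ n v} with
    smul_mem' := by
      intro x m hm
      change m ∈ Submodule.span ℂ {x | ∃ v : LinkState n, v.defects ≤ d ∧ x = linkBasis δ n v} at hm
      change x • m ∈ Submodule.span ℂ {x | ∃ v : LinkState n, v.defects ≤ d ∧ x = linkBasis δ n v}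
      induction x using basis_induction (diagBasis δ n) with
      | zero => rw [zero_smul]; exact Submodule.zero_mem _
      | add x y hx hy => rw [add_smul]; exact Submodule.add_mem _ hx hy
      | smul c x hx => rw [smul_assoc]; exact Submodule.smul_mem _ c hx
      | basis p =>
        induction hm using Submodule.span_induction with
        | zero => rw [smul_zero]; exact Submodule.zero_mem _
        | add m m' _ _ hm hm' => rw [smul_add]; exact Submodule.add_mem _ hm hm'
        | smul c m _ hm => rw [DiagAlg.act_smul]; exact Submodule.smul_mem _ c hm
        | mem m hm =>
          obtain ⟨v, hv, rfl⟩ := hm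
          rw [DiagAlg.basis_smul]
          exact Submodule.smul_mem _ _ (Submodule.subset_span
            ⟨v.act p, (defectCount_comp_le p.2 v.2).trans hv, rfl⟩) }

theorem linkBasis_mem_linkSub {v : LinkState n} {d : ℕ} (h : v.defects ≤ d) :
    linkBasis δ n v ∈ linkSub δ n d :=
  Submodule.subset_span (s := {x | ∃ v : LinkState n, v.defects ≤ d ∧ x = linkBasis δ n v}) ⟨v, h, rfl⟩

/-- `M_(n,d-1)`, with the convention that it is zero for `d = 0`. -/
noncomputable def linkSubPrev : ℕ → Submodule (DiagAlg δ n) (LinkModule δ n)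
  | 0 => ⊥
  | d + 1 => linkSub δ n d

/-- The quotient `V_(n,d) = M_(n,d) / M_(n,d-1)`, where `V_(n,0) = M_(n,0)`. -/
abbrev LinkQuot (d : ℕ) : Type :=
  linkSub δ n d ⧸ (linkSubPrev δ n d).submoduleOf (linkSub δ n d)

/-- The class in `V_(n,d)` of a link state with at most `d` defects. -/
noncomputable def linkClass {d : ℕ} (v : LinkState n) (h : v.defects ≤ d) : LinkQuot δ n d :=
  Submodule.Quotient.mk ⟨linkBasis δ n v, linkBasis_mem_linkSub δ n h⟩

/-- The classes in `V_(n,d)` of the link states with `d` defects,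
`k` of them labelled `a` and `l` labelled `b`. -/
def klClasses (d k l : ℕ) : Set (LinkQuot δ n d) :=
  {x | ∃ (v : LinkState n) (h : v.defects = d),
    v.defectsWith Letter.a = k ∧ v.defectsWith Letter.b = l ∧ x = linkClass δ n v h.le}

/-- The classes in `V_(n,d)` of the link states with `d` defects and boundary word `w`. -/
def wordClasses (d : ℕ) (w : List Letter) : Set (LinkQuot δ n d) :=
  {x | ∃ (v : LinkState n) (h : v.defects = d), v.word = w ∧ x = linkClass δ n v h.le}

/-- `V_(n,k,l)`, as the submodule of `V_(n,d)`, `d = k + l`, generated by the classes of the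
link states with `k` defects labelled `a` and `l` defects labelled `b`. -/
noncomputable def klModule (d k l : ℕ) : Submodule (DiagAlg δ n) (LinkQuot δ n d) :=
  Submodule.span _ (klClasses δ n d k l)

/-- `V_w`, as the submodule of `V_(n,d)`, `d = |w|`, generated by the classes of the link states
with boundary word `w`. -/
noncomputable def wordModule (d : ℕ) (w : List Letter) : Submodule (DiagAlg δ n) (LinkQuot δ n d) :=
  Submodule.span _ (wordClasses δ n d w)

end modules

/-! ## Branching graphs -/

/-- A graph whose vertices are arranged in levels and whose edges connect vertices of consecutive
levels, given by the numbers of edges. -/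
structure GradedGraph where
  /-- The vertices of a level. -/
  V : ℕ → Type*
  /-- The number of edges between two vertices of consecutive levels. -/
  edges : ∀ n, V n → V (n + 1) → ℕ∞

namespace GradedGraph

/-- Isomorphisms of graded graphs. -/
structure Iso (Γ : GradedGraph) (Δ : GradedGraph) where
  /-- The bijections of the levels. -/
  toEquiv : ∀ n, Γ.V n ≃ Δ.V n
  edges_eq : ∀ n v w, Δ.edges n (toEquiv n v) (toEquiv (n + 1) w) = Γ.edges n v w

/-- The number of edges between two vertices of arbitrary levels. -/
def edgesBetween (Γ : GradedGraph) (v w : Σ k, Γ.V k) : ℕ∞ :=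
  if h : w.1 = v.1 + 1 then Γ.edges v.1 v.2 (h ▸ w.2)
  else if h : v.1 = w.1 + 1 then Γ.edges w.1 w.2 (h ▸ v.2)
  else 0

/-- The pascalization: the vertices of level `n` are the vertices `v` of the levels `k ≤ n` with
`k ≡ n` modulo two, and the number of edges between `(n, v)` and `(n + 1, w)` is the
number of edges between `v` and `w`. -/
def pascalization (Γ : GradedGraph) : GradedGraph where
  V n := {v : Σ k, Γ.V k // v.1 ≤ n ∧ v.1 ≡ n [MOD 2]}
  edges _ v w := Γ.edgesBetween v.1 w.1

/-- The graph with level zero removed. -/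
def derooted (Γ : GradedGraph) : GradedGraph where
  V n := Γ.V (n + 1)
  edges n := Γ.edges (n + 1)

open Classical in
/-- The Fibonacci tree: the words that are empty or start with `a` and in which no two letters `b`
are next to each other, a word being connected to the words obtained by appending a letter. -/
noncomputable def fibonacciTree : GradedGraph where
  V n := {w : List Letter // w.length = n ∧ (w = [] ∨ [Letter.a] <+: w) ∧
    ¬ [Letter.b, Letter.b] <:+: w}
  edges _ v w := if w.1 = v.1 ++ [Letter.a] ∨ w.1 = v.1 ++ [Letter.b] then 1 else 0

end GradedGraph

/-- Simple modules over `R`. -/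
abbrev SimpleModule (R : Type) [Ring R] : Type 1 := {M : ModuleCat.{0} R // IsSimpleModule R M}

/-- Isomorphism of simple modules. -/
instance SimpleModule.setoid (R : Type) [Ring R] : Setoid (SimpleModule R) where
  r M N := Nonempty (M.1 ≃ₗ[R] N.1)
  iseqv := ⟨fun _ => ⟨LinearEquiv.refl _ _⟩, fun ⟨e⟩ => ⟨e.symm⟩, fun ⟨e⟩ ⟨f⟩ => ⟨e.trans f⟩⟩

/-- The isomorphism classes of simple modules over `R`. -/
def SimpleClass (R : Type) [Ring R] : Type 1 := Quotient (SimpleModule.setoid R)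

/-- The multiplicity of the simple module `S` in the decomposition of the semisimple module `M`,
that is, the number of summands of the sum of all submodules isomorphic to `S`. -/
noncomputable def moduleMultiplicity (R : Type) [Ring R] (S M : ModuleCat.{0} R) : ℕ∞ :=
  Module.length R (isotypicComponent R M S)

theorem isotypicComponent_map {R : Type} [Ring R] {M N S : Type} [AddCommGroup M] [AddCommGroup N]
    [AddCommGroup S] [Module R M] [Module R N] [Module R S] (e : M ≃ₗ[R] N) :
    (isotypicComponent R M S).map (e : M →ₗ[R] N) = isotypicComponent R N S := by
  have key : ∀ {M N : Type} [AddCommGroup M] [AddCommGroup N] [Module R M] [Module R N]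
      (e : M ≃ₗ[R] N), (isotypicComponent R M S).map (e : M →ₗ[R] N) ≤ isotypicComponent R N S := by
    intro M N _ _ _ _ e
    rw [Submodule.map_le_iff_le_comap]
    refine sSup_le ?_
    rintro m ⟨f⟩
    rw [← Submodule.map_le_iff_le_comap]
    exact le_sSup ⟨(e.submoduleMap m).symm.trans f⟩
  refine le_antisymm (key e) ?_
  have := key e.symm
  rw [Submodule.map_le_iff_le_comap] at this
  intro x hx
  exact ⟨e.symm x, this hx, e.apply_symm_apply x⟩

theorem moduleMultiplicity_congr {R : Type} [Ring R] {S S' M M' : ModuleCat.{0} R}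
    (f : S ≃ₗ[R] S') (e : M ≃ₗ[R] M') : moduleMultiplicity R S M = moduleMultiplicity R S' M' := by
  unfold moduleMultiplicity
  rw [f.isotypicComponent_eq, ← isotypicComponent_map e]
  exact (e.submoduleMap _).length_eq

/-- The induction/restriction graph of a sequence of algebras: the vertices of level `n` are the
isomorphism classes of simple modules of the `n`-th algebra, and the number of edges between `v`
and `w` is the multiplicity of `v` in the restriction of `w`. -/
noncomputable def branchingGraph (A : ℕ → Type) [∀ n, Ring (A n)]
    (f : ∀ n, A n →+* A (n + 1)) : GradedGraph where
  V n := SimpleClass (A n)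
  edges n v w := Quotient.liftOn₂ v w
    (fun S M => moduleMultiplicity (A n) S.1 ((ModuleCat.restrictScalars (f n)).obj M.1))
    (by
      rintro S M S' M' ⟨e⟩ ⟨g⟩
      exact moduleMultiplicity_congr e
        ((ModuleCat.restrictScalars (f n)).mapIso g.toModuleIso).toLinearEquiv)

/-! Cutting a diagram between its two rows turns every through string into a defect of the upper
half and a defect of the lower half. Both halves are link states, and since strings cannot cross and
join different letters, both have the same boundary word. Conversely, two link states with the same
boundary word are the halves of exactly one diagram (`ABDiagram.join`, `IsABAdmissible.ext_halves`).
The algebra therefore behaves like a cellular algebra whose cells are labelled by the subwords of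
the alternating word.

Stacking can only lose through strings, and when none is lost the lower ends stay where they are; as
the word of a diagram can be read at its lower ends, an action that keeps the number of defects
keeps the boundary word (`LinkState.word_act`). So in the quotient for `d` defects a diagram sends
the class of a link state to zero or to a multiple of a class with the same word. The classes with
exactly `d` defects form a basis, and every set of words spans a submodule; this gives both direct
sum decompositions.

Semisimplicity is used through the ideal spanned by the diagrams with word `w` and by all diagrams
with fewer than `|w|` strings. It is two-sided, so it has a left identity `z`
(`exists_left_identity`). Since `δ ≠ 0` (otherwise `A_1` has a nilpotent ideal), `z` is the identity
on `V_w`. A diagram of word `w` maps `V_w` into the line of its upper half, and joins move that link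
state to every other one; hence any nonzero vector generates `V_w`. The same `z` kills `V_{w'}` for
every other word `w'` at least as long as `w`, which separates the modules. For an arbitrary simple
module `S`, a diagram `p` with as few strings as possible that does not kill `S` gives a nonzero map
to `S` from the module of its word.

For the branching rule, the last point of a link state on `n + 1` points is a proper singleton, a
defect, or paired. The first two kinds span a submodule of the restriction of `V_w`, isomorphic to
`V_{w̄}` plus, if `w = w'a`, `V_{w̄'}`, where the bar exchanges the letters. In the quotient,
removing the last point frees its partner as a new rightmost defect with letter `a`, which gives
`V_{w̄a}`. All multiplicities are at most one because these words have different lengths.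

Finally, embed a word into the alternating word greedily from the right: each letter uses one or two
places. Recording `a` for one place and `ab` for two, after an initial `a` or `ab` that fixes the
parity, gives a word of the Fibonacci tree. This encoding is bijective, and the three branching
relations become the appending or deletion of one letter (`appendAdj_levelWord`). -/

namespace Diagram

/-! ### Blocks that survive composition -/

section gluing

variable {X Y Z : Type} {p : Setoid (X ⊕ Y)} {q : Setoid (Y ⊕ Z)}

/-- A property that is inherited along the lines of both layers is inherited along the lines of
the stacked picture. -/
theorem glue_induction {P : X ⊕ (Y ⊕ Z) → Prop}
    (h1 : ∀ x y, p x y → P (Sum.map id Sum.inl x) → P (Sum.map id Sum.inl y))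
    (h2 : ∀ x y, q x y → P (Sum.inr x) → P (Sum.inr y)) {a b : X ⊕ (Y ⊕ Z)}
    (h : glue p q a b) (ha : P a) : P b := by
  have hle : glue p q ≤ Setoid.ker P := by
    refine sup_le (map_le_iff.2 fun x y h => ?_) (map_le_iff.2 fun x y h => ?_)
    · exact propext ⟨h1 x y h, h1 y x (p.symm h)⟩
    · exact propext ⟨h2 x y h, h2 y x (q.symm h)⟩
  have : P a = P b := hle h
  rwa [← this]

theorem glue_of_upper {x y : X ⊕ Y} (h : p x y) :
    glue p q (Sum.map id Sum.inl x) (Sum.map id Sum.inl y) :=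
  (le_sup_left : _ ≤ glue p q) (map_rel h)

theorem glue_of_lower {x y : Y ⊕ Z} (h : q x y) : glue p q (Sum.inr x) (Sum.inr y) :=
  (le_sup_right : _ ≤ glue p q) (map_rel h)

theorem glue_mono {p p' : Setoid (X ⊕ Y)} {q q' : Setoid (Y ⊕ Z)} (hp : p ≤ p') (hq : q ≤ q') :
    glue p q ≤ glue p' q' :=
  sup_le (map_le_iff.2 fun _ _ h => glue_of_upper (hp h))
    (map_le_iff.2 fun _ _ h => glue_of_lower (hq h))

theorem comp_mono_right {q q' : Setoid (Y ⊕ Z)} (hq : q ≤ q') : comp p q ≤ comp p q' :=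
  fun _ _ h => glue_mono le_rfl hq h

/-- An upper point whose block contains a lower point. -/
def Through (p : Setoid (X ⊕ Y)) (x : X) : Prop := ∃ y, p (Sum.inl x) (Sum.inr y)

/-- A lower point whose block contains an upper point. -/
def CoThrough (p : Setoid (X ⊕ Y)) (y : Y) : Prop := ∃ x, p (Sum.inl x) (Sum.inr y)

/-- A line leaves the upper row only along a block with a point in the middle row, so a block
without such a point is untouched by whatever is placed below. With the mirror image `glue_inr_iff`,
this makes the halves of a product computable. -/
theorem glue_inl_iff {x : X} (hx : ¬ Through p x) {e : X ⊕ (Y ⊕ Z)} :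
    glue p q (Sum.inl x) e ↔ ∃ x', e = Sum.inl x' ∧ p (Sum.inl x) (Sum.inl x') := by
  constructor
  · intro h
    refine glue_induction (P := fun e => ∃ x', e = Sum.inl x' ∧ p (Sum.inl x) (Sum.inl x'))
      ?_ ?_ h ⟨x, rfl, p.refl _⟩
    · rintro (a | a) (b | b) hab ⟨x', hx', h'⟩
      · obtain rfl : a = x' := by simpa using hx'
        exact ⟨b, rfl, p.trans h' hab⟩
      · obtain rfl : a = x' := by simpa using hx'
        exact absurd ⟨b, p.trans h' hab⟩ hx
      · simp at hx'
      · simp at hx'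
    · rintro a b _ ⟨x', hx', _⟩
      simp at hx'
  · rintro ⟨x', rfl, h⟩
    exact glue_of_upper h

theorem glue_inr_iff {z : Z} (hz : ¬ CoThrough q z) {e : X ⊕ (Y ⊕ Z)} :
    glue p q (Sum.inr (Sum.inr z)) e ↔
      ∃ z', e = Sum.inr (Sum.inr z') ∧ q (Sum.inr z) (Sum.inr z') := by
  constructor
  · intro h
    refine glue_induction
      (P := fun e => ∃ z', e = Sum.inr (Sum.inr z') ∧ q (Sum.inr z) (Sum.inr z'))
      ?_ ?_ h ⟨z, rfl, q.refl _⟩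
    · rintro (a | a) (b | b) hab ⟨x', hx', _⟩ <;> simp at hx'
    · rintro (a | a) (b | b) hab ⟨x', hx', h'⟩
      · simp at hx'
      · simp at hx'
      · obtain rfl : a = x' := by simpa using hx'
        exact absurd ⟨b, q.symm (q.trans h' hab)⟩ hz
      · obtain rfl : a = x' := by simpa using hx'
        exact ⟨b, rfl, q.trans h' hab⟩
  · rintro ⟨x', rfl, h⟩
    exact glue_of_lower h

theorem comp_inl_iff {x : X} (hx : ¬ Through p x) {e : X ⊕ Z} :
    comp p q (Sum.inl x) e ↔ ∃ x', e = Sum.inl x' ∧ p (Sum.inl x) (Sum.inl x') := by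
  change glue p q (Sum.inl x) (outer e) ↔ _
  rw [glue_inl_iff hx]
  rcases e with e | e <;> simp [outer]

theorem comp_inr_iff {z : Z} (hz : ¬ CoThrough q z) {e : X ⊕ Z} :
    comp p q (Sum.inr z) e ↔ ∃ z', e = Sum.inr z' ∧ q (Sum.inr z) (Sum.inr z') := by
  change glue p q (Sum.inr (Sum.inr z)) (outer e) ↔ _
  rw [glue_inr_iff hz]
  rcases e with e | e <;> simp [outer]

theorem Through.of_comp {x : X} (h : Through (comp p q) x) : Through p x := by
  by_contra hx
  obtain ⟨y, hy⟩ := h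
  obtain ⟨x', h, _⟩ := (comp_inl_iff hx).1 hy
  simp at h

theorem CoThrough.of_comp {z : Z} (h : CoThrough (comp p q) z) : CoThrough q z := by
  by_contra hz
  obtain ⟨x, hx⟩ := h
  obtain ⟨x', h, _⟩ := (comp_inr_iff hz).1 ((comp p q).symm hx)
  simp at h

/-- Every middle point is joined to the lower row, hence to an outer point. Combined with
`loops_assoc`, this shows that loop numbers depend only on the upper half of the lower factor. -/
theorem loops_top [Nonempty Z] : loops p (⊤ : Setoid (Y ⊕ Z)) = 0 := by
  obtain ⟨z⟩ := ‹Nonempty Z›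
  have : IsEmpty {c : Quotient (glue p (⊤ : Setoid (Y ⊕ Z))) //
      ∀ x, Quotient.mk (glue p (⊤ : Setoid (Y ⊕ Z))) (outer x) ≠ c} := by
    constructor
    rintro ⟨c, hc⟩
    induction c using Quotient.ind with
    | _ a =>
      rcases a with x | x
      · exact hc (Sum.inl x) rfl
      · exact hc (Sum.inr z) (Quotient.sound (glue_of_lower (x := Sum.inr z) (y := x) trivial))
  exact Nat.card_of_isEmpty

end gluing

/-! ### Link states as upper halves of diagrams -/

section link

variable {n : ℕ} {p : Setoid (Fin n ⊕ Fin n)} {v w : Setoid (Fin n ⊕ Fin 1)}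

theorem defect_iff_through {i : Fin n} : Defect v i ↔ Through v i :=
  ⟨fun h => ⟨0, h⟩, fun ⟨y, h⟩ => by rwa [eq_infty] at h⟩

/-- Placing `p` above the state with only defects extracts the upper half of `p`: its through
strings become the defects and nothing else changes. -/
theorem defect_comp_top {i : Fin n} :
    Defect (comp p (⊤ : Setoid (Fin n ⊕ Fin 1))) i ↔ Through p i := by
  constructor
  · intro h
    exact Through.of_comp (defect_iff_through.1 h)
  · rintro ⟨y, hy⟩
    exact (glue p ⊤).trans (glue_of_upper hy)
      (glue_of_lower (x := Sum.inl y) (y := infty) trivial)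

/-- A diagram on top of a link state that keeps all its through strings. -/
theorem comp_eq_comp_top (h : ∀ i, Through p i → Defect (comp p v) i) :
    comp p v = comp p (⊤ : Setoid (Fin n ⊕ Fin 1)) := by
  apply le_antisymm (comp_mono_right le_top)
  have key : ∀ i e, comp p (⊤ : Setoid (Fin n ⊕ Fin 1)) (Sum.inl i) e → comp p v (Sum.inl i) e := by
    intro i e hie
    by_cases hi : Through p i
    · refine (comp p v).trans (h i hi) ?_
      rcases e with j | j
      · refine (comp p v).symm (h j (defect_comp_top.1 ?_))
        exact (comp p ⊤).trans ((comp p ⊤).symm hie) (defect_comp_top.2 hi)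
      · rw [eq_infty]
    · rw [comp_inl_iff hi] at hie ⊢
      exact hie
  rintro (x | x) (y | y) hxy
  · exact key _ _ hxy
  · exact key _ _ hxy
  · exact (comp p v).symm (key _ _ ((comp p ⊤).symm hxy))
  · rw [eq_infty x, eq_infty y]

theorem IsLinkState.top : IsLinkState (⊤ : Setoid (Fin n ⊕ Fin 1)) :=
  ⟨fun _ _ _ _ _ _ _ _ _ => trivial, fun _ _ _ h _ _ => absurd trivial h,
    fun _ _ h _ _ => absurd trivial h⟩

/-- Two link states with the same defects and the same relations between other points agree. -/
theorem linkState_ext (h : ∀ i, Defect v i ↔ Defect w i)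
    (h' : ∀ i j, ¬ Defect v i → (v (Sum.inl i) (Sum.inl j) ↔ w (Sum.inl i) (Sum.inl j))) :
    v = w := by
  have key : ∀ i e, v (Sum.inl i) e ↔ w (Sum.inl i) e := by
    rintro i (j | j)
    · by_cases hi : Defect v i
      · have h1 : v (Sum.inl i) (Sum.inl j) ↔ Defect v j :=
          ⟨fun hh => v.trans (v.symm hh) hi, fun hh => v.trans hi (v.symm hh)⟩
        have h2 : w (Sum.inl i) (Sum.inl j) ↔ Defect w j :=
          ⟨fun hh => w.trans (w.symm hh) ((h i).1 hi), fun hh => w.trans ((h i).1 hi) (w.symm hh)⟩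
        rw [h1, h2, h]
      · exact h' i j hi
    · rw [eq_infty]; exact h i
  ext x y
  rcases x with x | x
  · exact key x y
  · rcases y with y | y
    · rw [Setoid.comm', key, Setoid.comm']
    · rw [eq_infty x, eq_infty y]; exact iff_of_true (v.refl _) (w.refl _)

end link

/-! ### Through strings and reconstruction from halves -/

section strings

variable {n : ℕ} {r : Setoid (Fin n ⊕ Fin n)}

theorem exists_lower (i : {i // Through r i}) :
    ∃ j : {j // CoThrough r j}, r (Sum.inl i.1) (Sum.inr j.1) :=
  ⟨⟨i.2.choose, i.1, i.2.choose_spec⟩, i.2.choose_spec⟩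

theorem IsABAdmissible.lower_unique (hr : IsABAdmissible r) {i j k : Fin n}
    (h : r (Sum.inl i) (Sum.inr j)) (h' : r (Sum.inl i) (Sum.inr k)) : j = k := by
  rcases hr.card_block_le _ _ _ h h' with h | h | h <;> simp_all

theorem IsABAdmissible.upper_unique (hr : IsABAdmissible r) {i j k : Fin n}
    (h : r (Sum.inl i) (Sum.inr k)) (h' : r (Sum.inl j) (Sum.inr k)) : i = j := by
  rcases hr.card_block_le _ _ _ (r.symm h) (r.symm h') with h | h | h <;> simp_all

/-- The boundary order runs through the lower row from right to left, so two strings in the wrong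
order would cross. The noncrossing condition would then join their upper ends, giving a block of
three points. -/
theorem IsABAdmissible.strings_lt (hr : IsABAdmissible r) {i i' j j' : Fin n}
    (h : r (Sum.inl i) (Sum.inr j)) (h' : r (Sum.inl i') (Sum.inr j')) (hlt : i < i') : j < j' := by
  by_contra hle
  have hne : j ≠ j' := by
    rintro rfl
    exact hlt.ne (hr.upper_unique h h')
  have hlt' : j' < j := lt_of_le_of_ne (not_lt.1 hle) hne.symm
  have hc := hr.noncrossing (Sum.inl i) (Sum.inl i') (Sum.inr j) (Sum.inr j')
    (by simpa [pos] using hlt) (by simp only [pos, Sum.elim_inl, Sum.elim_inr]; omega)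
    (by simp only [pos, Sum.elim_inr, Fin.val_rev]; omega) h h'
  rcases hr.card_block_le _ _ _ hc h with h | h | h
  · exact hlt.ne (by simpa using h)
  · simp at h
  · simp at h

/-- The through strings, as an order isomorphism between their upper and their lower points. -/
noncomputable def IsABAdmissible.strings (hr : IsABAdmissible r) :
    {i // Through r i} ≃o {j // CoThrough r j} :=
  (StrictMono.orderIsoOfSurjective (fun i => (exists_lower i).choose)
    (fun i i' hlt => hr.strings_lt (exists_lower i).choose_spec
      (exists_lower i').choose_spec hlt)
    (fun j => by
      obtain ⟨i, hi⟩ := j.2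
      refine ⟨⟨i, j.1, hi⟩, Subtype.ext ?_⟩
      exact hr.lower_unique (exists_lower ⟨i, j.1, hi⟩).choose_spec hi))

theorem IsABAdmissible.strings_rel (hr : IsABAdmissible r) (i : {i // Through r i}) :
    r (Sum.inl i.1) (Sum.inr (hr.strings i).1) :=
  (exists_lower i).choose_spec

/-- A string joins different letters, and a lower point has the letter opposite to that of the upper
point at the same place. Read with the labels of the upper row, both ends therefore agree, and words
at the top and at the bottom can be compared. -/
theorem IsABAdmissible.strings_label (hr : IsABAdmissible r) (i : {i // Through r i}) :
    upperLabel (hr.strings i).1 = upperLabel i.1 := by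
  have h := hr.label_ne _ _ (hr.strings_rel i) (by simp)
  simp only [label, Sum.elim_inl, Sum.elim_inr, lowerLabel_eq] at h
  rw [← bar_bar (upperLabel (hr.strings i).1), eq_comm, eq_bar_iff]
  exact h

theorem IsABAdmissible.rel_iff (hr : IsABAdmissible r) (i : {i // Through r i}) (j : Fin n) :
    r (Sum.inl i.1) (Sum.inr j) ↔ (hr.strings i).1 = j :=
  ⟨fun h => hr.lower_unique (hr.strings_rel i) h, fun h => h ▸ hr.strings_rel i⟩

/-- A diagram is determined by its upper and its lower half. -/
theorem IsABAdmissible.ext_halves {r' : Setoid (Fin n ⊕ Fin n)} (hr : IsABAdmissible r)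
    (hr' : IsABAdmissible r') (hu : ∀ i, Through r i ↔ Through r' i)
    (hl : ∀ j, CoThrough r j ↔ CoThrough r' j)
    (hu' : ∀ i i', ¬ Through r i → (r (Sum.inl i) (Sum.inl i') ↔ r' (Sum.inl i) (Sum.inl i')))
    (hl' : ∀ j j', ¬ CoThrough r j → (r (Sum.inr j) (Sum.inr j') ↔ r' (Sum.inr j) (Sum.inr j'))) :
    r = r' := by
  have key : ∀ i j, r (Sum.inl i) (Sum.inr j) ↔ r' (Sum.inl i) (Sum.inr j) := by
    intro i j
    by_cases hi : Through r i
    · have hi' := (hu i).1 hi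
      let f : {i // Through r i} ≃o {j // CoThrough r j} :=
        ((OrderIso.setCongr {i | Through r i} {i | Through r' i} (by ext i; exact hu i)).trans
          hr'.strings).trans
          (OrderIso.setCongr {i | CoThrough r' i} {i | CoThrough r i} (by ext i; exact (hl i).symm))
      -- An order isomorphism between finite linear orders is unique, so the end points of the
      -- strings determine how they are matched.
      have hf : f = hr.strings := Subsingleton.elim _ _
      have h1 := hr.rel_iff ⟨i, hi⟩ j
      have h2 := hr'.rel_iff ⟨i, hi'⟩ j
      rw [h1, h2, ← hf]
      rfl
    · constructor
      · exact fun h => absurd ⟨j, h⟩ hi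
      · exact fun h => absurd ((hu i).2 ⟨j, h⟩) hi
  have small : ∀ {r : Setoid (Fin n ⊕ Fin n)}, IsABAdmissible r → ∀ {i i'}, Through r i →
      (r (Sum.inl i) (Sum.inl i') ↔ i = i') := by
    rintro r hr i i' ⟨j, hj⟩
    constructor
    · intro h
      rcases hr.card_block_le _ _ _ hj h with h | h | h
      · simp at h
      · simpa using h
      · simp at h
    · rintro rfl; exact r.refl _
  have small' : ∀ {r : Setoid (Fin n ⊕ Fin n)}, IsABAdmissible r → ∀ {j j'}, CoThrough r j →
      (r (Sum.inr j) (Sum.inr j') ↔ j = j') := by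
    rintro r hr i i' ⟨j, hj⟩
    constructor
    · intro h
      rcases hr.card_block_le _ _ _ (r.symm hj) h with h | h | h
      · simp at h
      · simpa using h
      · simp at h
    · rintro rfl; exact r.refl _
  ext x y
  rcases x with x | x <;> rcases y with y | y
  · by_cases hx : Through r x
    · rw [small hr hx, small hr' ((hu x).1 hx)]
    · exact hu' x y hx
  · exact key x y
  · rw [Setoid.comm', key, Setoid.comm']
  · by_cases hx : CoThrough r x
    · rw [small' hr hx, small' hr' ((hl x).1 hx)]
    · exact hl' x y hx

end strings

end Diagram

namespace Diagram

/-! ### Words read off sets of points -/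

section words

variable {n : ℕ}

open Classical in
/-- The labels, from left to right, of the upper points with a given property. -/
noncomputable def labelWord (P : Fin n → Prop) : List Letter :=
  ((List.finRange n).filter fun i => P i).map upperLabel

theorem sortedLT_filter (P : Fin n → Bool) : ((List.finRange n).filter P).SortedLT :=
  ((List.sortedLT_finRange n).pairwise.sublist List.filter_sublist).sortedLT

/-- The images of the increasing list of points of `P` form an increasing list with the same members
as that of `Q`, and a sorted list is determined by its members. -/
theorem labelWord_congr {P Q : Fin n → Prop} (f : {i // P i} ≃o {j // Q j})
    (hf : ∀ i, upperLabel (f i).1 = upperLabel i.1) : labelWord P = labelWord Q := by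
  classical
  let L := (List.finRange n).filter fun i => P i
  have hL : ∀ i ∈ L, P i := fun i hi => by simpa [L] using hi
  let L' : List (Fin n) := L.attach.map fun i => (f ⟨i.1, hL i.1 i.2⟩).1
  have h1 : L' = (List.finRange n).filter fun j => Q j := by
    refine List.SortedLT.eq_of_mem_iff ?_ (sortedLT_filter _) (fun j => ?_)
    · refine List.Pairwise.sortedLT (List.pairwise_map.2 ?_)
      have : L.attach.Pairwise fun a b => a.1 < b.1 := by
        rw [← List.pairwise_map (f := Subtype.val) (R := (· < ·)), List.attach_map_subtype_val]
        exact (sortedLT_filter _).pairwise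
      exact this.imp fun {a b} h => f.strictMono
        (show (⟨a.1, hL a.1 a.2⟩ : {i // P i}) < ⟨b.1, hL b.1 b.2⟩ from h)
    · simp only [L', List.mem_map, List.mem_attach, true_and, List.mem_filter, List.mem_finRange,
        decide_eq_true_eq]
      constructor
      · rintro ⟨i, rfl⟩
        exact (f _).2
      · intro hj
        exact ⟨⟨(f.symm ⟨j, hj⟩).1, by simpa [L] using (f.symm ⟨j, hj⟩).2⟩, by simp⟩
  have h2 : L'.map upperLabel = L.map upperLabel := by
    rw [List.map_map]
    conv_rhs => rw [← List.attach_map_subtype_val L, List.map_map]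
    exact List.map_congr_left fun i _ => hf _
  change L.map upperLabel = _
  rw [← h2, h1]
  rfl

/-- The `k`-th points of the two sets are matched. This supplies the through strings when two halves
with equal words are joined. -/
theorem exists_orderIso_of_labelWord_eq {P Q : Fin n → Prop} (h : labelWord P = labelWord Q) :
    ∃ f : {i // P i} ≃o {j // Q j}, ∀ i, upperLabel (f i).1 = upperLabel i.1 := by
  classical
  have aux : ∀ P : Fin n → Prop, ∃ f : Fin (labelWord P).length ≃o {i // P i},
      ∀ k, upperLabel (f k).1 = (labelWord P).get k := by
    intro P
    refine ⟨((Fin.castOrderIso (by simp [labelWord])).trans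
      ((sortedLT_filter fun i => decide (P i)).getIso _)).trans
      (OrderIso.setCongr {i | i ∈ (List.finRange n).filter fun i => decide (P i)} {i | P i}
        (by ext i; simp)), fun k => ?_⟩
    rw [List.get_eq_getElem]
    simp only [labelWord, List.getElem_map]
    rfl
  obtain ⟨f, hf⟩ := aux P
  obtain ⟨g, hg⟩ := aux Q
  refine ⟨(f.symm.trans (Fin.castOrderIso (by rw [h]))).trans g, fun i => ?_⟩
  simp only [OrderIso.trans_apply]
  rw [hg]
  obtain ⟨k, rfl⟩ := f.surjective i
  rw [hf, OrderIso.symm_apply_apply]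
  simp [h]

theorem length_labelWord (P : Fin n → Prop) : (labelWord P).length = Nat.card {i // P i} := by
  classical
  rw [labelWord, List.length_map, Nat.card_eq_fintype_card, Fintype.card_subtype,
    ← List.toFinset_card_of_nodup ((List.nodup_finRange n).filter _)]
  congr 1
  ext i
  simp

theorem count_labelWord (P : Fin n → Prop) (x : Letter) :
    (labelWord P).count x = Nat.card {i // P i ∧ upperLabel i = x} := by
  classical
  rw [labelWord, List.count_eq_countP, List.countP_map, List.countP_eq_length_filter,
    List.filter_filter, Nat.card_eq_fintype_card, Fintype.card_subtype,
    ← List.toFinset_card_of_nodup ((List.nodup_finRange n).filter _)]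
  congr 1
  ext i
  simp [and_comm]

theorem labelWord_mem_subwords (P : Fin n → Prop) : labelWord P ∈ subwords n := by
  change (labelWord P).Sublist _
  rw [alternatingWord, List.ofFn_eq_map]
  exact List.filter_sublist.map _

theorem exists_labelWord {w : List Letter} (hw : w ∈ subwords n) :
    ∃ P : Fin n → Prop, labelWord P = w := by
  classical
  change w.Sublist _ at hw
  rw [alternatingWord, List.ofFn_eq_map, List.sublist_map_iff] at hw
  obtain ⟨L, hL, rfl⟩ := hw
  refine ⟨fun i => i ∈ L, ?_⟩
  rw [labelWord]
  congr 1
  refine List.SortedLT.eq_of_mem_iff (sortedLT_filter _)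
    ((List.sortedLT_finRange n).pairwise.sublist hL).sortedLT (fun j => by simp)

/-- An inclusion of finite sets without loss of cardinality is an equality. In this form, numerical
information about defects or strings is turned into information about the points themselves. -/
theorem eq_of_card_le {P Q : Fin n → Prop} (h : ∀ i, P i → Q i)
    (hc : Nat.card {i // Q i} ≤ Nat.card {i // P i}) (i : Fin n) : Q i → P i := by
  classical
  intro hi
  have hs : {i | P i} = {i | Q i} := Set.eq_of_subset_of_ncard_le (fun i hi => h i hi) hc
  exact (Set.ext_iff.1 hs i).2 hi

theorem card_le_of_imp {P Q : Fin n → Prop} (h : ∀ i, P i → Q i) :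
    Nat.card {i // P i} ≤ Nat.card {i // Q i} :=
  Nat.card_le_card_of_injective (Subtype.map id h) (Subtype.map_injective h Function.injective_id)

/-- The word of a diagram can be read at either end of its strings. The lower ends are not moved by
anything placed on top, which is the source of the invariance of boundary words. -/
theorem IsABAdmissible.labelWord_through {r : Setoid (Fin n ⊕ Fin n)} (hr : IsABAdmissible r) :
    labelWord (Through r) = labelWord (CoThrough r) :=
  labelWord_congr hr.strings hr.strings_label

end words

/-! ### Link states with prescribed defects -/

section singles

variable {n : ℕ}

open Classical in
/-- The link state with given defects and no pairs. -/
noncomputable def singles (P : Fin n → Prop) : Setoid (Fin n ⊕ Fin 1) :=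
  Setoid.ker (Sum.elim (fun i => if P i then none else some i) fun _ => none)

theorem singles_inl_iff {P : Fin n → Prop} {i : Fin n} (hi : ¬ P i) {e : Fin n ⊕ Fin 1} :
    singles P (Sum.inl i) e ↔ e = Sum.inl i := by
  change Sum.elim _ _ _ = Sum.elim _ _ _ ↔ _
  rcases e with j | j
  · by_cases hj : P j
    · simp [hi, hj]
      rintro rfl
      exact hi hj
    · simp [hi, hj, eq_comm]
  · simp [hi]

theorem defect_singles {P : Fin n → Prop} {i : Fin n} : Defect (singles P) i ↔ P i := by
  by_cases hi : P i
  · refine iff_of_true ?_ hi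
    change Sum.elim _ _ _ = Sum.elim _ _ _
    simp [hi, infty]
  · refine iff_of_false (fun h => ?_) hi
    have := (singles_inl_iff hi).1 h
    simp [infty] at this

theorem isLinkState_singles (P : Fin n → Prop) : IsLinkState (singles P) := by
  refine ⟨?_, ?_, ?_⟩
  · have hinf : ∀ x : Fin n ⊕ Fin 1, singles P x infty ∨ ∀ e, singles P x e → x = e := by
      rintro (i | i)
      · by_cases hi : P i
        · exact Or.inl (defect_singles.2 hi)
        · exact Or.inr fun e he => ((singles_inl_iff hi).1 he).symm
      · left; rw [eq_infty]
    intro x y z t hxy hyz hzt hxz hyt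
    rcases hinf x with hx | hx
    · rcases hinf y with hy | hy
      · exact (singles P).trans hx ((singles P).symm hy)
      · obtain rfl := hy _ hyt; omega
    · obtain rfl := hx _ hxz; omega
  · intro i j k hi hij _
    have := (singles_inl_iff fun h => hi (defect_singles.2 h)).1 hij
    exact Or.inl (by simpa using this.symm)
  · intro i j hi hij hne
    have := (singles_inl_iff fun h => hi (defect_singles.2 h)).1 hij
    exact absurd (by simpa using this.symm) hne

end singles

/-! ### Diagrams with prescribed halves -/

section join

variable {n : ℕ} (u v : Setoid (Fin n ⊕ Fin 1)) (f : {i // Defect u i} ≃o {j // Defect v j})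

open Classical in
/-- The blocks of the diagram with upper half `u` and lower half `v`: the through strings are
indexed by the defects of `v`. -/
noncomputable def joinBlock :
    Fin n ⊕ Fin n → {j // Defect v j} ⊕ (Quotient u ⊕ Quotient v) :=
  Sum.elim
    (fun i => if h : Defect u i then Sum.inl (f ⟨i, h⟩) else Sum.inr (Sum.inl ⟦Sum.inl i⟧))
    (fun j => if h : Defect v j then Sum.inl ⟨j, h⟩ else Sum.inr (Sum.inr ⟦Sum.inl j⟧))

/-- The diagram with upper half `u` and lower half `v`. -/
noncomputable def join : Setoid (Fin n ⊕ Fin n) := Setoid.ker (joinBlock u v f)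

variable {u v f}

theorem join_upper {i i' : Fin n} :
    join u v f (Sum.inl i) (Sum.inl i') ↔ i = i' ∨ (u (Sum.inl i) (Sum.inl i') ∧ ¬ Defect u i) := by
  change joinBlock u v f _ = joinBlock u v f _ ↔ _
  by_cases h : Defect u i <;> by_cases h' : Defect u i' <;> simp only [joinBlock, Sum.elim_inl, h, h',
    dif_pos, dif_neg, not_false_eq_true, not_true_eq_false, and_false, and_true, or_false]
  · simp
  · simp; rintro rfl; exact h' h
  · simp only [reduceCtorEq, false_iff, not_or]
    refine ⟨by rintro rfl; exact h h', fun hh => h (u.trans hh h')⟩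
  · simp only [Sum.inr.injEq, Sum.inl.injEq, Quotient.eq]
    exact ⟨Or.inr, by rintro (rfl | hh); exacts [u.refl _, hh]⟩

theorem join_lower {j j' : Fin n} :
    join u v f (Sum.inr j) (Sum.inr j') ↔ j = j' ∨ (v (Sum.inl j) (Sum.inl j') ∧ ¬ Defect v j) := by
  change joinBlock u v f _ = joinBlock u v f _ ↔ _
  by_cases h : Defect v j <;> by_cases h' : Defect v j' <;> simp only [joinBlock, Sum.elim_inr, h, h',
    dif_pos, dif_neg, not_false_eq_true, not_true_eq_false, and_false, and_true, or_false]
  · simp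
  · simp; rintro rfl; exact h' h
  · simp only [reduceCtorEq, false_iff, not_or]
    refine ⟨by rintro rfl; exact h h', fun hh => h (v.trans hh h')⟩
  · simp only [Sum.inr.injEq, Quotient.eq]
    exact ⟨Or.inr, by rintro (rfl | hh); exacts [v.refl _, hh]⟩

theorem join_through {i j : Fin n} :
    join u v f (Sum.inl i) (Sum.inr j) ↔ ∃ h : Defect u i, (f ⟨i, h⟩).1 = j := by
  change joinBlock u v f _ = joinBlock u v f _ ↔ _
  by_cases h : Defect u i <;> by_cases h' : Defect v j <;> simp only [joinBlock, Sum.elim_inl,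
    Sum.elim_inr, h, h', dif_pos, dif_neg, not_false_eq_true]
  · simp [Subtype.ext_iff]
  · simp only [reduceCtorEq, exists_true_left, false_iff]
    rintro rfl
    exact h' (f ⟨i, h⟩).2
  · simp
  · simp

theorem through_join {i : Fin n} : Through (join u v f) i ↔ Defect u i :=
  ⟨fun ⟨_, h⟩ => (join_through.1 h).1, fun h => ⟨_, join_through.2 ⟨h, rfl⟩⟩⟩

theorem coThrough_join {j : Fin n} : CoThrough (join u v f) j ↔ Defect v j := by
  constructor
  · rintro ⟨i, hi⟩
    obtain ⟨h, rfl⟩ := join_through.1 hi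
    exact (f ⟨i, h⟩).2
  · intro h
    exact ⟨(f.symm ⟨j, h⟩).1, join_through.2 ⟨(f.symm ⟨j, h⟩).2, by simp⟩⟩

theorem isABAdmissible_join (hu : IsLinkState u) (hv : IsLinkState v)
    (hf : ∀ i, upperLabel (f i).1 = upperLabel i.1) : IsABAdmissible (join u v f) := by
  refine ⟨?_, ?_, ?_⟩
  · rintro (x | x) (y | y) (z | z) (t | t) hxy hyz hzt hxz hyt <;>
      simp only [pos, Sum.elim_inl, Sum.elim_inr, Fin.val_rev] at hxy hyz hzt <;> try omega
    · rw [join_upper] at hxz hyt ⊢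
      rcases hxz with rfl | ⟨hxz, hx⟩
      · omega
      rcases hyt with rfl | ⟨hyt, hy⟩
      · omega
      exact Or.inr ⟨hu.noncrossing _ _ (Sum.inl z) (Sum.inl t) hxy hyz hzt hxz hyt, hx⟩
    · rw [join_upper] at hxz ⊢
      rw [join_through] at hyt
      rcases hxz with rfl | ⟨hxz, hx⟩
      · omega
      exact Or.inr ⟨hu.noncrossing _ _ (Sum.inl z) infty hxy hyz (by simp [pos, infty]) hxz
        hyt.1, hx⟩
    · rw [join_through] at hxz hyt
      obtain ⟨hx, rfl⟩ := hxz
      obtain ⟨hy, rfl⟩ := hyt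
      -- Since `f` is increasing and the lower row is passed from right to left, two through strings
      -- cannot alternate.
      have := f.strictMono (show (⟨x, hx⟩ : {i // Defect u i}) < ⟨y, hy⟩ from hxy)
      have : (f ⟨x, hx⟩).1.1 < (f ⟨y, hy⟩).1.1 := this
      omega
    · rw [join_through] at hxz
      rw [join_lower] at hyt
      obtain ⟨hx, rfl⟩ := hxz
      rcases hyt with rfl | ⟨hyt, hy⟩
      · omega
      -- After reversal of the lower row, the pair of `t` and `y` would brace the defect of `v` at
      -- the end of the string from `x`.
      have hz := (f ⟨x, hx⟩).2
      refine absurd (v.trans hyt (hv.noncrossing (Sum.inl t) (Sum.inl (f ⟨x, hx⟩).1) (Sum.inl y) infty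
        (by simp only [pos, Sum.elim_inl]; omega) (by simp only [pos, Sum.elim_inl]; omega)
        (by simp [pos, infty]) (v.symm hyt) hz)) fun h => hy (v.trans h hz)
    · rw [join_lower] at hxz hyt ⊢
      rcases hxz with rfl | ⟨hxz, hx⟩
      · omega
      rcases hyt with rfl | ⟨hyt, hy⟩
      · omega
      have := hv.noncrossing (Sum.inl t) (Sum.inl z) (Sum.inl y) (Sum.inl x)
        (by simp only [pos, Sum.elim_inl]; omega) (by simp only [pos, Sum.elim_inl]; omega)
        (by simp only [pos, Sum.elim_inl]; omega) (v.symm hyt) (v.symm hxz)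
      exact Or.inr ⟨v.trans hxz (v.trans (v.symm this) (v.symm hyt)), hx⟩
  · have hu' : ∀ i j k, join u v f (Sum.inl i) (Sum.inl j) → join u v f (Sum.inl i) (Sum.inl k) →
        i = j ∨ i = k ∨ j = k := by
      intro i j k hij hik
      rcases join_upper.1 hij with h | ⟨h, hi⟩
      · exact Or.inl h
      rcases join_upper.1 hik with h' | ⟨h', _⟩
      · exact Or.inr (Or.inl h')
      exact hu.card_block_le i j k hi h h'
    have hv' : ∀ i j k, join u v f (Sum.inr i) (Sum.inr j) → join u v f (Sum.inr i) (Sum.inr k) →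
        i = j ∨ i = k ∨ j = k := by
      intro i j k hij hik
      rcases join_lower.1 hij with h | ⟨h, hi⟩
      · exact Or.inl h
      rcases join_lower.1 hik with h' | ⟨h', _⟩
      · exact Or.inr (Or.inl h')
      exact hv.card_block_le i j k hi h h'
    have hd : ∀ i j, join u v f (Sum.inl i) (Sum.inl j) → Defect u i → i = j := by
      intro i j h hi
      rcases join_upper.1 h with h | ⟨_, h⟩
      · exact h
      · exact absurd hi h
    have hd' : ∀ i j, join u v f (Sum.inr i) (Sum.inr j) → Defect v i → i = j := by
      intro i j h hi
      rcases join_lower.1 h with h | ⟨_, h⟩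
      · exact h
      · exact absurd hi h
    have ht : ∀ i j, join u v f (Sum.inl i) (Sum.inr j) → Defect u i ∧ Defect v j :=
      fun i j h => ⟨through_join.1 ⟨j, h⟩, coThrough_join.1 ⟨i, h⟩⟩
    have hs : ∀ {x y}, join u v f x y → join u v f y x := (join u v f).symm
    have htr : ∀ {x y z}, join u v f x y → join u v f y z → join u v f x z := (join u v f).trans
    rintro (x | x) (y | y) (z | z) hxy hxz <;> simp only [Sum.inl.injEq, Sum.inr.injEq,
      reduceCtorEq, false_or, or_false]
    · exact hu' x y z hxy hxz
    · exact hd x y hxy (ht _ _ hxz).1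
    · exact hd x z hxz (ht _ _ hxy).1
    · exact hd' y z (htr (hs hxy) hxz) (ht _ _ hxy).2
    · exact hd y z (htr (hs hxy) hxz) (ht _ _ (hs hxy)).1
    · exact hd' x z hxz (ht _ _ (hs hxy)).2
    · exact hd' x y hxy (ht _ _ (hs hxz)).2
    · exact hv' x y z hxy hxz
  · have ht : ∀ i j, join u v f (Sum.inl i) (Sum.inr j) → upperLabel i ≠ lowerLabel j := by
      intro i j h
      obtain ⟨hi, rfl⟩ := join_through.1 h
      rw [lowerLabel_eq, hf]
      exact (bar_ne _).symm
    rintro (x | x) (y | y) hxy hne <;> simp only [label, Sum.elim_inl, Sum.elim_inr]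
    · rcases join_upper.1 hxy with rfl | ⟨h, hx⟩
      · exact absurd rfl hne
      · exact hu.label_ne x y hx h fun h => hne (by rw [h])
    · exact ht x y hxy
    · exact (ht y x ((join u v f).symm hxy)).symm
    · rcases join_lower.1 hxy with rfl | ⟨h, hx⟩
      · exact absurd rfl hne
      · rw [lowerLabel_eq, lowerLabel_eq]
        intro hb
        refine hv.label_ne x y hx h (fun h => hne (by rw [h])) ?_
        rw [← bar_bar (upperLabel x), hb, bar_bar]

theorem comp_join_top : comp (join u v f) (⊤ : Setoid (Fin n ⊕ Fin 1)) = u := by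
  refine linkState_ext (fun i => defect_comp_top.trans through_join) fun i j hi => ?_
  have hi' : ¬ Through (join u v f) i := fun h => hi (defect_comp_top.2 h)
  have hi'' : ¬ Defect u i := fun h => hi' (through_join.2 h)
  rw [comp_inl_iff hi']
  constructor
  · rintro ⟨x', hx', h⟩
    obtain rfl : j = x' := by simpa using hx'
    rcases join_upper.1 h with rfl | ⟨h, _⟩
    · exact u.refl _
    · exact h
  · exact fun h => ⟨j, rfl, join_upper.2 (Or.inr ⟨h, hi''⟩)⟩

/-- Each string of the join ends at a defect of `v`, so no string is lost and `comp_eq_comp_top`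
applies. Thus joins move any link state to any other one with the same word, up to a power of the
loop parameter. -/
theorem comp_join_self : comp (join u v f) v = u := by
  rw [comp_eq_comp_top, comp_join_top]
  intro i hi
  have hi' := through_join.1 hi
  exact (glue _ v).trans (glue_of_upper (x := Sum.inl i) (y := Sum.inr (f ⟨i, hi'⟩).1)
    (join_through.2 ⟨hi', rfl⟩)) (glue_of_lower (f ⟨i, hi'⟩).2)

end join

end Diagram

/-! ### Invariance of the boundary word -/

section states

open Diagram

variable {n : ℕ}

/-- The link state all of whose points are defects. -/
def LinkState.top (n : ℕ) : LinkState n := ⟨⊤, IsLinkState.top⟩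

/-- The upper half of a diagram: the through strings become defects. -/
def ABDiagram.upper (p : ABDiagram n) : LinkState n := (LinkState.top n).act p

theorem LinkState.word_eq (v : LinkState n) : v.word = labelWord (Defect v.1) := rfl

theorem LinkState.length_word (v : LinkState n) : v.word.length = v.defects :=
  length_labelWord _

theorem LinkState.count_word (v : LinkState n) (x : Letter) :
    v.word.count x = v.defectsWith x := count_labelWord _ _

theorem LinkState.word_mem_subwords (v : LinkState n) : v.word ∈ subwords n :=
  labelWord_mem_subwords _

theorem exists_linkState_word {w : List Letter} (hw : w ∈ subwords n) :
    ∃ v : LinkState n, v.word = w := by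
  obtain ⟨P, rfl⟩ := exists_labelWord hw
  refine ⟨⟨singles P, isLinkState_singles P⟩, congrArg labelWord ?_⟩
  exact funext fun i => propext defect_singles

theorem LinkState.act_comp (p q : ABDiagram n) (v : LinkState n) :
    v.act (p.comp q) = (v.act q).act p := Subtype.ext (comp_assoc _ _ _)

theorem ABDiagram.upper_comp (p q : ABDiagram n) : (p.comp q).upper = q.upper.act p :=
  LinkState.act_comp _ _ _

theorem ABDiagram.defect_upper (p : ABDiagram n) {i : Fin n} :
    Defect p.upper.1 i ↔ Through p.1 i := defect_comp_top

theorem ABDiagram.word_upper (p : ABDiagram n) : p.upper.word = labelWord (Through p.1) := by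
  rw [LinkState.word_eq]
  congr 1
  exact funext fun i => propext p.defect_upper

/-- The diagram with upper half `u` and lower half `v`. -/
noncomputable def ABDiagram.join (u v : LinkState n) (h : u.word = v.word) : ABDiagram n :=
  ⟨Diagram.join u.1 v.1 (exists_orderIso_of_labelWord_eq h).choose,
    isABAdmissible_join u.2 v.2 (exists_orderIso_of_labelWord_eq h).choose_spec⟩

theorem ABDiagram.upper_join (u v : LinkState n) (h : u.word = v.word) :
    (ABDiagram.join u v h).upper = u := Subtype.ext comp_join_top

theorem LinkState.act_join (u v : LinkState n) (h : u.word = v.word) :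
    v.act (ABDiagram.join u v h) = u := Subtype.ext comp_join_self

theorem ABDiagram.card_coThrough (p : ABDiagram n) :
    Nat.card {j // CoThrough p.1 j} = p.upper.defects := by
  rw [← length_labelWord, ← p.2.labelWord_through, ← p.word_upper, LinkState.length_word]

theorem LinkState.defects_act_le (p : ABDiagram n) (v : LinkState n) :
    (v.act p).defects ≤ v.defects := defectCount_comp_le p.2 v.2

/-- A diagram that preserves the number of defects preserves the boundary word. -/
theorem LinkState.word_act {p : ABDiagram n} {u : LinkState n}
    (h : u.defects ≤ (u.act p).defects) : (u.act p).word = u.word := by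
  -- The link state is replaced by a diagram `q` with upper half `u`. The lower ends of the strings
  -- of `p` on top of `q` are among those of `q`; equal numbers force equal sets, and the word is
  -- then compared at the bottom.
  let q := ABDiagram.join u u rfl
  have hq : q.upper = u := ABDiagram.upper_join u u rfl
  have hpq : (p.comp q).upper = u.act p := by rw [ABDiagram.upper_comp, hq]
  have h1 : ∀ j, CoThrough (p.comp q).1 j → CoThrough q.1 j := fun j hj => CoThrough.of_comp hj
  have h2 := eq_of_card_le h1 (by
    rw [ABDiagram.card_coThrough, ABDiagram.card_coThrough, hpq, hq]; exact h)
  rw [← hpq, ABDiagram.word_upper, (p.comp q).2.labelWord_through]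
  conv_rhs => rw [← hq, ABDiagram.word_upper, q.2.labelWord_through]
  congr 1
  exact funext fun j => propext ⟨h1 j, h2 j⟩

theorem LinkState.word_act_iff {p : ABDiagram n} {u : LinkState n} :
    (u.act p).word = u.word ↔ (u.act p).defects = u.defects := by
  refine ⟨fun h => ?_, fun h => LinkState.word_act h.ge⟩
  rw [← LinkState.length_word, h, LinkState.length_word]

theorem LinkState.defects_act_le_upper (p : ABDiagram n) (v : LinkState n) :
    (v.act p).defects ≤ p.upper.defects :=
  card_le_of_imp fun _ h => comp_mono_right le_top h

/-- If as many defects remain as `p` has strings, every string of `p` ends in a defect. The result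
then depends on `p` alone. -/
theorem LinkState.act_eq_upper {p : ABDiagram n} {v : LinkState n}
    (h : p.upper.defects ≤ (v.act p).defects) : v.act p = p.upper := by
  refine Subtype.ext (comp_eq_comp_top fun i hi => ?_)
  exact eq_of_card_le (P := Defect (v.act p).1) (Q := Defect p.upper.1)
    (fun _ h => comp_mono_right le_top h) h i (p.defect_upper.2 hi)

/-- Diagrams on top of `p` that keep all through strings of `p` are determined by their upper
halves. -/
theorem ABDiagram.comp_eq_of_upper_eq {p x x' : ABDiagram n}
    (h : p.upper.defects ≤ (x.comp p).upper.defects)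
    (hu : (x.comp p).upper = (x'.comp p).upper) : x.comp p = x'.comp p := by
  -- If no string of `p` is lost, the product has the lower half of `p`: first its strings, then its
  -- other lower blocks. Upper halves agree by hypothesis, so the two products coincide.
  have hl : ∀ x : ABDiagram n, p.upper.defects ≤ (x.comp p).upper.defects →
      ∀ j, CoThrough (x.comp p).1 j ↔ CoThrough p.1 j := fun x hx j =>
    ⟨fun hj => CoThrough.of_comp hj, eq_of_card_le (P := CoThrough (x.comp p).1)
      (Q := CoThrough p.1) (fun _ hj => CoThrough.of_comp hj)
      (by have := hx; rw [← ABDiagram.card_coThrough, ← ABDiagram.card_coThrough] at this; exact this) j⟩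
  have hl' : ∀ x : ABDiagram n, p.upper.defects ≤ (x.comp p).upper.defects →
      ∀ j j', ¬ CoThrough (x.comp p).1 j → ((x.comp p).1 (Sum.inr j) (Sum.inr j') ↔
        p.1 (Sum.inr j) (Sum.inr j')) := by
    intro x hx j j' hj
    rw [hl x hx] at hj
    exact (comp_inr_iff hj).trans (by simp)
  have h' := h
  rw [hu] at h'
  have ht : ∀ i, Through (x.comp p).1 i ↔ Through (x'.comp p).1 i := fun i => by
    rw [← ABDiagram.defect_upper, ← ABDiagram.defect_upper, hu]
  refine Subtype.ext ((x.comp p).2.ext_halves (x'.comp p).2 ht ?_ ?_ ?_)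
  · exact fun j => by rw [hl x h, hl x' h']
  · intro i i' hi
    have aux : ∀ q : ABDiagram n, ¬ Through q.1 i →
        (q.1 (Sum.inl i) (Sum.inl i') ↔ q.upper.1 (Sum.inl i) (Sum.inl i')) := by
      intro q hq
      refine Iff.trans ?_ (comp_inl_iff hq).symm
      simp
    rw [aux _ hi, aux _ fun hh => hi ((ht i).2 hh), hu]
  · intro j j' hj
    have hj' := hj
    rw [hl x h, ← hl x' h'] at hj'
    rw [hl' x h j j' hj, hl' x' h' j j' hj']

/-- In `loops_assoc` with the all-defect state as third factor, two of the four terms vanish by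
`loops_top`. It makes the scalars in the algebra and in the link modules agree. -/
theorem ABDiagram.loops_eq_loops_upper (q r : ABDiagram n) :
    loops q.1 r.1 = loops q.1 r.upper.1 := by
  have := loops_assoc q.1 r.1 (⊤ : Setoid (Fin n ⊕ Fin 1))
  rw [loops_top, loops_top, add_zero, zero_add] at this
  exact this

end states

/-! ### The quotients by number of defects -/

section quotients

open Diagram

variable (δ : ℂ) (n : ℕ)

theorem linkBasis_mem_linkSubPrev {v : LinkState n} {d : ℕ} (h : v.defects < d) :
    linkBasis δ n v ∈ linkSubPrev δ n d := by
  cases d with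
  | zero => omega
  | succ d => exact linkBasis_mem_linkSub δ n (by omega)

/-- Coordinates at link states with `d` or more defects are insensitive to the submodule that is
divided out, so they can test linear independence in the quotient. -/
theorem repr_linkSubPrev {d : ℕ} {x : LinkModule δ n} (hx : x ∈ linkSubPrev δ n d) {v : LinkState n}
    (hv : d ≤ v.defects) : (linkBasis δ n).repr x v = 0 := by
  cases d with
  | zero =>
    obtain rfl : x = 0 := hx
    simp
  | succ d =>
    change x ∈ Submodule.span ℂ {x | ∃ v : LinkState n, v.defects ≤ d ∧ x = linkBasis δ n v} at hx
    induction hx using Submodule.span_induction with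
    | zero => simp
    | add x y _ _ hx hy => simp [hx, hy]
    | smul c x _ hx => simp [hx]
    | mem x hx =>
      obtain ⟨u, hu, rfl⟩ := hx
      rw [Module.Basis.repr_self, Finsupp.single_apply_eq_zero]
      rintro rfl
      omega

variable {n}

theorem linkClass_eq_zero {d : ℕ} {v : LinkState n} (h : v.defects < d) :
    linkClass δ n v h.le = 0 := by
  rw [linkClass, Submodule.Quotient.mk_eq_zero]
  exact linkBasis_mem_linkSubPrev δ n h

theorem smul_linkClass {d : ℕ} (p : ABDiagram n) (v : LinkState n) (h : v.defects ≤ d) :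
    diagBasis δ n p • linkClass δ n v h =
      δ ^ loops p.1 v.1 • linkClass δ n (v.act p) ((v.defects_act_le p).trans h) := by
  rw [linkClass, ← Submodule.Quotient.mk_smul, linkClass, ← Submodule.Quotient.mk_smul]
  congr 1
  exact Subtype.ext (DiagAlg.basis_smul p v)

/-- The classes of the link states with `d` defects, as a family. -/
noncomputable def topClass (d : ℕ) (v : {v : LinkState n // v.defects = d}) : LinkQuot δ n d :=
  linkClass δ n v.1 v.2.le

theorem linearIndependent_topClass (d : ℕ) : LinearIndependent ℂ (topClass δ (n := n) d) := by
  classical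
  rw [linearIndependent_iff']
  intro s g hg v hv
  have h1 : ∑ i ∈ s, g i • topClass δ d i = Submodule.Quotient.mk
      (∑ i ∈ s, g i • (⟨linkBasis δ n i.1, linkBasis_mem_linkSub δ n i.2.le⟩ : linkSub δ n d)) := by
    change _ = (Submodule.mkQ _) _
    rw [map_sum]
    rfl
  rw [h1, Submodule.Quotient.mk_eq_zero] at hg
  -- A relation between classes lifts to a combination lying in the smaller submodule; its
  -- coordinate at `v` is the coefficient `g v`.
  have h2 := repr_linkSubPrev δ n (d := d) (x := ∑ i ∈ s, g i • linkBasis δ n i.1)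
    (by
      have : ((∑ i ∈ s, g i • (⟨linkBasis δ n i.1, linkBasis_mem_linkSub δ n i.2.le⟩ :
          linkSub δ n d) : linkSub δ n d) : LinkModule δ n) ∈ linkSubPrev δ n d := hg
      rw [AddSubmonoidClass.coe_finsetSum] at this
      exact this) (v := v.1) v.2.ge
  rw [map_sum, Finsupp.finsetSum_apply, Finset.sum_eq_single v] at h2
  · simpa using h2
  · intro u _ hu
    simp [Subtype.ext_iff.not.1 hu]
  · exact fun h => absurd hv h

/-- The classes of the link states with `d` defects and boundary word in `T`. -/
def classesIn (δ : ℂ) (n d : ℕ) (T : Set (List Letter)) : Set (LinkQuot δ n d) :=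
  {x | ∃ (v : LinkState n) (h : v.defects = d), v.word ∈ T ∧ x = linkClass δ n v h.le}

theorem classesIn_eq_image (d : ℕ) (T : Set (List Letter)) :
    classesIn δ n d T = topClass δ (n := n) d '' {v | v.1.word ∈ T} := by
  ext x
  constructor
  · rintro ⟨v, h, hT, rfl⟩
    exact ⟨⟨v, h⟩, hT, rfl⟩
  · rintro ⟨⟨v, h⟩, hT, rfl⟩
    exact ⟨v, h, hT, rfl⟩

/-- A diagram either lowers the number of defects, and the class becomes zero, or keeps the boundary
word by `LinkState.word_act`. No condition on the set `T` of words is needed. -/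
theorem smul_mem_span_classesIn (d : ℕ) (T : Set (List Letter)) (x : DiagAlg δ n)
    {m : LinkQuot δ n d} (hm : m ∈ Submodule.span ℂ (classesIn δ n d T)) :
    x • m ∈ Submodule.span ℂ (classesIn δ n d T) := by
  induction x using basis_induction (diagBasis δ n) with
  | zero => rw [zero_smul]; exact Submodule.zero_mem _
  | add x y hx hy => rw [add_smul]; exact Submodule.add_mem _ hx hy
  | smul c x hx => rw [smul_assoc]; exact Submodule.smul_mem _ c hx
  | basis p =>
    induction hm using Submodule.span_induction with
    | zero => rw [smul_zero]; exact Submodule.zero_mem _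
    | add m m' _ _ hm hm' => rw [smul_add]; exact Submodule.add_mem _ hm hm'
    | smul c m _ hm => rw [smul_algebra_smul_comm]; exact Submodule.smul_mem _ c hm
    | mem m hm =>
      obtain ⟨v, hv, hT, rfl⟩ := hm
      rw [smul_linkClass]
      rcases ((v.defects_act_le p).trans hv.le).lt_or_eq with h | h
      · rw [linkClass_eq_zero δ h, smul_zero]
        exact Submodule.zero_mem _
      · refine Submodule.smul_mem _ _ (Submodule.subset_span ⟨v.act p, h, ?_, rfl⟩)
        rwa [LinkState.word_act (hv.trans h.symm).le]

/-- The complex span is already stable under diagrams, so generating a submodule adds nothing. Sums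
and independence of these submodules become questions of linear algebra. -/
theorem span_classesIn (d : ℕ) (T : Set (List Letter)) :
    (Submodule.span (DiagAlg δ n) (classesIn δ n d T)).restrictScalars ℂ =
      Submodule.span ℂ (classesIn δ n d T) := by
  apply le_antisymm
  · let N : Submodule (DiagAlg δ n) (LinkQuot δ n d) :=
      { Submodule.span ℂ (classesIn δ n d T) with
        smul_mem' := fun x m hm => smul_mem_span_classesIn δ d T x hm }
    have : Submodule.span (DiagAlg δ n) (classesIn δ n d T) ≤ N :=
      Submodule.span_le.2 fun x hx => Submodule.subset_span (R := ℂ) hx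
    exact fun x hx => this hx
  · exact Submodule.span_le.2 fun x hx => Submodule.subset_span (R := DiagAlg δ n) hx

theorem iSup_span_classesIn (d : ℕ) {ι : Type} (T : ι → Set (List Letter)) :
    ⨆ i, Submodule.span (DiagAlg δ n) (classesIn δ n d (T i)) =
      Submodule.span (DiagAlg δ n) (classesIn δ n d (⋃ i, T i)) := by
  rw [← Submodule.span_iUnion]
  congr 1
  ext x
  simp only [Set.mem_iUnion, classesIn, Set.mem_ofPred_eq]
  constructor
  · rintro ⟨i, v, h, hT, rfl⟩
    exact ⟨v, h, ⟨i, hT⟩, rfl⟩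
  · rintro ⟨v, h, ⟨i, hT⟩, rfl⟩
    exact ⟨i, v, h, hT, rfl⟩

/-- Disjoint sets of words select disjoint parts of the linearly independent family `topClass`. -/
theorem iSupIndep_span_classesIn (d : ℕ) {ι : Type} (T : ι → Set (List Letter))
    (hT : ∀ i j, i ≠ j → Disjoint (T i) (T j)) :
    iSupIndep fun i => Submodule.span (DiagAlg δ n) (classesIn δ n d (T i)) := by
  intro i
  rw [Submodule.disjoint_def]
  intro x hx hx'
  have h1 : ⨆ j, ⨆ (_ : j ≠ i), Submodule.span (DiagAlg δ n) (classesIn δ n d (T j)) ≤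
      Submodule.span (DiagAlg δ n) (classesIn δ n d (T i)ᶜ) := by
    refine iSup₂_le fun j hj => Submodule.span_mono ?_
    rintro _ ⟨v, h, hv, rfl⟩
    exact ⟨v, h, Set.disjoint_left.1 (hT j i hj) hv, rfl⟩
  have hx2 := h1 hx'
  rw [← Submodule.restrictScalars_mem ℂ, span_classesIn, classesIn_eq_image] at hx hx2
  have hd := (linearIndependent_topClass δ (n := n) d).disjoint_span_image
    (s := {v | v.1.word ∈ T i}) (t := {v | v.1.word ∈ (T i)ᶜ})
    (Set.disjoint_left.2 fun v hv hv' => hv' hv)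
  exact (Submodule.disjoint_def.1 hd) x hx hx2

theorem span_classesIn_eq_top (d : ℕ) {T : Set (List Letter)}
    (hT : ∀ v : LinkState n, v.defects = d → v.word ∈ T) :
    Submodule.span (DiagAlg δ n) (classesIn δ n d T) = ⊤ := by
  rw [← Submodule.restrictScalars_eq_top_iff (S := ℂ), span_classesIn, eq_top_iff]
  rintro x -
  obtain ⟨⟨m, hm⟩, rfl⟩ := Submodule.Quotient.mk_surjective _ x
  change m ∈ Submodule.span ℂ {x | ∃ v : LinkState n, v.defects ≤ d ∧ x = linkBasis δ n v} at hm
  induction hm using Submodule.span_induction with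
  | zero => exact Submodule.zero_mem _
  | add x y hx hy h h' => exact Submodule.add_mem _ h h'
  | smul c x hx h => exact Submodule.smul_mem _ c h
  | mem x hx =>
    obtain ⟨v, hv, rfl⟩ := hx
    rcases hv.lt_or_eq with h | h
    · have := linkClass_eq_zero δ h
      rw [linkClass] at this
      rw [this]
      exact Submodule.zero_mem _
    · exact Submodule.subset_span ⟨v, h, hT v h, rfl⟩

theorem wordClasses_eq (d : ℕ) (w : List Letter) : wordClasses δ n d w = classesIn δ n d {w} := rfl

/-- The numbers of defects with each letter are functions of the boundary word, so the
decompositions by `(k, l)` and by words are both instances of the decomposition by sets of words. -/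
theorem klClasses_eq (d k l : ℕ) : klClasses δ n d k l =
    classesIn δ n d {w | w.count Letter.a = k ∧ w.count Letter.b = l} := by
  ext x
  simp only [klClasses, classesIn, Set.mem_ofPred_eq, LinkState.count_word]
  simp only [and_assoc]

theorem count_add_count (w : List Letter) :
    w.count Letter.a + w.count Letter.b = w.length := by
  induction w with
  | nil => rfl
  | cons x w ih => cases x <;> simp <;> omega

end quotients

/-! ### Linearity over the diagram algebra -/

section linear

variable {δ : ℂ} {n : ℕ}

/-- A complex linear map that commutes with diagrams on a basis is linear over the diagram
algebra. -/
noncomputable def diagLinear {ι M N : Type*} [AddCommGroup M] [Module ℂ M] [Module (DiagAlg δ n) M]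
    [IsScalarTower ℂ (DiagAlg δ n) M] [AddCommGroup N] [Module ℂ N] [Module (DiagAlg δ n) N]
    [IsScalarTower ℂ (DiagAlg δ n) N] (B : Module.Basis ι ℂ M) (f : M →ₗ[ℂ] N)
    (h : ∀ p i, f (diagBasis δ n p • B i) = diagBasis δ n p • f (B i)) : M →ₗ[DiagAlg δ n] N :=
  { f with
    map_smul' := by
      intro x m
      change f (x • m) = x • f m
      have hB : m ∈ Submodule.span ℂ (Set.range B) := by rw [B.span_eq]; trivial
      induction x using basis_induction (diagBasis δ n) with
      | zero => simp
      | add x y hx hy => rw [add_smul, map_add, hx, hy, add_smul]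
      | smul c x hx => rw [smul_assoc, map_smul, hx, smul_assoc]
      | basis p =>
        induction hB using Submodule.span_induction with
        | zero => simp
        | add x y _ _ hx hy => rw [smul_add, map_add, hx, hy, map_add, smul_add]
        | smul c x _ hx => rw [smul_algebra_smul_comm, map_smul, hx, map_smul, smul_algebra_smul_comm]
        | mem x hx => obtain ⟨i, rfl⟩ := hx; exact h p i }

theorem diagLinear_apply {ι M N : Type*} [AddCommGroup M] [Module ℂ M] [Module (DiagAlg δ n) M]
    [IsScalarTower ℂ (DiagAlg δ n) M] [AddCommGroup N] [Module ℂ N] [Module (DiagAlg δ n) N]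
    [IsScalarTower ℂ (DiagAlg δ n) N] (B : Module.Basis ι ℂ M) (f : M →ₗ[ℂ] N)
    (h : ∀ p i, f (diagBasis δ n p • B i) = diagBasis δ n p • f (B i)) (m : M) :
    diagLinear B f h m = f m := rfl

end linear

/-! ### The modules of words and their bases -/

section cells

open Diagram

variable (δ : ℂ) {n : ℕ}

theorem klModule_restrictScalars (d k l : ℕ) : (klModule δ n d k l).restrictScalars ℂ =
    Submodule.span ℂ (klClasses δ n d k l) := by
  rw [klModule, klClasses_eq, span_classesIn]

theorem wordModule_restrictScalars (d : ℕ) (w : List Letter) :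
    (wordModule δ n d w).restrictScalars ℂ = Submodule.span ℂ (wordClasses δ n d w) := by
  rw [wordModule, wordClasses_eq, span_classesIn]

theorem klModule_eq (d k l : ℕ) : klModule δ n d k l = Submodule.span (DiagAlg δ n)
    (classesIn δ n d {w | w.count Letter.a = k ∧ w.count Letter.b = l}) := by
  rw [klModule, klClasses_eq]

theorem upperLabel_castSucc (i : Fin n) : upperLabel i.castSucc = bar (upperLabel i) :=
  label_castS (Sum.inl i)

theorem upperLabel_last : upperLabel (Fin.last n) = Letter.a := by simp [upperLabel]

theorem alternatingWord_succ (n : ℕ) :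
    alternatingWord (n + 1) = (alternatingWord n).map bar ++ [Letter.a] := by
  rw [alternatingWord, alternatingWord, List.ofFn_succ', List.concat_eq_append, List.map_ofFn,
    upperLabel_last]
  congr 2
  exact funext upperLabel_castSucc

theorem bar_injective : Function.Injective bar := fun x y h => by rw [← bar_bar x, h, bar_bar]

/-- Appending the final `a` exchanges all earlier letters, which gives the recursion. The two counts
are `⌈n/2⌉` and `⌊n/2⌋`, the bounds on `k` and `l`. -/
theorem count_alternatingWord (n : ℕ) : (alternatingWord n).count Letter.a = (n + 1) / 2 ∧
    (alternatingWord n).count Letter.b = n / 2 := by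
  have hbar : ∀ (w : List Letter) x, (w.map bar).count x = w.count (bar x) := by
    intro w x
    conv_lhs => rw [← bar_bar x]
    exact List.count_map_of_injective w bar bar_injective (bar x)
  induction n with
  | zero => simp [alternatingWord]
  | succ n ih =>
    rw [alternatingWord_succ, List.count_append, List.count_append, hbar, hbar]
    simp only [bar, ih]
    constructor
    · simp; omega
    · simp

theorem iSupIndep_klModule (d : ℕ) (P : ℕ × ℕ → Prop) :
    iSupIndep fun i : {i : ℕ × ℕ // P i} => klModule δ n d i.1.1 i.1.2 := by
  simp only [klModule_eq]
  refine iSupIndep_span_classesIn δ d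
    (fun i : {i : ℕ × ℕ // P i} => {w | w.count Letter.a = i.1.1 ∧ w.count Letter.b = i.1.2}) ?_
  rintro i j hij
  rw [Set.disjoint_left]
  rintro w ⟨h1, h2⟩ ⟨h3, h4⟩
  exact hij (Subtype.ext (Prod.ext (h1.symm.trans h3) (h2.symm.trans h4)))

theorem iSup_klModule (d : ℕ) :
    (⨆ i : {i : ℕ × ℕ // i.1 + i.2 = d ∧ i.1 ≤ (n + 1) / 2 ∧ i.2 ≤ n / 2},
      klModule δ n d i.1.1 i.1.2) = ⊤ := by
  simp only [klModule_eq]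
  rw [iSup_span_classesIn δ d
    (fun i : {i : ℕ × ℕ // i.1 + i.2 = d ∧ i.1 ≤ (n + 1) / 2 ∧ i.2 ≤ n / 2} =>
      {w | w.count Letter.a = i.1.1 ∧ w.count Letter.b = i.1.2})]
  apply span_classesIn_eq_top
  intro v hv
  have hs : v.word.Sublist (alternatingWord n) := v.word_mem_subwords
  exact Set.mem_iUnion.2 ⟨⟨(v.word.count Letter.a, v.word.count Letter.b),
    by rw [count_add_count, v.length_word, hv],
    (hs.count_le _).trans (count_alternatingWord n).1.le,
    (hs.count_le _).trans (count_alternatingWord n).2.le⟩, rfl, rfl⟩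

theorem iSupIndep_wordModule (d : ℕ) (T : Set (List Letter)) :
    iSupIndep fun w : T => wordModule δ n d w.1 := by
  simp only [wordModule, wordClasses_eq]
  refine iSupIndep_span_classesIn δ d (fun w : T => {w.1}) ?_
  intro i j hij
  rw [Set.disjoint_singleton]
  exact fun h => hij (Subtype.ext h)

theorem iSup_wordModule (k l : ℕ) :
    (⨆ w : subwordsOf n k l, wordModule δ n (k + l) w.1) = klModule δ n (k + l) k l := by
  simp only [wordModule, wordClasses_eq, klModule_eq]
  rw [iSup_span_classesIn δ (k + l) fun w : subwordsOf n k l => {w.1}]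
  congr 1
  ext x
  constructor
  · rintro ⟨v, h, hv, rfl⟩
    obtain ⟨w, hw⟩ := Set.mem_iUnion.1 hv
    exact ⟨v, h, by rw [show v.word = w.1 from hw]; exact w.2.2, rfl⟩
  · rintro ⟨v, h, hv, rfl⟩
    exact ⟨v, h, Set.mem_iUnion.2 ⟨⟨v.word, v.word_mem_subwords, hv⟩, rfl⟩, rfl⟩

/-- The class of a link state, in the module of its boundary word. -/
noncomputable def cellVec (w : List Letter) (u : {u : LinkState n // u.word = w}) :
    wordModule δ n w.length w :=
  ⟨linkClass δ n u.1 (by rw [← u.1.length_word, u.2]),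
    Submodule.subset_span ⟨u.1, by rw [← u.1.length_word, u.2], u.2, rfl⟩⟩

theorem linearIndependent_cellVec (w : List Letter) :
    LinearIndependent ℂ (cellVec δ (n := n) w) := by
  have h := (linearIndependent_topClass δ (n := n) w.length).comp
    (fun u : {u : LinkState n // u.word = w} =>
      (⟨u.1, by rw [← u.1.length_word, u.2]⟩ : {v : LinkState n // v.defects = w.length}))
    (fun u v huv => Subtype.ext (congrArg (fun x => x.1) huv))
  exact LinearIndependent.of_comp ((wordModule δ n w.length w).subtype.restrictScalars ℂ) h

theorem span_cellVec (w : List Letter) :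
    ⊤ ≤ Submodule.span ℂ (Set.range (cellVec δ (n := n) w)) := by
  rintro ⟨x, hx⟩ -
  have hx' : x ∈ (wordModule δ n w.length w).restrictScalars ℂ := hx
  rw [wordModule_restrictScalars] at hx'
  have key : ∀ y ∈ Submodule.span ℂ (wordClasses δ n w.length w),
      ∀ hy : y ∈ wordModule δ n w.length w,
      (⟨y, hy⟩ : wordModule δ n w.length w) ∈
        Submodule.span ℂ (Set.range (cellVec δ (n := n) w)) := by
    intro y hy
    have hle : ∀ y ∈ Submodule.span ℂ (wordClasses δ n w.length w),
        y ∈ wordModule δ n w.length w := by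
      intro y hy
      rw [← wordModule_restrictScalars] at hy
      exact hy
    induction hy using Submodule.span_induction with
    | zero => exact fun _ => Submodule.zero_mem _
    | add x y hx hy h h' => exact fun _ => Submodule.add_mem _ (h (hle x hx)) (h' (hle y hy))
    | smul c x hx h => exact fun _ => Submodule.smul_mem _ c (h (hle x hx))
    | mem x hx =>
      obtain ⟨v, hv, hw, rfl⟩ := hx
      exact fun _ => Submodule.subset_span ⟨⟨v, hw⟩, rfl⟩
  exact key x hx' hx

/-- The module of a word has the link states with this boundary word as a basis. -/
noncomputable def cellBasis (w : List Letter) :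
    Module.Basis {u : LinkState n // u.word = w} ℂ (wordModule δ n w.length w) :=
  Module.Basis.mk (linearIndependent_cellVec δ w) (span_cellVec δ w)

theorem smul_cellBasis {w : List Letter} (p : ABDiagram n) (u : {u : LinkState n // u.word = w})
    (h : (u.1.act p).word = w) : diagBasis δ n p • cellBasis δ w u =
      δ ^ loops p.1 u.1.1 • cellBasis δ w ⟨u.1.act p, h⟩ := by
  rw [cellBasis, Module.Basis.mk_apply, Module.Basis.mk_apply]
  exact Subtype.ext (smul_linkClass δ p u.1 (by rw [← u.1.length_word, u.2]))

/-- A changed word means lost defects, by `LinkState.word_act`, so the class vanishes in the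
quotient. -/
theorem smul_cellBasis_eq_zero {w : List Letter} (p : ABDiagram n)
    (u : {u : LinkState n // u.word = w}) (h : (u.1.act p).word ≠ w) :
    diagBasis δ n p • cellBasis δ w u = 0 := by
  rw [cellBasis, Module.Basis.mk_apply]
  refine Subtype.ext ((smul_linkClass δ p u.1 (by rw [← u.1.length_word, u.2])).trans ?_)
  rw [linkClass_eq_zero, smul_zero]
  · rfl
  · have h1 := u.1.defects_act_le p
    have h2 : (u.1.act p).defects ≠ u.1.defects :=
      fun hh => h ((LinkState.word_act hh.ge).trans u.2)
    have h3 : u.1.defects = w.length := by rw [← u.1.length_word, u.2]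
    omega

end cells

/-- Semisimplicity gives `I = Re` with `e` idempotent, so `e` is a right identity of `I`. The
elements of `I` killed by `I` from the left form a left ideal `N`, because `I` is two-sided. The
idempotent generator of `N` lies in `I`, so it kills itself and is zero. As `x - e * x` lies in `N`
for every `x` in `I`, the same `e` is a left identity. -/
theorem exists_left_identity {R : Type*} [Ring R] [IsSemisimpleRing R] (I : Ideal R)
    (hI : ∀ x ∈ I, ∀ r, x * r ∈ I) : ∃ z ∈ I, ∀ x ∈ I, z * x = x := by
  obtain ⟨e, he, hIe⟩ := IsSemisimpleRing.ideal_eq_span_idempotent I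
  have heI : e ∈ I := by rw [hIe]; exact Ideal.mem_span_singleton_self e
  have hr : ∀ x ∈ I, x * e = x := by
    intro x hx
    rw [hIe, Ideal.mem_span_singleton'] at hx
    obtain ⟨a, rfl⟩ := hx
    rw [mul_assoc, he.eq]
  let N : Ideal R :=
    { carrier := {x | x ∈ I ∧ ∀ y ∈ I, y * x = 0}
      add_mem' := fun {x y} hx hy => ⟨I.add_mem hx.1 hy.1, fun z hz => by
        rw [mul_add, hx.2 z hz, hy.2 z hz, add_zero]⟩
      zero_mem' := ⟨I.zero_mem, fun y _ => mul_zero y⟩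
      smul_mem' := fun r x hx => ⟨I.smul_mem r hx.1, fun y hy => by
        rw [smul_eq_mul, ← mul_assoc]; exact hx.2 _ (hI y hy r)⟩ }
  obtain ⟨f, hf, hNf⟩ := IsSemisimpleRing.ideal_eq_span_idempotent N
  have hfN : f ∈ N := by rw [hNf]; exact Ideal.mem_span_singleton_self f
  have hf0 : f = 0 := by rw [← hf.eq]; exact hfN.2 f hfN.1
  refine ⟨e, heI, fun x hx => ?_⟩
  have hN : x - e * x ∈ N := by
    refine ⟨I.sub_mem hx (I.smul_mem e hx), fun y hy => ?_⟩
    rw [mul_sub, ← mul_assoc, hr y hy, sub_self]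
  rw [hNf, hf0, Ideal.span_singleton_eq_bot.2 rfl] at hN
  exact (sub_eq_zero.1 hN).symm

/-! ### Simplicity, inequivalence and completeness -/

section semisimple

open Diagram

variable (δ : ℂ) {n : ℕ}

/-- The diagrams whose through strings read `w`, or that have less through strings. -/
def wordDiagrams (n : ℕ) (w : List Letter) : Set (ABDiagram n) :=
  {p | p.upper.word = w ∨ p.upper.defects < w.length}

/-- Placing `q` on top loses strings or keeps the word. Hence a single word, together with all
diagrams with fewer strings, suffices for an ideal; other words of the same length need not be
included. -/
theorem comp_mem_wordDiagrams {w : List Letter} {p : ABDiagram n} (q : ABDiagram n)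
    (hp : p ∈ wordDiagrams n w) : q.comp p ∈ wordDiagrams n w := by
  have h := p.upper.defects_act_le q
  rcases hp with rfl | hp
  · rcases h.lt_or_eq with h' | h'
    · right
      rwa [ABDiagram.upper_comp, LinkState.length_word]
    · left
      rw [ABDiagram.upper_comp, LinkState.word_act_iff, h']
  · right
    rw [ABDiagram.upper_comp]
    exact h.trans_lt hp

/-- With `q` below `p` the argument is more direct: if the product keeps all strings of `p`, its
upper half is that of `p`. -/
theorem mem_wordDiagrams_comp {w : List Letter} {p : ABDiagram n} (q : ABDiagram n)
    (hp : p ∈ wordDiagrams n w) : p.comp q ∈ wordDiagrams n w := by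
  have h := q.upper.defects_act_le_upper p
  rcases hp with rfl | hp
  · rcases h.lt_or_eq with h' | h'
    · right
      rwa [ABDiagram.upper_comp, LinkState.length_word]
    · left
      rw [ABDiagram.upper_comp, LinkState.act_eq_upper h'.ge]
  · right
    rw [ABDiagram.upper_comp]
    exact h.trans_lt hp

/-- The ideal spanned by the diagrams whose through strings read `w` and by those that have less
through strings. -/
noncomputable def wordIdeal (n : ℕ) (w : List Letter) : Ideal (DiagAlg δ n) :=
  { Submodule.span ℂ (diagBasis δ n '' wordDiagrams n w) with
    smul_mem' := by
      intro x m hm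
      change x * m ∈ Submodule.span ℂ (diagBasis δ n '' wordDiagrams n w)
      change m ∈ Submodule.span ℂ (diagBasis δ n '' wordDiagrams n w) at hm
      induction x using basis_induction (diagBasis δ n) with
      | zero => rw [zero_mul]; exact Submodule.zero_mem _
      | add x y hx hy => rw [add_mul]; exact Submodule.add_mem _ hx hy
      | smul c x hx => rw [smul_mul_assoc]; exact Submodule.smul_mem _ c hx
      | basis q =>
        induction hm using Submodule.span_induction with
        | zero => rw [mul_zero]; exact Submodule.zero_mem _
        | add m m' _ _ hm hm' => rw [mul_add]; exact Submodule.add_mem _ hm hm'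
        | smul c m _ hm => rw [mul_smul_comm]; exact Submodule.smul_mem _ c hm
        | mem m hm =>
          obtain ⟨p, hp, rfl⟩ := hm
          rw [DiagAlg.basis_mul]
          exact Submodule.smul_mem _ _ (Submodule.subset_span ⟨_, comp_mem_wordDiagrams q hp, rfl⟩) }

theorem mem_wordIdeal {w : List Letter} {x : DiagAlg δ n} : x ∈ wordIdeal δ n w ↔
    x ∈ Submodule.span ℂ (diagBasis δ n '' wordDiagrams n w) := Iff.rfl

theorem wordIdeal_mul {w : List Letter} {x : DiagAlg δ n} (hx : x ∈ wordIdeal δ n w)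
    (y : DiagAlg δ n) : x * y ∈ wordIdeal δ n w := by
  rw [mem_wordIdeal] at hx ⊢
  induction y using basis_induction (diagBasis δ n) with
  | zero => rw [mul_zero]; exact Submodule.zero_mem _
  | add x y hx hy => rw [mul_add]; exact Submodule.add_mem _ hx hy
  | smul c x hx => rw [mul_smul_comm]; exact Submodule.smul_mem _ c hx
  | basis q =>
    induction hx using Submodule.span_induction with
    | zero => rw [zero_mul]; exact Submodule.zero_mem _
    | add m m' _ _ hm hm' => rw [add_mul]; exact Submodule.add_mem _ hm hm'
    | smul c m _ hm => rw [smul_mul_assoc]; exact Submodule.smul_mem _ c hm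
    | mem m hm =>
      obtain ⟨p, hp, rfl⟩ := hm
      rw [DiagAlg.basis_mul]
      exact Submodule.smul_mem _ _ (Submodule.subset_span ⟨_, mem_wordDiagrams_comp q hp, rfl⟩)

theorem wordIdeal_smul_eq_zero {M : Type*} [AddCommGroup M] [Module ℂ M] [Module (DiagAlg δ n) M]
    [IsScalarTower ℂ (DiagAlg δ n) M] {w : List Letter} {m : M}
    (h : ∀ p ∈ wordDiagrams n w, diagBasis δ n p • m = 0) {x : DiagAlg δ n}
    (hx : x ∈ wordIdeal δ n w) : x • m = 0 := by
  rw [mem_wordIdeal] at hx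
  induction hx using Submodule.span_induction with
  | zero => rw [zero_smul]
  | add m m' _ _ hm hm' => rw [add_smul, hm, hm', add_zero]
  | smul c m _ hm => rw [smul_assoc, hm, smul_zero]
  | mem m hm => obtain ⟨p, hp, rfl⟩ := hm; exact h p hp

theorem smul_wordModule_eq_zero {w : List Letter} {p : ABDiagram n}
    (hp : ∀ u : LinkState n, u.word = w → (u.act p).word ≠ w)
    (x : wordModule δ n w.length w) : diagBasis δ n p • x = 0 := by
  induction x using basis_induction (cellBasis δ w) with
  | zero => rw [smul_zero]
  | add x y hx hy => rw [smul_add, hx, hy, add_zero]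
  | smul c x hx => rw [smul_algebra_smul_comm, hx, smul_zero]
  | basis u => exact smul_cellBasis_eq_zero δ p u (hp u.1 u.2)

/-- A diagram in the ideal of `w` has at most `|w|` strings. If at least `|w|` defects remain after
its action, it has word `w`, all its strings survive, and the result is its upper half. This
controls the action on the module of `w` as well as on those of words that are not shorter. -/
theorem word_upper_of_word_act {w : List Letter} {p : ABDiagram n} (hp : p ∈ wordDiagrams n w)
    {u : LinkState n} {w' : List Letter} (h : (u.act p).word = w') (hl : w.length ≤ w'.length) :
    u.act p = p.upper ∧ w = w' := by
  have h1 := u.defects_act_le_upper p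
  rw [← LinkState.length_word, h] at h1
  rcases hp with rfl | hp
  · have h2 : u.act p = p.upper := LinkState.act_eq_upper (by
      rw [← LinkState.length_word, ← LinkState.length_word, h]; exact hl)
    exact ⟨h2, by rw [← h, h2]⟩
  · omega

/-- A one-dimensional image: a diagram whose through strings read `w` maps the module of `w` to the
line spanned by its upper half. -/
theorem exists_smul_eq {w : List Letter} {p : ABDiagram n} (hp : p.upper.word = w)
    (x : wordModule δ n w.length w) :
    ∃ c : ℂ, diagBasis δ n p • x = c • cellBasis δ w ⟨p.upper, hp⟩ := by
  induction x using basis_induction (cellBasis δ w) with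
  | zero => exact ⟨0, by rw [smul_zero, zero_smul]⟩
  | add x y hx hy =>
    obtain ⟨c, hc⟩ := hx
    obtain ⟨d, hd⟩ := hy
    exact ⟨c + d, by rw [smul_add, hc, hd, add_smul]⟩
  | smul c x hx =>
    obtain ⟨d, hd⟩ := hx
    exact ⟨c * d, by rw [smul_algebra_smul_comm, hd, smul_smul]⟩
  | basis u =>
    by_cases h : (u.1.act p).word = w
    · refine ⟨δ ^ loops p.1 u.1.1, ?_⟩
      rw [smul_cellBasis δ p u h]
      congr 3
      exact (word_upper_of_word_act (Or.inl hp) h le_rfl).1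
    · exact ⟨0, by rw [zero_smul, smul_cellBasis_eq_zero δ p u h]⟩

/-- On one point, let `e` be the diagram of two singletons. It lies in the ideal of diagrams without
through strings, and for `δ = 0` this ideal annihilates `e`, since stacking always erases the middle
block. This contradicts the existence of a left identity. -/
theorem loopParameter_ne_zero (h : IsSemisimpleRing (DiagAlg δ 1)) : δ ≠ 0 := by
  rintro rfl
  have hbot : IsABAdmissible (⊥ : Setoid (Fin 1 ⊕ Fin 1)) := by
    refine ⟨?_, ?_, ?_⟩
    · intro x y z t _ _ _ hxz _
      obtain rfl : x = z := hxz
      omega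
    · intro x y z hxy _
      exact Or.inl hxy
    · intro x y hxy hne
      exact absurd hxy hne
  let e : ABDiagram 1 := ⟨⊥, hbot⟩
  have hth : ∀ {p : ABDiagram 1}, p ∈ wordDiagrams 1 [] → ∀ i, ¬ Through p.1 i := by
    intro p hp i hi
    have h0 : p.upper.defects = 0 := by
      rcases hp with hp | hp
      · rw [← LinkState.length_word, hp]; rfl
      · exact absurd hp (by simp)
    have : IsEmpty {i // Defect p.upper.1 i} := by
      rw [← Finite.card_eq_zero_iff]; exact h0
    exact this.elim ⟨i, p.defect_upper.2 hi⟩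
  have he : ∀ i : Fin 1, ¬ CoThrough e.1 i := by
    rintro i ⟨j, hj⟩
    have : (Sum.inl j : Fin 1 ⊕ Fin 1) = Sum.inr i := hj
    simp at this
  -- Neither `p` nor `e` has a through string, so the middle point is joined to no outer point and
  -- its block is erased.
  have hloop : ∀ p ∈ wordDiagrams 1 [], loops p.1 e.1 ≠ 0 := by
    intro p hp
    have hfin : Finite (Quotient (glue p.1 e.1)) := Quotient.finite _
    refine Nat.card_ne_zero.2 ⟨⟨⟨Quotient.mk _ (Sum.inr (Sum.inl 0)), ?_⟩⟩, inferInstance⟩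
    rintro (x | x) hx
    · obtain ⟨x', h, _⟩ := (glue_inl_iff (hth hp x)).1 (Quotient.exact hx)
      simp at h
    · obtain ⟨x', h, _⟩ := (glue_inr_iff (he x)).1 (Quotient.exact hx)
      simp at h
  obtain ⟨z, hz, hz'⟩ := exists_left_identity (wordIdeal 0 1 []) fun x hx r => wordIdeal_mul 0 hx r
  have heI : e ∈ wordDiagrams 1 [] := by
    left
    rw [List.eq_nil_iff_length_eq_zero, LinkState.length_word, ← ABDiagram.card_coThrough]
    have : IsEmpty {j // CoThrough e.1 j} := ⟨fun j => he j.1 j.2⟩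
    exact Nat.card_of_isEmpty
  have h1 := hz' (diagBasis 0 1 e) (Submodule.subset_span ⟨e, heI, rfl⟩)
  have h2 : z • diagBasis 0 1 e = 0 := by
    refine wordIdeal_smul_eq_zero 0 (fun p hp => ?_) hz
    rw [smul_eq_mul, DiagAlg.basis_mul, zero_pow (hloop p hp), zero_smul]
  rw [smul_eq_mul, h1] at h2
  exact (diagBasis 0 1).ne_zero e h2

variable {δ}

/-- A left identity of the ideal fixes every vector `e • v` with `e` in the ideal. A link state is
of this form up to a power of `δ`: the diagram joining it to itself fixes it up to such a power. The
power can be cancelled because `δ ≠ 0`. -/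
theorem exists_wordIdentity [IsSemisimpleRing (DiagAlg δ n)] (hδ : δ ≠ 0) (w : List Letter) :
    ∃ z ∈ wordIdeal δ n w, ∀ x : wordModule δ n w.length w, z • x = x := by
  obtain ⟨z, hz, hz'⟩ := exists_left_identity (wordIdeal δ n w) fun x hx r => wordIdeal_mul δ hx r
  refine ⟨z, hz, fun x => ?_⟩
  induction x using basis_induction (cellBasis δ w) with
  | zero => rw [smul_zero]
  | add x y hx hy => rw [smul_add, hx, hy]
  | smul c x hx => rw [smul_algebra_smul_comm, hx]
  | basis u =>
    obtain ⟨u, hu⟩ := u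
    let e := ABDiagram.join u u rfl
    have he : e ∈ wordDiagrams n w := Or.inl (by rw [ABDiagram.upper_join, hu])
    have hact : u.act e = u := LinkState.act_join u u rfl
    have h1 : diagBasis δ n e • cellBasis δ w ⟨u, hu⟩ =
        δ ^ loops e.1 u.1 • cellBasis δ w ⟨u, hu⟩ := by
      rw [smul_cellBasis δ e ⟨u, hu⟩ (by rw [hact, hu])]
      congr 3
    have h2 : z • (diagBasis δ n e • cellBasis δ w ⟨u, hu⟩) =
        diagBasis δ n e • cellBasis δ w ⟨u, hu⟩ := by
      rw [smul_smul, hz' _ (Submodule.subset_span ⟨e, he, rfl⟩)]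
    rw [h1, smul_algebra_smul_comm] at h2
    exact smul_right_injective _ (pow_ne_zero _ hδ) h2

/-- Since `z` fixes a nonzero `x`, some diagram of the ideal does not kill `x`. Its word is `w`, its
value on `x` is a nonzero multiple of its upper half, and joins carry this link state to all others.
So every nonzero vector generates. -/
theorem isSimpleModule_wordModule [IsSemisimpleRing (DiagAlg δ n)] (hδ : δ ≠ 0) {w : List Letter}
    (hw : w ∈ subwords n) : IsSimpleModule (DiagAlg δ n) (wordModule δ n w.length w) := by
  obtain ⟨u₀, hu₀⟩ := exists_linkState_word hw
  obtain ⟨z, hz, hz'⟩ := exists_wordIdentity (n := n) hδ w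
  have : Nontrivial (wordModule δ n w.length w) :=
    ⟨cellBasis δ w ⟨u₀, hu₀⟩, 0, (cellBasis δ w).ne_zero _⟩
  rw [isSimpleModule_iff_toSpanSingleton_surjective]
  refine ⟨this, fun x hx => ?_⟩
  have hp : ∃ p ∈ wordDiagrams n w, diagBasis δ n p • x ≠ 0 := by
    by_contra! h
    exact hx ((hz' x).symm.trans (wordIdeal_smul_eq_zero (M := wordModule δ n w.length w) δ h hz))
  obtain ⟨p, hp, hpx⟩ := hp
  have hpw : p.upper.word = w := by
    by_contra hne
    refine hpx (smul_wordModule_eq_zero δ (fun u hu h => hne ?_) x)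
    rw [← (word_upper_of_word_act hp h le_rfl).1, h]
  obtain ⟨c, hc⟩ := exists_smul_eq δ hpw x
  have hc0 : c ≠ 0 := by
    rintro rfl
    exact hpx (by rw [hc, zero_smul])
  rw [← LinearMap.range_eq_top, ← Submodule.restrictScalars_eq_top_iff (S := ℂ), eq_top_iff,
    ← (cellBasis δ w).span_eq, Submodule.span_le]
  rintro _ ⟨⟨u, hu⟩, rfl⟩
  let e := ABDiagram.join u p.upper (hu.trans hpw.symm)
  have hact : p.upper.act e = u := LinkState.act_join _ _ _
  -- The scalar cancels the coefficient `c` of the upper half and the loops erased when the join is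
  -- applied to it.
  refine ⟨(c * δ ^ loops e.1 p.upper.1)⁻¹ • (diagBasis δ n e * diagBasis δ n p), ?_⟩
  rw [LinearMap.toSpanSingleton_apply, smul_assoc, mul_smul, hc, smul_algebra_smul_comm,
    smul_cellBasis δ e ⟨p.upper, hpw⟩ (by rw [hact, hu]), smul_smul, smul_smul,
    mul_assoc]
  exact (congrArg₂ (· • ·) (inv_mul_cancel₀ (mul_ne_zero hc0 (pow_ne_zero _ hδ)))
    (congrArg (cellBasis δ w) (Subtype.ext hact))).trans (one_smul ℂ _)

/-- If `w` is the word that is not longer and the words differ, the ideal of `w` kills the module of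
`w'`, while one of its elements is the identity on the nonzero module of `w`. -/
theorem eq_of_wordModule_equiv [IsSemisimpleRing (DiagAlg δ n)] (hδ : δ ≠ 0) {w w' : List Letter}
    (hw : w ∈ subwords n) (hw' : w' ∈ subwords n)
    (h : Nonempty (wordModule δ n w.length w ≃ₗ[DiagAlg δ n] wordModule δ n w'.length w')) :
    w = w' := by
  wlog hl : w.length ≤ w'.length generalizing w w'
  · exact (this hw' hw (h.map fun f => f.symm) (by omega)).symm
  obtain ⟨f⟩ := h
  obtain ⟨u, hu⟩ := exists_linkState_word hw
  obtain ⟨z, hz, hz'⟩ := exists_wordIdentity (n := n) hδ w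
  by_contra hne
  have h1 : z • f (cellBasis δ w ⟨u, hu⟩) = 0 := by
    refine wordIdeal_smul_eq_zero (M := wordModule δ n w'.length w') δ
      (fun p hp => smul_wordModule_eq_zero δ (fun v hv hpv => ?_) (f (cellBasis δ w ⟨u, hu⟩))) hz
    exact hne (word_upper_of_word_act hp hpv hl).2
  rw [← map_smul, hz', LinearEquiv.map_eq_zero_iff] at h1
  exact (cellBasis δ w).ne_zero _ h1

/-- Every simple module is the module of a word. -/
theorem exists_wordModule_equiv [IsSemisimpleRing (DiagAlg δ n)] (hδ : δ ≠ 0) (S : Type*)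
    [AddCommGroup S] [Module (DiagAlg δ n) S] [IsSimpleModule (DiagAlg δ n) S] :
    ∃ w ∈ subwords n, Nonempty (S ≃ₗ[DiagAlg δ n] wordModule δ n w.length w) := by
  classical
  let _ : Module ℂ S := Module.compHom S (algebraMap ℂ (DiagAlg δ n))
  have _ : IsScalarTower ℂ (DiagAlg δ n) S := ⟨fun c x s => by
    change (c • x) • s = (algebraMap ℂ (DiagAlg δ n) c) • (x • s)
    rw [Algebra.smul_def, mul_smul]⟩
  have _ : Nontrivial S := IsSimpleModule.nontrivial (DiagAlg δ n) S
  obtain ⟨s₀, hs₀⟩ := exists_ne (0 : S)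
  -- Among all diagrams that do not kill `S`, one with the fewest through strings is taken; the
  -- identity shows that there is one. Its word is the word sought.
  have hex : ∃ d, ∃ p : ABDiagram n, ∃ s : S, p.upper.defects = d ∧ diagBasis δ n p • s ≠ 0 :=
    ⟨_, ABDiagram.one n, s₀, rfl, by rw [← DiagAlg.one_def, one_smul]; exact hs₀⟩
  obtain ⟨p, s, hp, hps⟩ := Nat.find_spec hex
  have hmin : ∀ q : ABDiagram n, q.upper.defects < p.upper.defects → ∀ t : S,
      diagBasis δ n q • t = 0 := by
    intro q hq t
    by_contra hne
    exact Nat.find_min hex (hp ▸ hq) ⟨q, t, rfl, hne⟩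
  set w := p.upper.word with hw
  refine ⟨w, p.upper.word_mem_subwords, ?_⟩
  -- The diagram `r u` has upper half `u` and keeps all strings of `p`. The map to `S` sends the
  -- link state `u` to `r u` applied to `s`.
  let r : {u : LinkState n // u.word = w} → ABDiagram n := fun u =>
    (ABDiagram.join u.1 p.upper u.2).comp p
  have hr : ∀ u, (r u).upper = u.1 := fun u => by
    rw [ABDiagram.upper_comp]; exact LinkState.act_join _ _ _
  have hdef : ∀ u : {u : LinkState n // u.word = w}, u.1.defects = p.upper.defects := fun u => by
    rw [← LinkState.length_word, u.2, hw, LinkState.length_word]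
  let f : wordModule δ n w.length w →ₗ[ℂ] S :=
    (cellBasis δ w).constr ℂ fun u => diagBasis δ n (r u) • s
  have hf : ∀ u, f (cellBasis δ w u) = diagBasis δ n (r u) • s := fun u =>
    Module.Basis.constr_basis _ _ _ _
  let F : wordModule δ n w.length w →ₗ[DiagAlg δ n] S := diagLinear (cellBasis δ w) f (by
    intro q u
    -- The product of `q` with `r u` erases as many blocks as `q` on top of the link state `u`, so
    -- the scalars agree. If the word survives, both diagrams keep all strings of `p` and have the
    -- same upper half; if not, the product has too few strings and kills `S` by minimality.
    rw [hf, smul_smul, DiagAlg.basis_mul, smul_assoc, ABDiagram.loops_eq_loops_upper, hr]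
    have hqr : (q.comp (r u)).upper = u.1.act q := by rw [ABDiagram.upper_comp, hr]
    by_cases h : (u.1.act q).word = w
    · rw [smul_cellBasis δ q u h, map_smul, hf]
      congr 3
      have hcomp : q.comp (r u) = (q.comp (ABDiagram.join u.1 p.upper u.2)).comp p :=
        Subtype.ext (comp_assoc _ _ _).symm
      rw [hcomp] at hqr ⊢
      refine (ABDiagram.comp_eq_of_upper_eq ?_ ?_).symm
      · rw [hqr]
        exact (hdef ⟨_, h⟩).ge
      · rw [hqr]
        exact (hr ⟨_, h⟩).symm
    · rw [smul_cellBasis_eq_zero δ q u h, map_zero, hmin, smul_zero]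
      rw [hqr, ← hdef u]
      refine lt_of_le_of_ne (u.1.defects_act_le q) fun h' => h ?_
      rw [LinkState.word_act h'.ge, u.2])
  have hF : F ≠ 0 := by
    intro h0
    have h1 : F (cellBasis δ w ⟨p.upper, rfl⟩) = 0 := by rw [h0]; rfl
    rw [diagLinear_apply, hf] at h1
    refine hps ?_
    convert h1 using 3
    -- The diagram attached to the upper half of `p` is `p` itself, by uniqueness from the upper
    -- half; so the map takes the nonzero value `p • s`.
    have h2 : (ABDiagram.one n).comp p = p := Subtype.ext (comp_id_left p.1)
    have h3 : (ABDiagram.one n).comp p = (ABDiagram.join p.upper p.upper rfl).comp p :=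
      ABDiagram.comp_eq_of_upper_eq (by rw [h2]) (by rw [h2]; exact (hr ⟨p.upper, rfl⟩).symm)
    exact h2.symm.trans h3
  have := isSimpleModule_wordModule (n := n) hδ (p.upper.word_mem_subwords)
  exact ⟨(LinearEquiv.ofBijective F ((LinearMap.bijective_or_eq_zero F).resolve_right hF)).symm⟩

/-- Without defects the only boundary word is the empty one, and nothing is divided out; so this is
the module of the empty word. -/
theorem isSimpleModule_linkSub_zero [IsSemisimpleRing (DiagAlg δ n)] (hδ : δ ≠ 0) :
    IsSimpleModule (DiagAlg δ n) (linkSub δ n 0) := by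
  have h1 : IsSimpleModule (DiagAlg δ n) (wordModule δ n 0 []) :=
    isSimpleModule_wordModule (w := []) hδ (List.nil_sublist _)
  have h2 : wordModule δ n 0 [] = ⊤ := by
    rw [wordModule, wordClasses_eq]
    refine span_classesIn_eq_top δ 0 fun v hv => ?_
    rw [Set.mem_singleton_iff, List.eq_nil_iff_length_eq_zero, LinkState.length_word, hv]
  have h3 : (linkSubPrev δ n 0).submoduleOf (linkSub δ n 0) = ⊥ := by
    ext x
    change (x : LinkModule δ n) = 0 ↔ x = 0
    exact ZeroMemClass.coe_eq_zero
  have e : wordModule δ n 0 [] ≃ₗ[DiagAlg δ n] linkSub δ n 0 :=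
    (LinearEquiv.ofEq _ _ h2).trans (Submodule.topEquiv.trans (Submodule.quotEquivOfEqBot _ h3))
  exact IsSimpleModule.congr e.symm

end semisimple

namespace Diagram

/-! ### Partitions pulled back along maps -/

section collapse

/-- Blocks of a pulled back partition. -/
theorem deadCount_comap {E E' O O' : Type} (H : Setoid E) (f : E' → E)
    (hf : Function.Surjective f) (o : O → E) (o' : O' → E') (h1 : ∀ x', ∃ x, f (o' x') = o x)
    (h2 : ∀ x, ∃ x', f (o' x') = o x) : deadCount (H.comap f) o' = deadCount H o := by
  unfold deadCount
  let g : Quotient (H.comap f) → Quotient H := Quotient.map f fun _ _ h => h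
  refine Nat.card_congr (Equiv.ofBijective
    (fun c : {c : Quotient (H.comap f) // ∀ x, Quotient.mk (H.comap f) (o' x) ≠ c} =>
      (⟨g c.1, ?_⟩ : {c : Quotient H // ∀ x, Quotient.mk H (o x) ≠ c})) ⟨?_, ?_⟩)
  · obtain ⟨c, hc⟩ := c
    induction c using Quotient.ind with
    | _ a =>
      intro x hx
      obtain ⟨x', hx'⟩ := h2 x
      refine hc x' (Quotient.sound ?_)
      change H (f (o' x')) (f a)
      rw [hx']
      exact Quotient.exact hx
  · rintro ⟨a, ha⟩ ⟨b, hb⟩ hab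
    induction a using Quotient.ind with
    | _ a =>
      induction b using Quotient.ind with
      | _ b =>
        have h : Quotient.mk H (f a) = Quotient.mk H (f b) := congrArg Subtype.val hab
        have h' : H (f a) (f b) := Quotient.exact h
        exact Subtype.ext (Quotient.sound h')
  · rintro ⟨c, hc⟩
    induction c using Quotient.ind with
    | _ e =>
      obtain ⟨e', rfl⟩ := hf e
      refine ⟨⟨Quotient.mk _ e', fun x' hx' => ?_⟩, rfl⟩
      obtain ⟨x, hx⟩ := h1 x'
      apply hc x
      rw [← hx]
      have : (H.comap f) (o' x') e' := Quotient.exact hx'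
      exact Quotient.sound this

theorem comap_map_le {E E' : Type} {s t : Setoid E'} {f : E' → E} {g : E → E'} (hst : s ≤ t)
    (hg : ∀ x, t x (g (f x))) : (s.map f).comap f ≤ t := by
  have h : s.map f ≤ t.comap g :=
    map_le_iff.2 fun x y h => t.trans (t.symm (hg x)) (t.trans (hst h) (hg y))
  exact fun x y hxy => t.trans (hg x) (t.trans (h hxy) (t.symm (hg y)))

/-- When `f` has a section, pushing forward and pulling back adds only the identifications made by
`f` itself. -/
theorem comap_map_eq {E E' : Type} {s : Setoid E'} {f : E' → E} {g : E → E'}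
    (hg : ∀ x, f (g x) = x) : (s.map f).comap f = s ⊔ Setoid.ker f := by
  apply le_antisymm
  · refine comap_map_le (g := g) le_sup_left fun x => ?_
    exact (le_sup_right : Setoid.ker f ≤ s ⊔ Setoid.ker f) (hg (f x)).symm
  · refine sup_le (fun x y h => map_rel h) fun x y h => ?_
    change s.map f (f x) (f y)
    rw [show f x = f y from h]

theorem comap_injective {E E' : Type} {s t : Setoid E} {f : E' → E} (hf : Function.Surjective f)
    (h : s.comap f = t.comap f) : s = t := by
  ext x y
  obtain ⟨x, rfl⟩ := hf x
  obtain ⟨y, rfl⟩ := hf y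
  exact Setoid.ext_iff.1 h x y

end collapse

/-! ### Diagrams with an added strand acting on a last point -/

section restriction

variable {n : ℕ}

/-- The points of a link state, as points of a link state with one more point on the right. -/
def castI : Fin n ⊕ Fin 1 → Fin (n + 1) ⊕ Fin 1 := Sum.map Fin.castSucc id

/-- Removing the last point. -/
def unpoint : Fin (n + 1) ⊕ Fin 1 → Option (Fin n ⊕ Fin 1) :=
  Sum.elim (fun i => (strip i).map Sum.inl) fun x => some (Sum.inr x)

/-- Moving the last point to the extra point. -/
def collapse : Fin (n + 1) ⊕ Fin 1 → Fin n ⊕ Fin 1 := fun x => (unpoint x).getD infty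

/-- Removing the last points of the upper two of three rows. -/
def unpoint3 : Fin (n + 1) ⊕ (Fin (n + 1) ⊕ Fin 1) → Option (Fin n ⊕ (Fin n ⊕ Fin 1)) :=
  Sum.elim (fun i => (strip i).map Sum.inl) fun x => (unpoint x).map Sum.inr

/-- Moving the last points of the upper two of three rows to the extra point. -/
def collapse3 : Fin (n + 1) ⊕ (Fin (n + 1) ⊕ Fin 1) → Fin n ⊕ (Fin n ⊕ Fin 1) :=
  fun x => (unpoint3 x).getD (Sum.inr infty)

/-- The inclusion of the old points of three rows. -/
def castI3 : Fin n ⊕ (Fin n ⊕ Fin 1) → Fin (n + 1) ⊕ (Fin (n + 1) ⊕ Fin 1) :=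
  Sum.map Fin.castSucc castI

/-- The last point. -/
def lastPt : Fin (n + 1) ⊕ Fin 1 := Sum.inl (Fin.last n)

@[simp] theorem unpoint_castI (x : Fin n ⊕ Fin 1) : unpoint (castI x) = some x := by
  rcases x with x | x <;> simp [unpoint, castI]

@[simp] theorem unpoint_lastPt : unpoint (lastPt : Fin (n + 1) ⊕ Fin 1) = none := by
  simp [unpoint, lastPt]

@[simp] theorem collapse_castI (x : Fin n ⊕ Fin 1) : collapse (castI x) = x := by simp [collapse]

@[simp] theorem collapse_lastPt : collapse (lastPt : Fin (n + 1) ⊕ Fin 1) = infty := by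
  simp [collapse]

@[simp] theorem unpoint3_castI3 (x : Fin n ⊕ (Fin n ⊕ Fin 1)) : unpoint3 (castI3 x) = some x := by
  rcases x with x | x <;> simp [unpoint3, castI3]

@[simp] theorem collapse3_castI3 (x : Fin n ⊕ (Fin n ⊕ Fin 1)) : collapse3 (castI3 x) = x := by
  simp [collapse3]

theorem castI_infty : castI (infty : Fin n ⊕ Fin 1) = infty := rfl

theorem castI_injective : Function.Injective (castI : Fin n ⊕ Fin 1 → _) := fun x y h => by
  have := congrArg collapse h
  simpa using this

theorem castI_ne_lastPt (x : Fin n ⊕ Fin 1) : castI x ≠ lastPt := fun h => by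
  have := congrArg unpoint h
  simp at this

theorem eq_castI_or (x : Fin (n + 1) ⊕ Fin 1) : (∃ y, x = castI y) ∨ x = lastPt := by
  rcases x with x | x
  · induction x using Fin.lastCases with
    | last => exact Or.inr rfl
    | cast i => exact Or.inl ⟨Sum.inl i, rfl⟩
  · exact Or.inl ⟨Sum.inr x, rfl⟩

theorem pos_castI_lt {a b : Fin n ⊕ Fin 1} : pos (castI a) < pos (castI b) ↔ pos a < pos b := by
  rcases a with a | a <;> rcases b with b | b <;>
    simp only [castI, pos, Sum.map_inl, Sum.map_inr, Sum.elim_inl, Sum.elim_inr, Fin.val_rev,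
      Fin.val_castSucc, id] <;> omega

theorem pos_lastPt : pos (lastPt : Fin (n + 1) ⊕ Fin 1) = n := rfl

theorem pos_infty : pos (infty : Fin n ⊕ Fin 1) = n := by simp [pos, infty]

theorem pos_le (x : Fin n ⊕ Fin 1) : pos x ≤ n := by
  rcases x with x | x
  · exact x.2.le
  · rw [eq_infty, pos_infty]

theorem eq_infty_of_pos {x : Fin n ⊕ Fin 1} (h : n ≤ pos x) : x = infty :=
  pos_injective (by rw [pos_infty]; exact le_antisymm (pos_le x) h)

theorem exists_castI_of_pos {x : Fin (n + 1) ⊕ Fin 1} (h : pos x < n) : ∃ y, x = castI y :=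
  (eq_castI_or x).resolve_right fun h' => by rw [h', pos_lastPt] at h; omega

theorem castS_upper (a : Fin n ⊕ Fin n) : (Sum.map id Sum.inl (castS a) :
    Fin (n + 1) ⊕ (Fin (n + 1) ⊕ Fin 1)) = castI3 (Sum.map id Sum.inl a) := by
  rcases a with a | a <;> rfl

theorem eq_castI3_or (e : Fin (n + 1) ⊕ (Fin (n + 1) ⊕ Fin 1)) :
    (∃ d, e = castI3 d) ∨ e = Sum.inl (Fin.last n) ∨ e = Sum.inr lastPt := by
  rcases e with e | e
  · induction e using Fin.lastCases with
    | last => exact Or.inr (Or.inl rfl)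
    | cast i => exact Or.inl ⟨Sum.inl i, rfl⟩
  · rcases eq_castI_or e with ⟨y, rfl⟩ | rfl
    · exact Or.inl ⟨Sum.inr y, rfl⟩
    · exact Or.inr (Or.inr rfl)

@[simp] theorem unpoint3_upper : unpoint3 (Sum.inl (Fin.last n)) = none := by simp [unpoint3]

@[simp] theorem unpoint3_middle : unpoint3 (Sum.inr (lastPt (n := n))) = none := by
  simp [unpoint3]

@[simp] theorem collapse3_upper : collapse3 (Sum.inl (Fin.last n)) = Sum.inr infty := by
  simp [collapse3]

@[simp] theorem collapse3_middle : collapse3 (Sum.inr (lastPt (n := n))) = Sum.inr infty := by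
  simp [collapse3]

theorem collapse3_inr (x : Fin (n + 1) ⊕ Fin 1) : collapse3 (Sum.inr x) = Sum.inr (collapse x) := by
  rcases eq_castI_or x with ⟨y, rfl⟩ | rfl
  · rw [collapse_castI]; exact collapse3_castI3 (Sum.inr y)
  · simp

theorem outer_castI (x : Fin n ⊕ Fin 1) :
    (outer (castI x) : Fin (n + 1) ⊕ (Fin (n + 1) ⊕ Fin 1)) = castI3 (outer x) := by
  rcases x with x | x <;> rfl

theorem outer_lastPt : (outer lastPt : Fin (n + 1) ⊕ (Fin (n + 1) ⊕ Fin 1)) =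
    Sum.inl (Fin.last n) := rfl

theorem unpoint3_outer (x : Fin (n + 1) ⊕ Fin 1) :
    unpoint3 (outer x) = (unpoint x).map outer := by
  rcases eq_castI_or x with ⟨y, rfl⟩ | rfl
  · rw [outer_castI, unpoint3_castI3, unpoint_castI, Option.map_some]
  · rw [outer_lastPt, unpoint3_upper, unpoint_lastPt, Option.map_none]

theorem collapse3_outer (x : Fin (n + 1) ⊕ Fin 1) :
    collapse3 (outer x) = outer (collapse x) := by
  rcases eq_castI_or x with ⟨y, rfl⟩ | rfl
  · rw [outer_castI, collapse3_castI3, collapse_castI]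
  · rw [outer_lastPt, collapse3_upper, collapse_lastPt]; rfl

variable (p : Setoid (Fin n ⊕ Fin n)) (v : Setoid (Fin n ⊕ Fin 1))
  (u : Setoid (Fin (n + 1) ⊕ Fin 1))

/-- The link state `v` with a proper singleton added on the right. -/
def addPoint : Setoid (Fin (n + 1) ⊕ Fin 1) := (v.map some).comap unpoint

/-- The link state `v` with a defect added on the right. -/
def addDefect : Setoid (Fin (n + 1) ⊕ Fin 1) := v.comap collapse

/-- The link state `u` with its last point moved to the extra point. -/
def dropPoint : Setoid (Fin n ⊕ Fin 1) := u.map collapse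

theorem addStrand_cases {x y : Fin (n + 1) ⊕ Fin (n + 1)} (h : addStrand p x y) :
    (∃ a b, p a b ∧ (Sum.map id Sum.inl x : Fin (n + 1) ⊕ (Fin (n + 1) ⊕ Fin 1)) =
        castI3 (Sum.map id Sum.inl a) ∧
      (Sum.map id Sum.inl y : Fin (n + 1) ⊕ (Fin (n + 1) ⊕ Fin 1)) = castI3 (Sum.map id Sum.inl b)) ∨
    (unpoint3 (Sum.map id Sum.inl x) = none ∧ unpoint3 (Sum.map id Sum.inl y) = none) := by
  rcases addStrand_iff.1 h with ⟨a, b, rfl, rfl, hab⟩ | ⟨hx, hy⟩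
  · exact Or.inl ⟨a, b, hab, castS_upper a, castS_upper b⟩
  · right
    have : ∀ x : Fin (n + 1) ⊕ Fin (n + 1), (x = Sum.inl (Fin.last n) ∨ x = Sum.inr (Fin.last n)) →
        unpoint3 (Sum.map id Sum.inl x) = none := by
      rintro _ (rfl | rfl)
      · exact unpoint3_upper
      · exact unpoint3_middle
    exact ⟨this x hx, this y hy⟩

theorem glue_last : glue (addStrand p) u (Sum.inr lastPt) (Sum.inl (Fin.last n)) :=
  glue_of_upper (x := Sum.inr (Fin.last n)) (y := Sum.inl (Fin.last n))
    (addStrand_iff.2 (Or.inr ⟨Or.inr rfl, Or.inl rfl⟩))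

theorem glue_le_comap_castI3 (h : v ≤ u.comap castI) :
    glue p v ≤ (glue (addStrand p) u).comap castI3 := by
  refine sup_le (map_le_iff.2 ?_) (map_le_iff.2 ?_)
  · intro x y hxy
    have := glue_of_upper (q := u) (addStrand_iff.2 (Or.inl ⟨x, y, rfl, rfl, hxy⟩) :
      addStrand p (castS x) (castS y))
    rw [castS_upper, castS_upper] at this
    exact this
  · intro x y hxy
    exact glue_of_lower (p := addStrand p) (h hxy)

theorem addPoint_castI {a b : Fin n ⊕ Fin 1} : addPoint v (castI a) (castI b) ↔ v a b := by
  change v.map some _ _ ↔ _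
  rw [unpoint_castI, unpoint_castI, map_some_iff]

theorem addPoint_lastPt {x : Fin (n + 1) ⊕ Fin 1} : addPoint v lastPt x ↔ x = lastPt := by
  constructor
  · intro h
    rcases eq_castI_or x with ⟨y, rfl⟩ | h'
    · change v.map some _ _ at h
      rw [unpoint_castI, unpoint_lastPt] at h
      exact absurd h (map_some_none _ _)
    · exact h'
  · rintro rfl; exact (addPoint v).refl _

theorem addDefect_castI {a b : Fin n ⊕ Fin 1} : addDefect v (castI a) (castI b) ↔ v a b := by
  change v _ _ ↔ _
  rw [collapse_castI, collapse_castI]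

theorem addDefect_lastPt {a : Fin n ⊕ Fin 1} : addDefect v lastPt (castI a) ↔ v infty a := by
  change v _ _ ↔ _
  rw [collapse_castI, collapse_lastPt]

/-- A point of the block created when the last point is moved to the extra point. -/
def Merged (a : Fin n ⊕ Fin 1) : Prop := u (castI a) lastPt ∨ u (castI a) infty

variable {u} in
theorem Merged.of_rel {a b : Fin n ⊕ Fin 1} (h : u (castI a) (castI b)) (hb : Merged u b) :
    Merged u a := hb.imp (u.trans h) (u.trans h)

/-- Only the blocks of the last point and of the extra point are merged. The relation on the right
is already transitive because `Merged` is constant on blocks. -/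
theorem dropPoint_iff {a b : Fin n ⊕ Fin 1} :
    dropPoint u a b ↔ u (castI a) (castI b) ∨ (Merged u a ∧ Merged u b) := by
  constructor
  · let r : Setoid (Fin n ⊕ Fin 1) :=
      { r := fun a b => u (castI a) (castI b) ∨ (Merged u a ∧ Merged u b)
        iseqv :=
          { refl := fun a => Or.inl (u.refl _)
            symm := fun h => h.imp u.symm And.symm
            trans := by
              rintro a b c (h | ⟨h, h'⟩) (i | ⟨i, i'⟩)
              · exact Or.inl (u.trans h i)
              · exact Or.inr ⟨i.of_rel h, i'⟩
              · exact Or.inr ⟨h, h'.of_rel (u.symm i)⟩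
              · exact Or.inr ⟨h, i'⟩ } }
    have hinf : Merged u infty := Or.inr (u.refl _)
    have hr : dropPoint u ≤ r := by
      refine map_le_iff.2 fun x y hxy => ?_
      rcases eq_castI_or x with ⟨a, rfl⟩ | rfl <;> rcases eq_castI_or y with ⟨b, rfl⟩ | rfl
      · rw [collapse_castI, collapse_castI]; exact Or.inl hxy
      · rw [collapse_castI, collapse_lastPt]; exact Or.inr ⟨Or.inl hxy, hinf⟩
      · rw [collapse_castI, collapse_lastPt]; exact Or.inr ⟨hinf, Or.inl (u.symm hxy)⟩
      · exact r.refl _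
    exact fun h => hr h
  · have key : ∀ {x y}, u x y → dropPoint u (collapse x) (collapse y) := fun h => map_rel h
    have hm : ∀ {a}, Merged u a → dropPoint u a infty := by
      rintro a (h | h)
      · have := key h
        rwa [collapse_castI, collapse_lastPt] at this
      · have := key h
        rwa [collapse_castI, ← castI_infty, collapse_castI] at this
    rintro (h | ⟨h, h'⟩)
    · have := key h
      rwa [collapse_castI, collapse_castI] at this
    · exact (dropPoint u).trans (hm h) ((dropPoint u).symm (hm h'))

/-- The added strand ends at an isolated point, so the last points of the upper and of the middle
row form a block of their own, represented by `none`. -/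
theorem glue_addPoint :
    glue (addStrand p) (addPoint v) = ((glue p v).map some).comap unpoint3 := by
  apply le_antisymm
  · refine sup_le (map_le_iff.2 ?_) (map_le_iff.2 ?_)
    · intro x y h
      change (glue p v).map some (unpoint3 _) (unpoint3 _)
      rcases addStrand_cases p h with ⟨a, b, hab, hx, hy⟩ | ⟨hx, hy⟩
      · rw [hx, hy, unpoint3_castI3, unpoint3_castI3]; exact map_rel (glue_of_upper hab)
      · rw [hx, hy]
    · intro x y h
      change (glue p v).map some ((unpoint _).map _) ((unpoint _).map _)
      rcases eq_castI_or x with ⟨a, rfl⟩ | rfl <;> rcases eq_castI_or y with ⟨b, rfl⟩ | rfl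
      · rw [unpoint_castI, unpoint_castI]
        exact map_rel (glue_of_lower ((addPoint_castI v).1 h))
      · exact absurd ((addPoint_lastPt v).1 ((addPoint v).symm h)) (castI_ne_lastPt a)
      · exact absurd ((addPoint_lastPt v).1 h) (castI_ne_lastPt b)
      · exact Setoid.refl' _ _
  · have h1 := glue_le_comap_castI3 p v (addPoint v) fun a b h => (addPoint_castI v).2 h
    set G := glue (addStrand p) (addPoint v)
    have hlast : ∀ e, (∃ d, e = castI3 d) ∨ (unpoint3 e = none ∧ G e (Sum.inl (Fin.last n))) := by
      intro e
      rcases eq_castI3_or e with h | rfl | rfl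
      · exact Or.inl h
      · exact Or.inr ⟨unpoint3_upper, G.refl _⟩
      · exact Or.inr ⟨unpoint3_middle, glue_last p (addPoint v)⟩
    intro e e' h
    replace h : (glue p v).map some (unpoint3 e) (unpoint3 e') := h
    rcases hlast e with ⟨d, rfl⟩ | ⟨h2, h3⟩ <;> rcases hlast e' with ⟨d', rfl⟩ | ⟨h4, h5⟩
    · rw [unpoint3_castI3, unpoint3_castI3, map_some_iff] at h
      exact h1 h
    · rw [unpoint3_castI3, h4] at h
      exact absurd (Setoid.symm' _ h) (map_some_none _ _)
    · rw [unpoint3_castI3, h2] at h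
      exact absurd h (map_some_none _ _)
    · exact G.trans h3 (G.symm h5)

theorem comp_addPoint : comp (addStrand p) (addPoint v) = addPoint (comp p v) := by
  ext x y
  change glue (addStrand p) (addPoint v) (outer x) (outer y) ↔ _
  rw [glue_addPoint]
  change (glue p v).map some (unpoint3 (outer x)) (unpoint3 (outer y)) ↔
    (comp p v).map some (unpoint x) (unpoint y)
  rw [unpoint3_outer, unpoint3_outer]
  cases unpoint x <;> cases unpoint y
  · exact ⟨fun _ => Setoid.refl' _ _, fun _ => Setoid.refl' _ _⟩
  · exact ⟨fun h => absurd h (map_some_none _ _), fun h => absurd h (map_some_none _ _)⟩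
  · exact ⟨fun h => absurd (Setoid.symm' _ h) (map_some_none _ _),
      fun h => absurd (Setoid.symm' _ h) (map_some_none _ _)⟩
  · rw [Option.map_some, Option.map_some, map_some_iff, map_some_iff]; rfl

/-- The additional block reaches the upper row and is therefore not erased. -/
theorem loops_addPoint : loops (addStrand p) (addPoint v) = loops p v := by
  unfold loops
  rw [glue_addPoint, deadCount_comap ((glue p v).map some) unpoint3 ?_
    (fun x : Option (Fin n ⊕ Fin 1) => x.map outer) outer (fun x => ⟨_, unpoint3_outer x⟩) ?_]
  · refine deadCount_map _ _ (Option.some_injective _) _ _ (fun x => ⟨some x, rfl⟩) ?_ ?_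
    · rintro d (_ | y) h
      · simp at h
      · exact ⟨y, by simpa using h⟩
    · rintro (_ | e)
      · exact Or.inr ⟨none, rfl⟩
      · exact Or.inl ⟨e, rfl⟩
  · rintro (_ | e)
    · exact ⟨_, unpoint3_upper⟩
    · exact ⟨_, unpoint3_castI3 e⟩
  · rintro (_ | x)
    · exact ⟨lastPt, by rw [unpoint3_outer, unpoint_lastPt]⟩
    · exact ⟨castI x, by rw [unpoint3_outer, unpoint_castI]⟩

/-- The added strand ends at a defect, so both new points belong to the block of the extra point. -/
theorem glue_addDefect : glue (addStrand p) (addDefect v) = (glue p v).comap collapse3 := by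
  apply le_antisymm
  · refine sup_le (map_le_iff.2 ?_) (map_le_iff.2 ?_)
    · intro x y h
      change glue p v (collapse3 _) (collapse3 _)
      rcases addStrand_cases p h with ⟨a, b, hab, hx, hy⟩ | ⟨hx, hy⟩
      · rw [hx, hy, collapse3_castI3, collapse3_castI3]; exact glue_of_upper hab
      · rw [collapse3, collapse3, hx, hy]
    · intro x y h
      change glue p v (collapse3 _) (collapse3 _)
      rw [collapse3_inr, collapse3_inr]
      exact glue_of_lower h
  · have h1 := glue_le_comap_castI3 p v (addDefect v) fun a b h => (addDefect_castI v).2 h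
    set G := glue (addStrand p) (addDefect v)
    have hm : G (Sum.inr lastPt) (Sum.inr infty) :=
      glue_of_lower ((addDefect_lastPt v).2 (v.refl infty))
    have hG : ∀ e, G e (castI3 (collapse3 e)) := by
      intro e
      rcases eq_castI3_or e with ⟨d, rfl⟩ | rfl | rfl
      · rw [collapse3_castI3]
      · rw [collapse3_upper]
        exact G.trans (G.symm (glue_last p (addDefect v))) hm
      · rw [collapse3_middle]; exact hm
    exact fun e e' h => G.trans (hG e) (G.trans (h1 h) (G.symm (hG e')))

theorem comp_addDefect : comp (addStrand p) (addDefect v) = addDefect (comp p v) := by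
  ext x y
  change glue (addStrand p) (addDefect v) (outer x) (outer y) ↔ _
  rw [glue_addDefect]
  change glue p v (collapse3 (outer x)) (collapse3 (outer y)) ↔ _
  rw [collapse3_outer, collapse3_outer]
  rfl

theorem collapse_surjective : Function.Surjective (collapse : Fin (n + 1) ⊕ Fin 1 → _) :=
  fun x => ⟨_, collapse_castI x⟩

theorem collapse3_surjective :
    Function.Surjective (collapse3 : Fin (n + 1) ⊕ (Fin (n + 1) ⊕ Fin 1) → _) :=
  fun x => ⟨_, collapse3_castI3 x⟩

theorem deadCount_comap_collapse3 (H : Setoid (Fin n ⊕ (Fin n ⊕ Fin 1))) :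
    deadCount (H.comap collapse3) outer = deadCount H outer :=
  deadCount_comap H collapse3 collapse3_surjective outer outer
    (fun x => ⟨_, collapse3_outer x⟩)
    fun x => ⟨castI x, by rw [collapse3_outer, collapse_castI]⟩

theorem loops_addDefect : loops (addStrand p) (addDefect v) = loops p v := by
  rw [loops, glue_addDefect, deadCount_comap_collapse3, loops]

/-- The two ends of the added strand are both moved to the extra point, so the strand leaves no
trace and moving commutes with stacking. -/
theorem glue_dropPoint : glue p (dropPoint u) = (glue (addStrand p) u).map collapse3 := by
  apply le_antisymm
  · refine sup_le (map_le_iff.2 ?_) ?_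
    · intro x y h
      have := glue_of_upper (q := u) (addStrand_iff.2 (Or.inl ⟨x, y, rfl, rfl, h⟩) :
        addStrand p (castS x) (castS y))
      have h2 := map_rel (f := collapse3) this
      rwa [castS_upper, castS_upper, collapse3_castI3, collapse3_castI3] at h2
    · rw [dropPoint, map_map, map_le_iff]
      intro x y h
      have := map_rel (f := collapse3) (glue_of_lower (p := addStrand p) h)
      rwa [collapse3_inr, collapse3_inr] at this
  · rw [map_le_iff]
    have : glue (addStrand p) u ≤ (glue p (dropPoint u)).comap collapse3 := by
      refine sup_le (map_le_iff.2 ?_) (map_le_iff.2 ?_)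
      · intro x y h
        change glue p _ (collapse3 _) (collapse3 _)
        rcases addStrand_cases p h with ⟨a, b, hab, hx, hy⟩ | ⟨hx, hy⟩
        · rw [hx, hy, collapse3_castI3, collapse3_castI3]; exact glue_of_upper hab
        · rw [collapse3, collapse3, hx, hy]
      · intro x y h
        change glue p _ (collapse3 _) (collapse3 _)
        rw [collapse3_inr, collapse3_inr]
        exact glue_of_lower (map_rel h)
    exact fun x y h => this h

/-- Before the points are moved, dropping the last point amounts to joining two outer points, the
last and the extra one. Joining outer points changes no erased block and commutes with restriction
to the outer points; this gives both `loops_dropPoint` and `comp_dropPoint`. -/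
theorem comap_glue_dropPoint : (glue p (dropPoint u)).comap collapse3 =
    glue (addStrand p) u ⊔ (Setoid.ker (collapse (n := n))).map outer := by
  rw [glue_dropPoint]
  set G := glue (addStrand p) u with hG
  apply le_antisymm
  · refine comap_map_le (g := castI3) le_sup_left fun e => ?_
    set t := G ⊔ (Setoid.ker (collapse (n := n))).map outer
    have hup : t (Sum.inl (Fin.last n)) (Sum.inr infty) := by
      refine (le_sup_right : _ ≤ t) ?_
      exact map_rel (f := outer) (x := lastPt) (y := infty)
        (show collapse lastPt = collapse (castI infty) by rw [collapse_lastPt, collapse_castI])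
    rcases eq_castI3_or e with ⟨d, rfl⟩ | rfl | rfl
    · rw [collapse3_castI3]
    · rw [collapse3_upper]; exact hup
    · rw [collapse3_middle]
      exact t.trans ((le_sup_left : _ ≤ t) (glue_last p u)) hup
  · refine sup_le (fun x y h => map_rel h) (map_le_iff.2 fun x y h => ?_)
    change G.map collapse3 (collapse3 _) (collapse3 _)
    rw [collapse3_outer, collapse3_outer, show collapse x = collapse y from h]

theorem loops_dropPoint : loops p (dropPoint u) = loops (addStrand p) u := by
  rw [loops, ← deadCount_comap_collapse3, comap_glue_dropPoint, deadCount_sup_map, loops]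

theorem comp_dropPoint : comp p (dropPoint u) = dropPoint (comp (addStrand p) u) := by
  -- After pulling back along `collapse`, both sides become the composed partition with the last and
  -- the extra point identified.
  apply comap_injective collapse_surjective
  rw [show dropPoint (comp (addStrand p) u) = (comp (addStrand p) u).map collapse from rfl,
    comap_map_eq collapse_castI]
  have h1 : ((glue p (dropPoint u)).comap collapse3).comap outer =
      (comp p (dropPoint u)).comap collapse := by
    ext x y
    change glue p (dropPoint u) (collapse3 (outer x)) (collapse3 (outer y)) ↔
      glue p (dropPoint u) (outer (collapse x)) (outer (collapse y))
    rw [collapse3_outer, collapse3_outer]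
  rw [← h1, comap_glue_dropPoint]
  have h2 := comap_sup_map (glue (addStrand p) u) (Setoid.ker (collapse (n := n))) outer id
  have h3 : (Setoid.ker (collapse (n := n))).map id = Setoid.ker collapse :=
    le_antisymm (map_le_iff.2 fun _ _ h => h) fun _ _ h => map_rel (f := id) h
  rw [Function.comp_id, h3] at h2
  rw [h2]
  rfl

end restriction

end Diagram

namespace Diagram

/-! ### Adding and removing a last point -/

section linkStates

variable {n : ℕ} {v : Setoid (Fin n ⊕ Fin 1)} {u : Setoid (Fin (n + 1) ⊕ Fin 1)}

theorem defect_addPoint_castSucc {i : Fin n} : Defect (addPoint v) i.castSucc ↔ Defect v i :=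
  addPoint_castI v (a := Sum.inl i) (b := infty)

theorem not_defect_addPoint_last : ¬ Defect (addPoint v) (Fin.last n) := fun h =>
  castI_ne_lastPt infty ((addPoint_lastPt v).1 h)

theorem defect_addDefect_castSucc {i : Fin n} : Defect (addDefect v) i.castSucc ↔ Defect v i :=
  addDefect_castI v (a := Sum.inl i) (b := infty)

theorem defect_addDefect_last : Defect (addDefect v) (Fin.last n) :=
  (addDefect_lastPt v (a := infty)).2 (v.refl _)

theorem IsLinkState.addPoint (hv : IsLinkState v) : IsLinkState (addPoint v) := by
  refine ⟨?_, ?_, ?_⟩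
  · intro x y z t hxy hyz hzt hxz hyt
    rcases eq_castI_or x with ⟨a, rfl⟩ | rfl
    · rcases eq_castI_or z with ⟨c, rfl⟩ | rfl
      · rcases eq_castI_or y with ⟨b, rfl⟩ | rfl
        · rcases eq_castI_or t with ⟨d, rfl⟩ | rfl
          · rw [pos_castI_lt] at hxy hyz hzt
            rw [addPoint_castI] at hxz hyt ⊢
            exact hv.noncrossing a b c d hxy hyz hzt hxz hyt
          · exact absurd ((addPoint_lastPt v).1 ((Diagram.addPoint v).symm hyt)) (castI_ne_lastPt b)
        · obtain rfl := (addPoint_lastPt v).1 hyt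
          omega
      · exact absurd ((addPoint_lastPt v).1 ((Diagram.addPoint v).symm hxz)) (castI_ne_lastPt a)
    · obtain rfl := (addPoint_lastPt v).1 hxz
      omega
  · intro i j k hi hij hik
    induction i using Fin.lastCases with
    | last =>
      have := (addPoint_lastPt v).1 hij
      exact Or.inl (by simpa [lastPt] using this.symm)
    | cast i =>
      have hne : ∀ j : Fin (n + 1), Diagram.addPoint v (Sum.inl i.castSucc) (Sum.inl j) →
          ∃ j' : Fin n, j = j'.castSucc ∧ v (Sum.inl i) (Sum.inl j') := by
        intro j hj
        induction j using Fin.lastCases with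
        | last =>
          exact absurd ((addPoint_lastPt v).1 ((Diagram.addPoint v).symm hj))
            (castI_ne_lastPt (Sum.inl i))
        | cast j => exact ⟨j, rfl, (addPoint_castI v (a := Sum.inl i) (b := Sum.inl j)).1 hj⟩
      obtain ⟨j, rfl, hj⟩ := hne j hij
      obtain ⟨k, rfl, hk⟩ := hne k hik
      simp only [Fin.castSucc_inj]
      exact hv.card_block_le i j k (fun h => hi (defect_addPoint_castSucc.2 h)) hj hk
  · intro i j hi hij hne
    induction i using Fin.lastCases with
    | last =>
      have := (addPoint_lastPt v).1 hij
      exact absurd (by simpa [lastPt] using this.symm) hne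
    | cast i =>
      induction j using Fin.lastCases with
      | last =>
        exact absurd ((addPoint_lastPt v).1 ((Diagram.addPoint v).symm hij))
          (castI_ne_lastPt (Sum.inl i))
      | cast j =>
        rw [upperLabel_castSucc, upperLabel_castSucc, bar_injective.ne_iff]
        exact hv.label_ne i j (fun h => hi (defect_addPoint_castSucc.2 h))
          ((addPoint_castI v (a := Sum.inl i) (b := Sum.inl j)).1 hij) fun h => hne (by rw [h])

theorem IsLinkState.addDefect (hv : IsLinkState v) : IsLinkState (addDefect v) := by
  refine ⟨?_, ?_, ?_⟩
  · intro x y z t hxy hyz hzt hxz hyt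
    have ht := pos_le t
    obtain ⟨a, rfl⟩ := exists_castI_of_pos (x := x) (by omega)
    obtain ⟨b, rfl⟩ := exists_castI_of_pos (x := y) (by omega)
    rw [pos_castI_lt] at hxy
    rw [addDefect_castI]
    replace hxz : v (collapse (castI a)) (collapse z) := hxz
    replace hyt : v (collapse (castI b)) (collapse t) := hyt
    rw [collapse_castI] at hxz hyt
    rcases eq_castI_or t with ⟨d, rfl⟩ | rfl
    · rw [collapse_castI] at hyt
      rcases eq_castI_or z with ⟨c, rfl⟩ | rfl
      · rw [pos_castI_lt] at hyz hzt
        rw [collapse_castI] at hxz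
        exact hv.noncrossing a b c d hxy hyz hzt hxz hyt
      · rw [collapse_lastPt] at hxz
        rw [pos_lastPt] at hzt
        have : castI d = infty := eq_infty_of_pos hzt
        rw [← castI_infty] at this
        obtain rfl := castI_injective this
        exact v.trans hxz (v.symm hyt)
    · rw [pos_lastPt] at hzt
      obtain ⟨c, rfl⟩ := exists_castI_of_pos hzt
      rw [pos_castI_lt] at hyz
      rw [collapse_castI] at hxz
      rw [collapse_lastPt] at hyt
      refine hv.noncrossing a b c infty hxy hyz ?_ hxz hyt
      rw [pos_infty]
      by_contra hc
      have := eq_infty_of_pos (not_lt.1 hc)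
      subst this
      rw [castI_infty, pos_infty] at hzt
      omega
  all_goals
    have hne : ∀ i j : Fin (n + 1), ¬ Diagram.addDefect v (Sum.inl i) infty →
        Diagram.addDefect v (Sum.inl i) (Sum.inl j) →
        ∃ i' j' : Fin n, i = i'.castSucc ∧ j = j'.castSucc ∧ v (Sum.inl i') (Sum.inl j') ∧
          ¬ Defect v i' := by
      intro i j hi hij
      induction i using Fin.lastCases with
      | last => exact absurd defect_addDefect_last hi
      | cast i =>
        induction j using Fin.lastCases with
        | last =>
          exact absurd ((Diagram.addDefect v).trans hij defect_addDefect_last) hi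
        | cast j =>
          exact ⟨i, j, rfl, rfl, (addDefect_castI v (a := Sum.inl i) (b := Sum.inl j)).1 hij,
            fun h => hi (defect_addDefect_castSucc.2 h)⟩
  · intro i j k hi hij hik
    obtain ⟨i, j, rfl, rfl, hj, hi'⟩ := hne i j hi hij
    obtain ⟨i', k, hii, rfl, hk, _⟩ := hne _ k hi hik
    obtain rfl := Fin.castSucc_injective _ hii
    simp only [Fin.castSucc_inj]
    exact hv.card_block_le i j k hi' hj hk
  · intro i j hi hij hne'
    obtain ⟨i, j, rfl, rfl, hj, hi'⟩ := hne i j hi hij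
    rw [upperLabel_castSucc, upperLabel_castSucc, bar_injective.ne_iff]
    exact hv.label_ne i j hi' hj fun h => hne' (by rw [h])

/-- The last and the extra point are neighbours in the boundary order, so merging their blocks
creates no crossing. Other blocks are unchanged, and passing from `n + 1` to `n` points exchanges
all letters at once. -/
theorem IsLinkState.dropPoint (hu : IsLinkState u) : IsLinkState (dropPoint u) := by
  have hnotM : ∀ {i : Fin n}, ¬ Diagram.dropPoint u (Sum.inl i) infty → ¬ Merged u (Sum.inl i) :=
    fun h h' => h ((dropPoint_iff u).2 (Or.inr ⟨h', Or.inr (u.refl _)⟩))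
  refine ⟨?_, ?_, ?_⟩
  · intro x y z t hxy hyz hzt hxz hyt
    have hx' := pos_castI_lt.2 hxy
    have hy' := pos_castI_lt.2 hyz
    have hz' := pos_castI_lt.2 hzt
    rw [dropPoint_iff] at hxz hyt ⊢
    have hlt : ∀ {z t : Fin n ⊕ Fin 1}, pos z < pos t → pos (castI z) < n := by
      intro z t h
      rcases z with z | z
      · simp [castI, pos]
      · rw [eq_infty, pos_infty] at h
        have := pos_le t
        omega
    rcases hxz with hxz | ⟨hx, hz⟩
    · rcases hyt with hyt | ⟨hy, ht⟩
      · exact Or.inl (hu.noncrossing _ _ _ _ hx' hy' hz' hxz hyt)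
      · left
        have h1 := hlt hzt
        rcases hy with hy | hy
        · exact hu.noncrossing _ _ _ _ hx' hy' (by rw [pos_lastPt]; exact h1) hxz hy
        · exact hu.noncrossing _ _ _ _ hx' hy' (by rw [pos_infty]; omega) hxz hy
    · by_cases hy : Merged u y
      · exact Or.inr ⟨hx, hy⟩
      · rcases hyt with hyt | ⟨hy', _⟩
        · have ht : pos (castI t) < n := by
            rcases t with t | t
            · simp [castI, pos]
            · rw [eq_infty] at hyt
              exact absurd (Or.inr hyt) hy
          refine absurd ?_ hy
          rcases hz with hz | hz
          · have := hu.noncrossing _ _ _ _ hy' hz' (by rw [pos_lastPt]; exact ht) hyt hz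
            exact Or.inl (u.trans this hz)
          · have := hu.noncrossing _ _ _ _ hy' hz' (by rw [pos_infty]; omega) hyt hz
            exact Or.inr (u.trans this hz)
        · exact absurd hy' hy
  · intro i j k hi hij hik
    have hM := hnotM hi
    have h1 := ((dropPoint_iff u).1 hij).resolve_right fun h => hM h.1
    have h2 := ((dropPoint_iff u).1 hik).resolve_right fun h => hM h.1
    have := hu.card_block_le i.castSucc j.castSucc k.castSucc (fun h => hM (Or.inr h)) h1 h2
    simpa only [Fin.castSucc_inj] using this
  · intro i j hi hij hne
    have hM := hnotM hi
    have h1 := ((dropPoint_iff u).1 hij).resolve_right fun h => hM h.1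
    have := hu.label_ne i.castSucc j.castSucc (fun h => hM (Or.inr h)) h1
      fun h => hne (Fin.castSucc_injective _ h)
    rwa [upperLabel_castSucc, upperLabel_castSucc, bar_injective.ne_iff] at this

theorem dropPoint_addPoint : dropPoint (addPoint v) = v := by
  ext a b
  have hM : ∀ {a}, Merged (addPoint v) a → v a infty := by
    rintro a (h | h)
    · exact absurd ((addPoint_lastPt v).1 ((addPoint v).symm h)) (castI_ne_lastPt a)
    · exact (addPoint_castI v).1 h
  rw [dropPoint_iff, addPoint_castI]
  exact ⟨fun h => h.elim id fun h => v.trans (hM h.1) (v.symm (hM h.2)), Or.inl⟩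

theorem dropPoint_addDefect : dropPoint (addDefect v) = v := by
  ext a b
  have hM : ∀ {a}, Merged (addDefect v) a → v a infty := by
    rintro a (h | h)
    · exact v.symm ((addDefect_lastPt v).1 ((addDefect v).symm h))
    · exact (addDefect_castI v).1 h
  rw [dropPoint_iff, addDefect_castI]
  exact ⟨fun h => h.elim id fun h => v.trans (hM h.1) (v.symm (hM h.2)), Or.inl⟩

/-- The last point is a proper singleton. -/
theorem addPoint_dropPoint (h : ∀ x, u lastPt x → x = lastPt) : addPoint (dropPoint u) = u := by
  have key : ∀ a b, addPoint (dropPoint u) (castI a) (castI b) ↔ u (castI a) (castI b) := by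
    intro a b
    have hM : ∀ {a}, Merged u a → u (castI a) infty := by
      rintro a (h' | h')
      · exact absurd (h _ (u.symm h')) (castI_ne_lastPt a)
      · exact h'
    rw [addPoint_castI, dropPoint_iff]
    exact ⟨fun h => h.elim id fun h => u.trans (hM h.1) (u.symm (hM h.2)), Or.inl⟩
  have hl : ∀ x, addPoint (dropPoint u) lastPt x ↔ u lastPt x := fun x => by
    rw [addPoint_lastPt]
    exact ⟨fun h => h ▸ u.refl _, h x⟩
  ext x y
  rcases eq_castI_or x with ⟨a, rfl⟩ | rfl <;> rcases eq_castI_or y with ⟨b, rfl⟩ | rfl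
  · exact key a b
  · rw [Setoid.comm', hl, Setoid.comm']
  · exact hl _
  · exact hl _

theorem addDefect_dropPoint (h : Defect u (Fin.last n)) : addDefect (dropPoint u) = u := by
  have hM : ∀ {a}, Merged u a ↔ u (castI a) infty := fun {a} =>
    ⟨fun h' => h'.elim (fun h' => u.trans h' h) id, Or.inr⟩
  have key : ∀ a b, addDefect (dropPoint u) (castI a) (castI b) ↔ u (castI a) (castI b) := by
    intro a b
    rw [addDefect_castI, dropPoint_iff, hM, hM]
    exact ⟨fun h => h.elim id fun h => u.trans h.1 (u.symm h.2), Or.inl⟩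
  have hl : ∀ a, addDefect (dropPoint u) lastPt (castI a) ↔ u lastPt (castI a) := fun a => by
    rw [addDefect_lastPt, dropPoint_iff, hM, hM, castI_infty]
    constructor
    · rintro (h' | h')
      · exact u.trans h h'
      · exact u.trans h (u.symm h'.2)
    · exact fun h' => Or.inl (u.trans (u.symm h) h')
  ext x y
  rcases eq_castI_or x with ⟨a, rfl⟩ | rfl <;> rcases eq_castI_or y with ⟨b, rfl⟩ | rfl
  · exact key a b
  · rw [Setoid.comm', hl, Setoid.comm']
  · exact hl _
  · exact iff_of_true (Setoid.refl' _ _) (u.refl _)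

/-- Labels are counted from the right, so a new last point takes the letter `a` and exchanges the
letters of all others. This is the origin of every `bar` in the branching rule. -/
theorem labelWord_succ (P : Fin (n + 1) → Prop) [Decidable (P (Fin.last n))] :
    labelWord P = (labelWord fun i => P i.castSucc).map bar ++
      if P (Fin.last n) then [Letter.a] else [] := by
  classical
  rw [labelWord, labelWord, List.finRange_succ_last, List.filter_append, List.map_append,
    List.filter_map, List.map_map, List.map_map]
  congr 1
  · refine List.map_congr_left fun i _ => upperLabel_castSucc i
  · by_cases h : P (Fin.last n) <;> simp [h, upperLabel_last]

/-- The added point is to the right of all the others, so its letter comes last. It is applied to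
the partner of the last point, which becomes the rightmost defect. -/
theorem labelWord_insert {P Q : Fin n → Prop} {j : Fin n} (hQ : ∀ i, Q i ↔ P i ∨ i = j)
    (hP : ∀ i, P i → i < j) : labelWord Q = labelWord P ++ [upperLabel j] := by
  classical
  have h : (List.finRange n).filter (fun i => Q i) =
      (List.finRange n).filter (fun i => P i) ++ [j] := by
    refine List.SortedLT.eq_of_mem_iff (sortedLT_filter _) ?_ fun i => by simp [hQ]
    refine List.Pairwise.sortedLT (List.pairwise_append.2 ⟨(sortedLT_filter _).pairwise, by simp, ?_⟩)
    intro i hi k hk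
    obtain rfl : k = j := by simpa using hk
    exact hP i (by simpa using hi)
  rw [labelWord, h, List.map_append]
  rfl

theorem exists_last_of_labelWord {P : Fin n → Prop} {w : List Letter} {x : Letter}
    (h : labelWord P = w ++ [x]) : ∃ j, P j ∧ (∀ i, P i → i ≤ j) ∧ upperLabel j = x := by
  classical
  obtain ⟨L, L', hL, -, h2⟩ := List.map_eq_append_iff.1 h
  obtain ⟨j, rfl⟩ : ∃ j, L' = [j] := by
    rw [List.map_eq_singleton_iff] at h2
    obtain ⟨j, hj, _⟩ := h2
    exact ⟨j, hj⟩
  have hs : (L ++ [j]).Pairwise (· < ·) := by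
    rw [← hL]; exact (sortedLT_filter _).pairwise
  have hm : ∀ i, P i ↔ i ∈ L ++ [j] := fun i => by rw [← hL]; simp
  refine ⟨j, (hm j).2 (by simp), fun i hi => ?_, by simpa using h2⟩
  rcases List.mem_append.1 ((hm i).1 hi) with h | h
  · exact ((List.pairwise_append.1 hs).2.2 i h j (by simp)).le
  · exact (by simpa using h : i = j).le

end linkStates

end Diagram

namespace Diagram

/-! ### Pairing the last point -/

section pairing

variable {n : ℕ} {v : Setoid (Fin n ⊕ Fin 1)} {u : Setoid (Fin (n + 1) ⊕ Fin 1)} {j : Fin n}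

/-- The last point is paired with the point `j`. -/
def LastPairedWith (u : Setoid (Fin (n + 1) ⊕ Fin 1)) (j : Fin n) : Prop :=
  u lastPt (castI (Sum.inl j)) ∧ ¬ Defect u (Fin.last n)

/-- The trichotomy behind the branching rule: proper singleton, defect, or member of a pair. -/
theorem last_cases (u : Setoid (Fin (n + 1) ⊕ Fin 1)) :
    (∀ x, u lastPt x → x = lastPt) ∨ Defect u (Fin.last n) ∨ ∃ j, LastPairedWith u j := by
  by_cases hd : Defect u (Fin.last n)
  · exact Or.inr (Or.inl hd)
  by_cases h : ∃ j : Fin n, u lastPt (castI (Sum.inl j))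
  · exact Or.inr (Or.inr (h.imp fun j hj => ⟨hj, hd⟩))
  · left
    intro x hx
    rcases eq_castI_or x with ⟨y | y, rfl⟩ | rfl
    · exact absurd ⟨y, hx⟩ h
    · rw [eq_infty] at hx; exact absurd hx hd
    · rfl

namespace LastPairedWith

variable (hu : IsLinkState u) (hj : LastPairedWith u j)
include hu hj

theorem eq_of_rel {i : Fin n} (h : u lastPt (castI (Sum.inl i))) : i = j := by
  rcases hu.card_block_le (Fin.last n) i.castSucc j.castSucc hj.2 h hj.1 with h | h | h
  · exact absurd h.symm (Fin.castSucc_lt_last i).ne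
  · exact absurd h.symm (Fin.castSucc_lt_last j).ne
  · exact Fin.castSucc_injective _ h

/-- A defect to the right of `j` would be braced by the pair formed by `j` and the last point. -/
theorem lt_of_defect {i : Fin n} (h : Defect u i.castSucc) : i < j := by
  by_contra hle
  have hne : i ≠ j := by
    rintro rfl
    exact hj.2 (u.trans hj.1 h)
  have hlt : j < i := lt_of_le_of_ne (not_lt.1 hle) hne.symm
  have := hu.noncrossing (castI (Sum.inl j)) (castI (Sum.inl i)) lastPt infty
    (pos_castI_lt.2 (by simpa [pos] using hlt)) (by rw [pos_lastPt]; simp [pos, castI])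
    (by rw [pos_lastPt, pos_infty]; omega) (u.symm hj.1) h
  exact hj.2 (u.trans hj.1 (u.trans this h))

/-- The last of `n + 1` points is an `a`, so its partner is a `b` there and becomes an `a` when the
last point is removed. -/
theorem upperLabel_eq : upperLabel j = Letter.a := by
  have := hu.label_ne (Fin.last n) j.castSucc hj.2 hj.1 (Fin.castSucc_lt_last j).ne'
  rw [upperLabel_last, upperLabel_castSucc] at this
  cases h : upperLabel j
  · rfl
  · rw [h] at this; exact absurd rfl this

theorem merged_iff {a : Fin n ⊕ Fin 1} :
    Merged u a ↔ a = Sum.inl j ∨ u (castI a) infty := by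
  refine or_congr_left ⟨fun h => ?_, fun h => h ▸ u.symm hj.1⟩
  rcases a with a | a
  · rw [hj.eq_of_rel hu (u.symm h)]
  · rw [eq_infty] at h; exact absurd (u.symm h) hj.2

theorem defect_dropPoint {i : Fin n} :
    Defect (dropPoint u) i ↔ Defect u i.castSucc ∨ i = j := by
  change dropPoint u _ _ ↔ _
  rw [dropPoint_iff, hj.merged_iff hu, hj.merged_iff hu]
  constructor
  · rintro (h | ⟨h | h, -⟩)
    · exact Or.inl h
    · exact Or.inr (by simpa using h)
    · exact Or.inl h
  · rintro (h | rfl)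
    · exact Or.inl h
    · exact Or.inr ⟨Or.inl rfl, Or.inr (u.refl _)⟩

theorem labelWord_dropPoint : labelWord (Defect (dropPoint u)) =
    (labelWord (Defect u)).map bar ++ [Letter.a] := by
  classical
  rw [labelWord_insert (fun i => hj.defect_dropPoint hu) (fun i => hj.lt_of_defect hu),
    hj.upperLabel_eq hu, labelWord_succ, if_neg hj.2, List.append_nil, List.map_map]
  have : bar ∘ bar = id := funext bar_bar
  rw [this, List.map_id]

end LastPairedWith

open Classical in
/-- The link state `v` with the point `j` paired with a new point on the right. -/
noncomputable def pairLast (v : Setoid (Fin n ⊕ Fin 1)) (j : Fin n) :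
    Setoid (Fin (n + 1) ⊕ Fin 1) :=
  -- The new point and `j` are both sent to `none`, hence form one block; every other point keeps
  -- its block apart from `j`.
  (v.map some).comap fun x => (unpoint x).filter fun y => y ≠ Sum.inl j

theorem pairLast_castI {a b : Fin n ⊕ Fin 1} (ha : a ≠ Sum.inl j) :
    pairLast v j (castI a) (castI b) ↔ b ≠ Sum.inl j ∧ v a b := by
  change v.map some ((unpoint (castI a)).filter _) ((unpoint (castI b)).filter _) ↔ _
  rw [unpoint_castI, unpoint_castI]
  by_cases hb : b = Sum.inl j
  · refine iff_of_false (fun h => ?_) (fun h => h.1 hb)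
    have := Setoid.symm' _ h
    simp only [Option.filter_some, ha, hb, ne_eq, not_false_eq_true, not_true_eq_false, decide_true,
      decide_false, if_true, Bool.false_eq_true, if_false] at this
    exact map_some_none _ _ this
  · simp only [Option.filter_some, ha, hb, ne_eq, not_false_eq_true, decide_true, if_true,
      map_some_iff, true_and]

theorem pairLast_lastPt {b : Fin n ⊕ Fin 1} :
    pairLast v j lastPt (castI b) ↔ b = Sum.inl j := by
  change v.map some ((unpoint lastPt).filter _) ((unpoint (castI b)).filter _) ↔ _
  rw [unpoint_castI, unpoint_lastPt]
  by_cases hb : b = Sum.inl j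
  · refine iff_of_true ?_ hb
    simp only [Option.filter_some, Option.filter_none, hb, ne_eq, not_true_eq_false,
      decide_false, Bool.false_eq_true, if_false]
    exact Setoid.refl' _ _
  · refine iff_of_false (fun h => ?_) hb
    simp only [Option.filter_some, Option.filter_none, hb, ne_eq, not_false_eq_true, decide_true,
      if_true] at h
    exact map_some_none _ _ h

theorem pairLast_self : pairLast v j lastPt (castI (Sum.inl j)) := pairLast_lastPt.2 rfl

theorem pairLast_iff {x y : Fin (n + 1) ⊕ Fin 1} : pairLast v j x y ↔
    ((x = lastPt ∨ x = castI (Sum.inl j)) ∧ (y = lastPt ∨ y = castI (Sum.inl j))) ∨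
      ∃ a b, x = castI a ∧ y = castI b ∧ a ≠ Sum.inl j ∧ b ≠ Sum.inl j ∧ v a b := by
  have hs : ∀ {x y}, pairLast v j x y → pairLast v j y x := fun h => Setoid.symm' _ h
  constructor
  · intro h
    by_cases hx : x = lastPt ∨ x = castI (Sum.inl j)
    · left
      refine ⟨hx, ?_⟩
      have hl : pairLast v j lastPt y := by
        rcases hx with rfl | rfl
        · exact h
        · exact Setoid.trans' _ pairLast_self h
      rcases eq_castI_or y with ⟨b, rfl⟩ | h
      · exact Or.inr (congrArg _ (pairLast_lastPt.1 hl))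
      · exact Or.inl h
    · right
      rcases eq_castI_or x with ⟨a, rfl⟩ | h'
      · have ha : a ≠ Sum.inl j := fun h => hx (Or.inr (by rw [h]))
        rcases eq_castI_or y with ⟨b, rfl⟩ | rfl
        · obtain ⟨hb, hab⟩ := (pairLast_castI ha).1 h
          exact ⟨a, b, rfl, rfl, ha, hb, hab⟩
        · exact absurd (pairLast_lastPt.1 (hs h)) ha
      · exact absurd (Or.inl h') hx
  · rintro (⟨hx, hy⟩ | ⟨a, b, rfl, rfl, ha, hb, hab⟩)
    · have : ∀ {x}, (x = lastPt ∨ x = castI (Sum.inl j)) → pairLast v j lastPt x := by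
        rintro _ (rfl | rfl)
        · exact Setoid.refl' _ _
        · exact pairLast_self
      exact Setoid.trans' _ (hs (this hx)) (this hy)
    · exact (pairLast_castI ha).2 ⟨hb, hab⟩

theorem lastPairedWith_pairLast : LastPairedWith (pairLast v j) j := by
  refine ⟨pairLast_self, fun h => ?_⟩
  have := (pairLast_lastPt (b := infty)).1 h
  simp [infty] at this

/-- Taking the rightmost defect as partner ensures that the new pair braces no defect, and a pair
that enclosed `j` would have braced it as a defect. The letter `a` of `j` becomes `b` in the longer
row, opposite to the new `a`. -/
theorem isLinkState_pairLast (hv : IsLinkState v) (hj : Defect v j)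
    (hmax : ∀ i, Defect v i → i ≤ j) (hl : upperLabel j = Letter.a) :
    IsLinkState (pairLast v j) := by
  have hinf : ∀ {a}, v a infty → pos a ≤ pos (Sum.inl j : Fin n ⊕ Fin 1) ∨ a = infty := by
    rintro (a | a) ha
    · left; simpa [pos] using hmax a ha
    · exact Or.inr (eq_infty a)
  refine ⟨?_, ?_, ?_⟩
  · intro x y z t hxy hyz hzt hxz hyt
    rcases pairLast_iff.1 hxz with ⟨hx, hz⟩ | ⟨a, c, rfl, rfl, ha, hc, hac⟩
    · rcases hz with rfl | rfl
      · rcases hx with rfl | rfl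
        · omega
        · have ht : t = infty := eq_infty_of_pos (by rw [pos_lastPt] at hzt; omega)
          subst ht
          rcases pairLast_iff.1 hyt with ⟨-, h | h⟩ | ⟨b, d, rfl, hd, hb, -, hbd⟩
          · simp [lastPt, infty] at h
          · simp [castI, infty] at h
          · rw [← castI_infty] at hd
            obtain rfl := castI_injective hd
            rw [pos_castI_lt] at hxy
            rcases hinf hbd with h | rfl
            · omega
            · rw [castI_infty, pos_infty, pos_lastPt] at hyz
              omega
      · rcases hx with rfl | rfl
        · have := pos_le t
          rw [pos_lastPt] at hxy
          omega
        · omega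
    · rcases pairLast_iff.1 hyt with ⟨hy, ht⟩ | ⟨b, d, rfl, rfl, hb, hd, hbd⟩
      · rcases hy with rfl | rfl
        · have := pos_le t
          rw [pos_lastPt] at hyz
          omega
        · rcases ht with rfl | rfl
          · rw [pos_castI_lt] at hxy hyz
            have hcn : pos c < n := by
              by_contra hcn
              obtain rfl := eq_infty_of_pos (not_lt.1 hcn)
              rw [castI_infty, pos_infty, pos_lastPt] at hzt
              omega
            have := hv.noncrossing a (Sum.inl j) c infty hxy hyz
              (by rw [pos_infty]; exact hcn) hac hj
            have hc' : v c infty := v.trans (v.symm hac) (v.trans this hj)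
            rcases hinf hc' with h | rfl
            · omega
            · rw [pos_infty] at hcn; omega
          · omega
      · rw [pos_castI_lt] at hxy hyz hzt
        exact pairLast_iff.2 (Or.inr ⟨a, b, rfl, rfl, ha, hb,
          hv.noncrossing a b c d hxy hyz hzt hac hbd⟩)
  · intro i k l hi hik hil
    rcases pairLast_iff.1 hik with ⟨hx, hy⟩ | ⟨a, b, ha', hb', ha, hb, hab⟩
    · rcases pairLast_iff.1 hil with ⟨-, hz⟩ | ⟨a, b, ha', _, ha, _⟩
      · simp only [lastPt, castI, Sum.map_inl, Sum.inl.injEq] at hx hy hz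
        rcases hx with rfl | rfl <;> rcases hy with rfl | rfl <;> rcases hz with rfl | rfl <;> simp
      · rcases hx with hx | hx
        · exact absurd (ha'.symm.trans hx) (castI_ne_lastPt a)
        · exact absurd (castI_injective (ha'.symm.trans hx)) ha
    · rcases pairLast_iff.1 hil with ⟨hx, -⟩ | ⟨a', c, ha'', hc', -, hc, hac⟩
      · rcases hx with hx | hx
        · exact absurd (ha'.symm.trans hx) (castI_ne_lastPt a)
        · exact absurd (castI_injective (ha'.symm.trans hx)) ha
      · obtain rfl := castI_injective (ha'.symm.trans ha'')
        rcases a with a | a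
        · rcases b with b | b
          · rcases c with c | c
            · simp only [castI, Sum.map_inl, Sum.inl.injEq] at ha' hb' hc'
              subst ha' hb' hc'
              simp only [Fin.castSucc_inj]
              refine hv.card_block_le a b c (fun h => hi ?_) hab hac
              exact pairLast_iff.2 (Or.inr ⟨_, infty, rfl, rfl, ha, by simp [infty], h⟩)
            · simp [castI] at hc'
          · simp [castI] at hb'
        · simp [castI] at ha'
  · intro i k hi hik hne
    rcases pairLast_iff.1 hik with ⟨hx, hy⟩ | ⟨a, b, ha', hb', ha, hb, hab⟩
    · simp only [lastPt, castI, Sum.map_inl, Sum.inl.injEq] at hx hy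
      rcases hx with rfl | rfl <;> rcases hy with rfl | rfl
      · exact absurd rfl hne
      · rw [upperLabel_last, upperLabel_castSucc, hl]; simp [bar]
      · rw [upperLabel_last, upperLabel_castSucc, hl]; simp [bar]
      · exact absurd rfl hne
    · rcases a with a | a
      · rcases b with b | b
        · simp only [castI, Sum.map_inl, Sum.inl.injEq] at ha' hb'
          subst ha' hb'
          rw [upperLabel_castSucc, upperLabel_castSucc, bar_injective.ne_iff]
          refine hv.label_ne a b (fun h => hi ?_) hab fun h => hne (by rw [h])
          exact pairLast_iff.2 (Or.inr ⟨_, infty, rfl, rfl, ha, by simp [infty], h⟩)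
        · simp [castI] at hb'
      · simp [castI] at ha'

theorem dropPoint_pairLast (hj : Defect v j) : dropPoint (pairLast v j) = v := by
  have hinf : (infty : Fin n ⊕ Fin 1) ≠ Sum.inl j := by simp [infty]
  have hM : ∀ {a}, Merged (pairLast v j) a ↔ v a infty := by
    intro a
    by_cases ha : a = Sum.inl j
    · subst ha
      exact iff_of_true (Or.inl (Setoid.symm' _ pairLast_self)) hj
    · constructor
      · rintro (h | h)
        · exact absurd (pairLast_lastPt.1 (Setoid.symm' _ h)) ha
        · rw [← castI_infty] at h
          exact ((pairLast_castI ha).1 h).2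
      · intro h
        refine Or.inr ?_
        rw [← castI_infty]
        exact (pairLast_castI ha).2 ⟨hinf, h⟩
  ext a b
  rw [dropPoint_iff, hM, hM]
  constructor
  · rintro (h | h)
    · by_cases ha : a = Sum.inl j
      · subst ha
        have := pairLast_lastPt.1 (Setoid.trans' _ pairLast_self h)
        rw [this]
      · exact ((pairLast_castI ha).1 h).2
    · exact v.trans h.1 (v.symm h.2)
  · intro h
    by_cases ha : a = Sum.inl j
    · subst ha
      exact Or.inr ⟨hj, v.trans (v.symm h) hj⟩
    · by_cases hb : b = Sum.inl j
      · subst hb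
        exact Or.inr ⟨v.trans h hj, hj⟩
      · exact Or.inl ((pairLast_castI ha).2 ⟨hb, h⟩)

theorem LastPairedWith.pairLast_dropPoint (hu : IsLinkState u) (hj : LastPairedWith u j) :
    pairLast (dropPoint u) j = u := by
  ext x y
  rw [pairLast_iff]
  constructor
  · rintro (⟨hx, hy⟩ | ⟨a, b, rfl, rfl, ha, hb, hab⟩)
    · have : ∀ {x}, (x = lastPt ∨ x = castI (Sum.inl j)) → u lastPt x := by
        rintro _ (rfl | rfl)
        · exact u.refl _
        · exact hj.1
      exact u.trans (u.symm (this hx)) (this hy)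
    · rw [dropPoint_iff, hj.merged_iff hu, hj.merged_iff hu] at hab
      rcases hab with h | ⟨h, h'⟩
      · exact h
      · exact u.trans (h.resolve_left ha) (u.symm (h'.resolve_left hb))
  · intro h
    have hj' : ∀ {y}, u lastPt y → y = lastPt ∨ y = castI (Sum.inl j) := by
      intro y hy
      rcases eq_castI_or y with ⟨b | b, rfl⟩ | rfl
      · rw [hj.eq_of_rel hu hy]; exact Or.inr rfl
      · rw [eq_infty] at hy; exact absurd hy hj.2
      · exact Or.inl rfl
    by_cases hx : u lastPt x
    · exact Or.inl ⟨hj' hx, hj' (u.trans hx h)⟩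
    · have hy : ¬ u lastPt y := fun h' => hx (u.trans h' (u.symm h))
      rcases eq_castI_or x with ⟨a, rfl⟩ | rfl
      · rcases eq_castI_or y with ⟨b, rfl⟩ | rfl
        · exact Or.inr ⟨a, b, rfl, rfl, fun ha => hx (ha ▸ hj.1), fun hb => hy (hb ▸ hj.1),
            (dropPoint_iff u).2 (Or.inl h)⟩
        · exact absurd (u.refl _) hy
      · exact absurd (u.refl _) hx

/-- The partner of the last point is recovered as the rightmost defect after dropping, and then
`pairLast` restores the state. -/
theorem dropPoint_injective_of_paired {u' : Setoid (Fin (n + 1) ⊕ Fin 1)} {j' : Fin n}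
    (hu : IsLinkState u) (hu' : IsLinkState u') (hj : LastPairedWith u j)
    (hj' : LastPairedWith u' j') (h : dropPoint u = dropPoint u') : u = u' := by
  have hle : ∀ {u u' : Setoid (Fin (n + 1) ⊕ Fin 1)} {j j'}, IsLinkState u → IsLinkState u' →
      LastPairedWith u j → LastPairedWith u' j' → dropPoint u = dropPoint u' → j ≤ j' := by
    intro u u' j j' hu hu' hj hj' h
    have h1 : Defect (dropPoint u') j := h ▸ (hj.defect_dropPoint hu).2 (Or.inr rfl)
    rcases (hj'.defect_dropPoint hu').1 h1 with h2 | h2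
    · exact (hj'.lt_of_defect hu' h2).le
    · exact h2.le
  have hjj : j = j' := le_antisymm (hle hu hu' hj hj' h) (hle hu' hu hj' hj h.symm)
  subst hjj
  rw [← hj.pairLast_dropPoint hu, h, hj'.pairLast_dropPoint hu']

end pairing

end Diagram

/-! ### The operations on bundled link states -/

section restriction

open Diagram

variable {n : ℕ}

/-- A link state with a proper singleton added on the right. -/
def LinkState.addPoint (v : LinkState n) : LinkState (n + 1) := ⟨Diagram.addPoint v.1, v.2.addPoint⟩

/-- A link state with a defect added on the right. -/
def LinkState.addDefect (v : LinkState n) : LinkState (n + 1) :=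
  ⟨Diagram.addDefect v.1, v.2.addDefect⟩

/-- A link state without its last point; a point that is paired with the last point becomes
a defect. -/
def LinkState.dropPoint (u : LinkState (n + 1)) : LinkState n :=
  ⟨Diagram.dropPoint u.1, u.2.dropPoint⟩

/-- The last point belongs to a pair. -/
def LinkState.LastPaired (u : LinkState (n + 1)) : Prop := ∃ j, LastPairedWith u.1 j

theorem LinkState.act_addPoint (p : ABDiagram n) (v : LinkState n) :
    v.addPoint.act p.addStrand = (v.act p).addPoint := Subtype.ext (comp_addPoint p.1 v.1)

theorem LinkState.act_addDefect (p : ABDiagram n) (v : LinkState n) :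
    v.addDefect.act p.addStrand = (v.act p).addDefect := Subtype.ext (comp_addDefect p.1 v.1)

theorem LinkState.act_dropPoint (p : ABDiagram n) (u : LinkState (n + 1)) :
    u.dropPoint.act p = (u.act p.addStrand).dropPoint := Subtype.ext (comp_dropPoint p.1 u.1)

theorem LinkState.dropPoint_addPoint (v : LinkState n) : v.addPoint.dropPoint = v :=
  Subtype.ext Diagram.dropPoint_addPoint

theorem LinkState.dropPoint_addDefect (v : LinkState n) : v.addDefect.dropPoint = v :=
  Subtype.ext Diagram.dropPoint_addDefect

theorem LinkState.word_addPoint (v : LinkState n) : v.addPoint.word = v.word.map bar := by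
  classical
  refine (labelWord_succ (Defect (Diagram.addPoint v.1))).trans ?_
  rw [if_neg not_defect_addPoint_last, List.append_nil]
  exact congrArg (fun P => (labelWord P).map bar)
    (funext fun i => propext defect_addPoint_castSucc)

theorem LinkState.word_addDefect (v : LinkState n) :
    v.addDefect.word = v.word.map bar ++ [Letter.a] := by
  classical
  refine (labelWord_succ (Defect (Diagram.addDefect v.1))).trans ?_
  rw [if_pos defect_addDefect_last]
  exact congrArg (fun P => (labelWord P).map bar ++ [Letter.a])
    (funext fun i => propext defect_addDefect_castSucc)

theorem LinkState.LastPaired.word_dropPoint {u : LinkState (n + 1)} (h : u.LastPaired) :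
    u.dropPoint.word = u.word.map bar ++ [Letter.a] := by
  obtain ⟨j, hj⟩ := h
  exact hj.labelWord_dropPoint u.2

theorem LinkState.last_cases (u : LinkState (n + 1)) :
    u = u.dropPoint.addPoint ∨ u = u.dropPoint.addDefect ∨ u.LastPaired := by
  rcases Diagram.last_cases u.1 with h | h | h
  · exact Or.inl (Subtype.ext (Diagram.addPoint_dropPoint h).symm)
  · exact Or.inr (Or.inl (Subtype.ext (Diagram.addDefect_dropPoint h).symm))
  · exact Or.inr (Or.inr h)

theorem LinkState.defects_dropPoint_le (u : LinkState (n + 1)) :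
    u.dropPoint.defects ≤ u.defects + 1 := by
  rw [← LinkState.length_word, ← LinkState.length_word]
  rcases u.last_cases with h | h | h
  · conv_rhs => rw [h, LinkState.word_addPoint, List.length_map]
    omega
  · conv_rhs => rw [h, LinkState.word_addDefect, List.length_append, List.length_map]
    omega
  · rw [h.word_dropPoint]; simp

theorem LinkState.LastPaired.injective {u u' : LinkState (n + 1)} (hu : u.LastPaired)
    (hu' : u'.LastPaired) (h : u.dropPoint = u'.dropPoint) : u = u' := by
  obtain ⟨j, hj⟩ := hu
  obtain ⟨j', hj'⟩ := hu'
  exact Subtype.ext (dropPoint_injective_of_paired u.2 u'.2 hj hj' (congrArg Subtype.val h))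

theorem LinkState.exists_lastPaired {v : LinkState n} {w : List Letter}
    (h : v.word = w ++ [Letter.a]) : ∃ u : LinkState (n + 1), u.LastPaired ∧ u.dropPoint = v := by
  obtain ⟨j, hj, hmax, hl⟩ := exists_last_of_labelWord h
  exact ⟨⟨pairLast v.1 j, isLinkState_pairLast v.2 hj hmax hl⟩, ⟨j, lastPairedWith_pairLast⟩,
    Subtype.ext (dropPoint_pairLast hj)⟩

end restriction

/-! ### Additivity of multiplicities -/

section multiplicity

variable {R : Type} [Ring R] {M N P S : Type} [AddCommGroup M] [Module R M] [AddCommGroup N]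
  [Module R N] [AddCommGroup P] [Module R P] [AddCommGroup S] [Module R S]

theorem length_isotypicComponent_congr (e : M ≃ₗ[R] N) :
    Module.length R (isotypicComponent R M S) = Module.length R (isotypicComponent R N S) := by
  rw [← isotypicComponent_map e]
  exact (e.submoduleMap _).length_eq

theorem isotypicComponent_prod [IsSimpleModule R S] : isotypicComponent R (M × N) S =
    (isotypicComponent R M S).prod (isotypicComponent R N S) := by
  apply le_antisymm
  · exact le_inf (LinearMap.le_comap_isotypicComponent S (LinearMap.fst R M N))
      (LinearMap.le_comap_isotypicComponent S (LinearMap.snd R M N))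
  · rintro ⟨x, y⟩ ⟨hx, hy⟩
    have h1 : (x, 0) ∈ isotypicComponent R (M × N) S :=
      LinearMap.le_comap_isotypicComponent S (LinearMap.inl R M N) hx
    have h2 : (0, y) ∈ isotypicComponent R (M × N) S :=
      LinearMap.le_comap_isotypicComponent S (LinearMap.inr R M N) hy
    have := Submodule.add_mem _ h1 h2
    simpa using this

theorem length_isotypicComponent_prod [IsSimpleModule R S] :
    Module.length R (isotypicComponent R (M × N) S) =
      Module.length R (isotypicComponent R M S) + Module.length R (isotypicComponent R N S) := by
  rw [isotypicComponent_prod, ← Module.length_prod]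
  exact LinearEquiv.length_eq
    { toFun := fun x => (⟨x.1.1, x.2.1⟩, ⟨x.1.2, x.2.2⟩)
      map_add' := fun _ _ => rfl
      map_smul' := fun _ _ => rfl
      invFun := fun x => ⟨(x.1.1, x.2.1), x.1.2, x.2.2⟩
      left_inv := fun _ => rfl
      right_inv := fun _ => rfl }

/-- The kernel of `g` has a complement in the semisimple module `M`, so `M` is the product of `N`
and `P` up to isomorphism. -/
theorem length_isotypicComponent_of_exact [IsSemisimpleModule R M] [IsSimpleModule R S]
    {f : N →ₗ[R] M} {g : M →ₗ[R] P} (hf : Function.Injective f) (hg : Function.Surjective g)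
    (h : Function.Exact f g) : Module.length R (isotypicComponent R M S) =
      Module.length R (isotypicComponent R N S) + Module.length R (isotypicComponent R P S) := by
  obtain ⟨C, hC⟩ := exists_isCompl (LinearMap.ker g)
  rw [← length_isotypicComponent_congr (Submodule.prodEquivOfIsCompl _ C hC),
    length_isotypicComponent_prod]
  congr 1
  · exact (length_isotypicComponent_congr ((LinearEquiv.ofInjective f hf).trans
      (LinearEquiv.ofEq _ _ (LinearMap.exact_iff.1 h).symm))).symm
  · exact length_isotypicComponent_congr ((Submodule.quotientEquivOfIsCompl _ C hC).symm.trans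
      (g.quotKerEquivOfSurjective hg))

theorem length_isotypicComponent_of_equiv [IsSimpleModule R S] (e : M ≃ₗ[R] S) :
    Module.length R (isotypicComponent R M S) = 1 := by
  have : IsSimpleModule R M := IsSimpleModule.congr e
  have h : isotypicComponent R M S = ⊤ :=
    top_le_iff.1 (le_sSup ⟨Submodule.topEquiv.trans e⟩)
  rw [h, Module.length_top, Module.length_eq_one]

theorem length_isotypicComponent_of_not_equiv [IsSimpleModule R S] [IsSimpleModule R M]
    (h : ¬ Nonempty (M ≃ₗ[R] S)) : Module.length R (isotypicComponent R M S) = 0 := by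
  have : isotypicComponent R M S = ⊥ := by
    refine sSup_eq_bot.2 ?_
    rintro m ⟨e⟩
    rcases eq_bot_or_eq_top m with hm | hm
    · exact hm
    · exact absurd ⟨Submodule.topEquiv.symm.trans ((LinearEquiv.ofEq _ _ hm.symm).trans e)⟩ h
  rw [this, Module.length_bot]

end multiplicity

/-- A left inverse sends each basis vector `B' (φ i)` back to `B i` and all other basis vectors to
zero. -/
theorem injective_of_map_basis {ι κ M N : Type} [AddCommGroup M] [Module ℂ M] [AddCommGroup N]
    [Module ℂ N] (B : Module.Basis ι ℂ M) (B' : Module.Basis κ ℂ N) {φ : ι → κ}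
    (hφ : Function.Injective φ) (f : M →ₗ[ℂ] N) (hf : ∀ i, f (B i) = B' (φ i)) :
    Function.Injective f := by
  have h : (B'.constr ℂ (Function.extend φ B 0)) ∘ₗ f = LinearMap.id := B.ext fun i => by
    rw [LinearMap.comp_apply, hf, Module.Basis.constr_basis, hφ.extend_apply, LinearMap.id_apply]
  exact Function.LeftInverse.injective (g := B'.constr ℂ (Function.extend φ B 0))
    fun x => LinearMap.congr_fun h x

/-! ### The branching rule -/

section branching

open Diagram

variable (δ : ℂ) (n : ℕ)

/-- The module of the word `w` over the algebra of level `n + 1`, restricted to level `n`. -/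
def ResWordModule (w : List Letter) : Type := wordModule δ (n + 1) w.length w

variable {n} (w : List Letter)

noncomputable instance : AddCommGroup (ResWordModule δ n w) :=
  inferInstanceAs (AddCommGroup (wordModule δ (n + 1) w.length w))

noncomputable instance : Module ℂ (ResWordModule δ n w) :=
  inferInstanceAs (Module ℂ (wordModule δ (n + 1) w.length w))

noncomputable instance : Module (DiagAlg δ n) (ResWordModule δ n w) :=
  Module.compHom (wordModule δ (n + 1) w.length w) (DiagAlg.incl δ n).toRingHom

theorem ResWordModule.smul_def (x : DiagAlg δ n) (m : ResWordModule δ n w) :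
    x • m = (DiagAlg.incl δ n x • (show wordModule δ (n + 1) w.length w from m) :
      wordModule δ (n + 1) w.length w) := rfl

instance : IsScalarTower ℂ (DiagAlg δ n) (ResWordModule δ n w) := ⟨fun c x m => by
  rw [ResWordModule.smul_def, map_smul, smul_assoc]; rfl⟩

/-- The link states with boundary word `w`, as a basis of the restricted module. -/
noncomputable def resBasis : Module.Basis {u : LinkState (n + 1) // u.word = w} ℂ
    (ResWordModule δ n w) := cellBasis δ w

theorem smul_resBasis {w : List Letter} (p : ABDiagram n)
    (u : {u : LinkState (n + 1) // u.word = w}) (h : (u.1.act p.addStrand).word = w) :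
    diagBasis δ n p • resBasis δ w u =
      δ ^ loops p.addStrand.1 u.1.1 • resBasis δ w ⟨u.1.act p.addStrand, h⟩ := by
  rw [ResWordModule.smul_def]
  change DiagAlg.inclLinear δ n (diagBasis δ n p) • cellBasis δ w u = _
  rw [DiagAlg.inclLinear_basis]
  exact smul_cellBasis δ p.addStrand u h

theorem smul_resBasis_eq_zero {w : List Letter} (p : ABDiagram n)
    (u : {u : LinkState (n + 1) // u.word = w}) (h : (u.1.act p.addStrand).word ≠ w) :
    diagBasis δ n p • resBasis δ w u = 0 := by
  rw [ResWordModule.smul_def]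
  change DiagAlg.inclLinear δ n (diagBasis δ n p) • cellBasis δ w u = _
  rw [DiagAlg.inclLinear_basis]
  exact smul_cellBasis_eq_zero δ p.addStrand u h

theorem map_bar_map_bar (w : List Letter) : (w.map bar).map bar = w := by
  rw [List.map_map, show bar ∘ bar = id from funext bar_bar, List.map_id]

variable {w}

theorem word_addPoint_eq {v : LinkState n} : v.addPoint.word = w ↔ v.word = w.map bar := by
  rw [LinkState.word_addPoint]
  constructor
  · rintro rfl; rw [map_bar_map_bar]
  · intro h; rw [h, map_bar_map_bar]

theorem word_addDefect_eq {v : LinkState n} :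
    v.addDefect.word = w ++ [Letter.a] ↔ v.word = w.map bar := by
  rw [LinkState.word_addDefect, List.append_cancel_right_eq]
  constructor
  · rintro rfl; rw [map_bar_map_bar]
  · intro h; rw [h, map_bar_map_bar]

/-- Length decides: removing a proper singleton keeps the number of defects, removing a defect
lowers it, and only removing a paired point raises it. -/
theorem word_dropPoint_iff {u : LinkState (n + 1)} (hu : u.word = w) :
    u.dropPoint.word = w.map bar ++ [Letter.a] ↔ u.LastPaired := by
  subst hu
  refine ⟨fun h => ?_, fun h => h.word_dropPoint⟩
  have hl : u.dropPoint.word.length = u.word.length + 1 := by rw [h]; simp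
  rcases u.last_cases with h' | h' | h'
  · rw [h', LinkState.word_addPoint, ← h'] at hl; simp at hl
  · rw [h', LinkState.word_addDefect, ← h'] at hl; simp at hl; omega
  · exact h'

/-- Adding a point. -/
noncomputable def pointLinear (n : ℕ) (w : List Letter) :
    wordModule δ n (w.map bar).length (w.map bar) →ₗ[ℂ] ResWordModule δ n w :=
  (cellBasis δ (w.map bar)).constr ℂ fun v =>
    resBasis δ w ⟨v.1.addPoint, word_addPoint_eq.2 v.2⟩

theorem pointLinear_cellBasis (v : {v : LinkState n // v.word = w.map bar}) :
    pointLinear δ n w (cellBasis δ (w.map bar) v) =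
      resBasis δ w ⟨v.1.addPoint, word_addPoint_eq.2 v.2⟩ := by
  rw [pointLinear, Module.Basis.constr_basis]

/-- Adding a point, as a linear map over the diagram algebra. -/
noncomputable def pointMap (n : ℕ) (w : List Letter) :
    wordModule δ n (w.map bar).length (w.map bar) →ₗ[DiagAlg δ n] ResWordModule δ n w :=
  diagLinear (cellBasis δ (w.map bar)) (pointLinear δ n w) (by
    intro p v
    rw [pointLinear_cellBasis]
    by_cases h : (v.1.act p).word = w.map bar
    · have h' : (v.1.addPoint.act p.addStrand).word = w := by
        rw [LinkState.act_addPoint, word_addPoint_eq]; exact h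
      rw [smul_cellBasis δ p v h, map_smul, pointLinear_cellBasis,
        smul_resBasis δ p ⟨v.1.addPoint, _⟩ h']
      exact congrArg₂ (fun (k : ℕ) x => δ ^ k • x) (loops_addPoint (p := p.1) (v := v.1.1)).symm
        (congrArg (resBasis δ w) (Subtype.ext (LinkState.act_addPoint p v.1).symm))
    · have h' : (v.1.addPoint.act p.addStrand).word ≠ w := by
        rw [LinkState.act_addPoint, Ne, word_addPoint_eq]; exact h
      rw [smul_cellBasis_eq_zero δ p v h, map_zero,
        smul_resBasis_eq_zero δ p ⟨v.1.addPoint, _⟩ h'])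

theorem pointMap_cellBasis (v : {v : LinkState n // v.word = w.map bar}) :
    pointMap δ n w (cellBasis δ (w.map bar) v) =
      resBasis δ w ⟨v.1.addPoint, word_addPoint_eq.2 v.2⟩ :=
  pointLinear_cellBasis δ v

/-- Adding a defect. -/
noncomputable def defectLinear (n : ℕ) (w : List Letter) :
    wordModule δ n (w.map bar).length (w.map bar) →ₗ[ℂ] ResWordModule δ n (w ++ [Letter.a]) :=
  (cellBasis δ (w.map bar)).constr ℂ fun v =>
    resBasis δ (w ++ [Letter.a]) ⟨v.1.addDefect, word_addDefect_eq.2 v.2⟩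

theorem defectLinear_cellBasis (v : {v : LinkState n // v.word = w.map bar}) :
    defectLinear δ n w (cellBasis δ (w.map bar) v) =
      resBasis δ (w ++ [Letter.a]) ⟨v.1.addDefect, word_addDefect_eq.2 v.2⟩ := by
  rw [defectLinear, Module.Basis.constr_basis]

/-- Adding a defect, as a linear map over the diagram algebra. -/
noncomputable def defectMap (n : ℕ) (w : List Letter) :
    wordModule δ n (w.map bar).length (w.map bar) →ₗ[DiagAlg δ n]
      ResWordModule δ n (w ++ [Letter.a]) :=
  diagLinear (cellBasis δ (w.map bar)) (defectLinear δ n w) (by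
    intro p v
    rw [defectLinear_cellBasis]
    by_cases h : (v.1.act p).word = w.map bar
    · have h' : (v.1.addDefect.act p.addStrand).word = w ++ [Letter.a] := by
        rw [LinkState.act_addDefect, word_addDefect_eq]; exact h
      rw [smul_cellBasis δ p v h, map_smul, defectLinear_cellBasis,
        smul_resBasis δ p ⟨v.1.addDefect, _⟩ h']
      exact congrArg₂ (fun (k : ℕ) x => δ ^ k • x) (loops_addDefect (p := p.1) (v := v.1.1)).symm
        (congrArg (resBasis δ (w ++ [Letter.a])) (Subtype.ext (LinkState.act_addDefect p v.1).symm))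
    · have h' : (v.1.addDefect.act p.addStrand).word ≠ w ++ [Letter.a] := by
        rw [LinkState.act_addDefect, Ne, word_addDefect_eq]; exact h
      rw [smul_cellBasis_eq_zero δ p v h, map_zero,
        smul_resBasis_eq_zero δ p ⟨v.1.addDefect, _⟩ h'])

theorem defectMap_cellBasis (v : {v : LinkState n // v.word = w.map bar}) :
    defectMap δ n w (cellBasis δ (w.map bar) v) =
      resBasis δ (w ++ [Letter.a]) ⟨v.1.addDefect, word_addDefect_eq.2 v.2⟩ :=
  defectLinear_cellBasis δ v

open Classical in
/-- Removing the last point, where the point that it is paired with becomes a defect. -/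
noncomputable def dropLinear (n : ℕ) (w : List Letter) : ResWordModule δ n w →ₗ[ℂ]
    wordModule δ n (w.map bar ++ [Letter.a]).length (w.map bar ++ [Letter.a]) :=
  (resBasis δ w).constr ℂ fun u =>
    if h : u.1.dropPoint.word = w.map bar ++ [Letter.a] then
      cellBasis δ (w.map bar ++ [Letter.a]) ⟨u.1.dropPoint, h⟩ else 0

theorem dropLinear_of_pos (u : {u : LinkState (n + 1) // u.word = w})
    (h : u.1.dropPoint.word = w.map bar ++ [Letter.a]) : dropLinear δ n w (resBasis δ w u) =
      cellBasis δ (w.map bar ++ [Letter.a]) ⟨u.1.dropPoint, h⟩ := by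
  rw [dropLinear, Module.Basis.constr_basis, dif_pos h]

theorem dropLinear_of_neg (u : {u : LinkState (n + 1) // u.word = w})
    (h : u.1.dropPoint.word ≠ w.map bar ++ [Letter.a]) : dropLinear δ n w (resBasis δ w u) = 0 := by
  rw [dropLinear, Module.Basis.constr_basis, dif_neg h]

/-- Removing the last point, as a linear map over the diagram algebra. -/
noncomputable def dropMap (n : ℕ) (w : List Letter) : ResWordModule δ n w →ₗ[DiagAlg δ n]
    wordModule δ n (w.map bar ++ [Letter.a]).length (w.map bar ++ [Letter.a]) :=
  diagLinear (resBasis δ w) (dropLinear δ n w) (by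
    intro p u
    have hlen : (w.map bar ++ [Letter.a]).length = w.length + 1 := by simp
    have hu : u.1.defects = w.length := by rw [← u.1.length_word, u.2]
    have hd := u.1.defects_dropPoint_le
    have hd' := (u.1.act p.addStrand).defects_dropPoint_le
    have ha := u.1.dropPoint.defects_act_le p
    have hact := LinkState.act_dropPoint p u.1
    by_cases h : (u.1.act p.addStrand).word = w
    · rw [smul_resBasis δ p u h, map_smul]
      by_cases h1 : u.1.dropPoint.word = w.map bar ++ [Letter.a]
      · rw [dropLinear_of_pos δ u h1]
        by_cases h2 : (u.1.dropPoint.act p).word = w.map bar ++ [Letter.a]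
        · rw [smul_cellBasis δ p ⟨u.1.dropPoint, h1⟩ h2,
            dropLinear_of_pos δ ⟨u.1.act p.addStrand, h⟩ (by rw [← hact]; exact h2)]
          exact congrArg₂ (fun (k : ℕ) x => δ ^ k • x)
            (loops_dropPoint p.1 u.1.1).symm (congrArg (cellBasis δ _) (Subtype.ext hact.symm))
        · rw [smul_cellBasis_eq_zero δ p ⟨u.1.dropPoint, h1⟩ h2,
            dropLinear_of_neg δ ⟨u.1.act p.addStrand, h⟩ (by rw [← hact]; exact h2), smul_zero]
      -- If the last point of `u` is not paired, it does not become paired: otherwise the state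
      -- after dropping and acting would have `|w| + 1` defects, the most possible, so its word
      -- would already be that of `u.dropPoint`.
      · rw [dropLinear_of_neg δ u h1, smul_zero, dropLinear_of_neg, smul_zero]
        intro h2
        rw [← hact] at h2
        refine h1 ((LinkState.word_act (p := p) ?_).symm.trans h2)
        rw [← (u.1.dropPoint.act p).length_word, h2, hlen]
        omega
    -- Here the action destroys `w`. If the longer word survived on the dropped state, `|w| + 1`
    -- defects would remain there, hence at least `|w|` before dropping, and `w` would have survived
    -- as well.
    · rw [smul_resBasis_eq_zero δ p u h, map_zero]
      by_cases h1 : u.1.dropPoint.word = w.map bar ++ [Letter.a]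
      · rw [dropLinear_of_pos δ u h1, smul_cellBasis_eq_zero]
        intro h2
        have h3 : (u.1.dropPoint.act p).defects = w.length + 1 := by
          rw [← LinkState.length_word, ← hlen]; exact congrArg _ h2
        rw [hact] at h3
        exact h ((LinkState.word_act (p := p.addStrand) (by omega)).trans u.2)
      · rw [dropLinear_of_neg δ u h1, smul_zero])

/-- The link states whose last point belongs to a pair span a quotient of the restricted module. -/
theorem length_isotypicComponent_resWordModule [IsSemisimpleRing (DiagAlg δ n)] {ι N S : Type}
    [AddCommGroup N] [Module ℂ N] [Module (DiagAlg δ n) N] [IsScalarTower ℂ (DiagAlg δ n) N]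
    [AddCommGroup S] [Module (DiagAlg δ n) S] [IsSimpleModule (DiagAlg δ n) S]
    (B : Module.Basis ι ℂ N) (f : N →ₗ[DiagAlg δ n] ResWordModule δ n w)
    (φ : ι → {u : LinkState (n + 1) // u.word = w}) (hφ : Function.Injective φ)
    (hf : ∀ i, f (B i) = resBasis δ w (φ i)) (hφ' : ∀ u, u ∈ Set.range φ ↔ ¬ u.1.LastPaired) :
    Module.length (DiagAlg δ n) (isotypicComponent (DiagAlg δ n) (ResWordModule δ n w) S) =
      Module.length (DiagAlg δ n) (isotypicComponent (DiagAlg δ n) N S) +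
      Module.length (DiagAlg δ n) (isotypicComponent (DiagAlg δ n)
        (wordModule δ n (w.map bar ++ [Letter.a]).length (w.map bar ++ [Letter.a])) S) := by
  -- Each link state with word `w̄a` arises by dropping the last point of a paired state: its
  -- rightmost defect has letter `a` and can be paired with a new point. This gives a complex linear
  -- section `J` of the drop map.
  have hsec : ∀ v : {v : LinkState n // v.word = w.map bar ++ [Letter.a]},
      ∃ u : {u : LinkState (n + 1) // u.word = w}, u.1.LastPaired ∧ u.1.dropPoint = v.1 := by
    rintro ⟨v, hv⟩
    obtain ⟨u, hu, rfl⟩ := LinkState.exists_lastPaired hv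
    refine ⟨⟨u, ?_⟩, hu, rfl⟩
    rw [hu.word_dropPoint, List.append_cancel_right_eq] at hv
    exact bar_injective.list_map hv
  choose j hj hj' using hsec
  let J := (cellBasis δ (w.map bar ++ [Letter.a])).constr ℂ fun v => resBasis δ w (j v)
  have hJ : ∀ v, J (cellBasis δ _ v) = resBasis δ w (j v) := fun v =>
    Module.Basis.constr_basis _ _ _ _
  have hg : ∀ v, dropMap δ n w (resBasis δ w (j v)) = cellBasis δ _ v := by
    intro v
    refine (dropLinear_of_pos δ (j v) (by rw [hj']; exact v.2)).trans ?_
    exact congrArg _ (Subtype.ext (hj' v))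
  have hgf : ∀ x, dropMap δ n w (f x) = 0 := by
    intro x
    have : (dropMap δ n w ∘ₗ f).restrictScalars ℂ = 0 := B.ext fun i => by
      refine (congrArg (dropMap δ n w) (hf i)).trans (dropLinear_of_neg δ _ fun h => ?_)
      exact (hφ' (φ i)).1 ⟨i, rfl⟩ ((word_dropPoint_iff (φ i).2).1 h)
    exact LinearMap.congr_fun this x
  -- On a paired basis state the difference is zero, since such a state is determined by its dropped
  -- state; on any other basis state the drop map vanishes and the state itself lies in the range of
  -- `f`. This yields exactness in the middle.
  have hmem : ∀ x, x - J (dropMap δ n w x) ∈ LinearMap.range (f.restrictScalars ℂ) := by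
    intro x
    have hle : (⊤ : Submodule ℂ (ResWordModule δ n w)) ≤
        (LinearMap.range (f.restrictScalars ℂ)).comap
          (LinearMap.id - J ∘ₗ (dropMap δ n w).restrictScalars ℂ) := by
      rw [← (resBasis δ w).span_eq, Submodule.span_le]
      rintro _ ⟨u, rfl⟩
      change resBasis δ w u - J (dropMap δ n w (resBasis δ w u)) ∈
        LinearMap.range (f.restrictScalars ℂ)
      by_cases hu : u.1.LastPaired
      · have h1 := (word_dropPoint_iff u.2).2 hu
        rw [show dropMap δ n w (resBasis δ w u) = _ from dropLinear_of_pos δ u h1, hJ,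
          show j ⟨u.1.dropPoint, h1⟩ = u from Subtype.ext ((hj _).injective hu (hj' _)), sub_self]
        exact Submodule.zero_mem _
      · rw [show dropMap δ n w (resBasis δ w u) = _ from
          dropLinear_of_neg δ u fun h => hu ((word_dropPoint_iff u.2).1 h), map_zero, sub_zero]
        obtain ⟨i, rfl⟩ := (hφ' u).2 hu
        exact ⟨B i, hf i⟩
    exact hle Submodule.mem_top
  refine length_isotypicComponent_of_exact (f := f) (g := dropMap δ n w) ?_ ?_ ?_
  · exact injective_of_map_basis B (resBasis δ w) hφ (f.restrictScalars ℂ) hf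
  · have : (dropMap δ n w).restrictScalars ℂ ∘ₗ J = LinearMap.id :=
      Module.Basis.ext (cellBasis δ _) fun v => by
        rw [LinearMap.comp_apply, hJ]; exact hg v
    exact fun x => ⟨J x, LinearMap.congr_fun this x⟩
  · intro x
    constructor
    · intro hx
      have := hmem x
      rw [hx, map_zero, sub_zero] at this
      exact this
    · rintro ⟨y, rfl⟩
      exact hgf y

/-- The word `w̄a` need not be a subword of the shorter alternating word. Its module is then zero,
so the multiplicity formula needs no separate case. -/
theorem subsingleton_wordModule (hw : w ∉ subwords n) :
    Subsingleton (wordModule δ n w.length w) := by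
  have : IsEmpty {u : LinkState n // u.word = w} :=
    ⟨fun u => hw (by rw [← u.2]; exact u.1.word_mem_subwords)⟩
  exact (cellBasis δ w).repr.toEquiv.subsingleton

-- Schur's lemma for the modules of words, with the zero modules of non-subwords included.
open Classical in
theorem length_isotypicComponent_wordModule [IsSemisimpleRing (DiagAlg δ n)] (hδ : δ ≠ 0)
    {v : List Letter} (hv : v ∈ subwords n) (w : List Letter) :
    Module.length (DiagAlg δ n) (isotypicComponent (DiagAlg δ n) (wordModule δ n w.length w)
      (wordModule δ n v.length v)) = if v = w then 1 else 0 := by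
  have := isSimpleModule_wordModule hδ hv
  split_ifs with h
  · subst h
    exact length_isotypicComponent_of_equiv (LinearEquiv.refl _ _)
  · by_cases hw : w ∈ subwords n
    · have := isSimpleModule_wordModule hδ hw
      exact length_isotypicComponent_of_not_equiv fun h' =>
        h (eq_of_wordModule_equiv hδ hw hv h').symm
    · have := subsingleton_wordModule δ hw
      exact Module.length_eq_zero

/-- The words whose modules occur in the restriction of the module of `w`. -/
def Branches (v w : List Letter) : Prop :=
  v = w.map bar ∨ w = v.map bar ++ [Letter.a] ∨ v = w.map bar ++ [Letter.a]

-- The submodule spanned by unpaired states is `V_{w̄}`, with a further summand `V_{w̄'}` when `w =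
-- w'a`; the quotient is `V_{w̄a}`. Multiplicities are counted in each piece.
open Classical in
theorem length_isotypicComponent_restriction [IsSemisimpleRing (DiagAlg δ n)] (hδ : δ ≠ 0)
    {v : List Letter} (hv : v ∈ subwords n) (w : List Letter) :
    Module.length (DiagAlg δ n) (isotypicComponent (DiagAlg δ n) (ResWordModule δ n w)
      (wordModule δ n v.length v)) = if Branches v w then 1 else 0 := by
  have := isSimpleModule_wordModule hδ hv
  have hpt : ∀ x : LinkState n, ¬ x.addPoint.LastPaired := fun x h => by
    have := congrArg List.length h.word_dropPoint
    rw [LinkState.dropPoint_addPoint, LinkState.word_addPoint] at this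
    simp at this
  have hdf : ∀ x : LinkState n, ¬ x.addDefect.LastPaired := fun x h => by
    have := congrArg List.length h.word_dropPoint
    rw [LinkState.dropPoint_addDefect, LinkState.word_addDefect] at this
    simp at this
  by_cases hw : ∃ w', w = w' ++ [Letter.a]
  · obtain ⟨w', rfl⟩ := hw
    set w := w' ++ [Letter.a] with hw
    -- A state with a new singleton and one with a new defect cannot coincide: dropping the last
    -- point would give the same state with words of different lengths.
    have hne : ∀ x y : LinkState n, x.word = w.map bar → y.word = w'.map bar →
        x.addPoint ≠ y.addDefect := by
      intro x y hx hy h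
      have := congrArg LinkState.dropPoint h
      rw [LinkState.dropPoint_addPoint, LinkState.dropPoint_addDefect] at this
      have := congrArg List.length ((congrArg LinkState.word this).symm.trans hx)
      rw [hy, hw] at this
      simp at this
    rw [length_isotypicComponent_resWordModule δ
      ((cellBasis δ (w.map bar)).prod (cellBasis δ (w'.map bar)))
      ((pointMap δ n w).coprod (defectMap δ n w'))
      (Sum.elim (fun x => ⟨x.1.addPoint, word_addPoint_eq.2 x.2⟩)
        (fun x => ⟨x.1.addDefect, word_addDefect_eq.2 x.2⟩)) ?_ ?_ ?_,
      length_isotypicComponent_prod, length_isotypicComponent_wordModule δ hδ hv,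
      length_isotypicComponent_wordModule δ hδ hv, length_isotypicComponent_wordModule δ hδ hv]
    · have h1 : w = v.map bar ++ [Letter.a] ↔ v = w'.map bar := by
        rw [hw, List.append_cancel_right_eq]
        constructor
        · rintro rfl; rw [map_bar_map_bar]
        · rintro rfl; rw [map_bar_map_bar]
      simp only [Branches, h1]
      -- The three words that can occur have lengths `|w|`, `|w| - 1` and `|w| + 1`, so at most one
      -- indicator is nonzero.
      have hlen : ∀ {x y : List Letter}, x.length ≠ y.length → x ≠ y := fun h h' => h (h' ▸ rfl)
      by_cases h2 : v = w.map bar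
      · subst h2
        rw [if_pos rfl, if_neg (hlen (by simp [hw])), if_neg (hlen (by simp)), if_pos (Or.inl rfl)]
        rfl
      · rw [if_neg h2]
        by_cases h3 : v = w'.map bar
        · subst h3
          rw [if_pos rfl, if_neg (hlen (by simp [hw])), if_pos (Or.inr (Or.inl rfl))]
          rfl
        · rw [if_neg h3, zero_add, zero_add]
          simp only [h2, h3, false_or]
    · rintro (⟨x, hx⟩ | ⟨x, hx⟩) (⟨y, hy⟩ | ⟨y, hy⟩) h
      · have := congrArg (fun u => u.1.dropPoint) h
        simp only [Sum.elim_inl, LinkState.dropPoint_addPoint] at this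
        subst this; rfl
      · exact absurd (congrArg Subtype.val h) (hne x y hx hy)
      · exact absurd (congrArg Subtype.val h).symm (hne y x hy hx)
      · have := congrArg (fun u => u.1.dropPoint) h
        simp only [Sum.elim_inr, LinkState.dropPoint_addDefect] at this
        subst this; rfl
    · rintro (x | x)
      · rw [Module.Basis.prod_apply]
        simpa using pointMap_cellBasis δ x
      · rw [Module.Basis.prod_apply]
        simpa using defectMap_cellBasis δ x
    · rintro ⟨u, hu⟩
      constructor
      · rintro ⟨x | x, hx⟩
        · rw [← hx]; exact hpt x.1
        · rw [← hx]; exact hdf x.1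
      · intro h
        rcases u.last_cases with h' | h' | h'
        · exact ⟨Sum.inl ⟨u.dropPoint, word_addPoint_eq.1 (h' ▸ hu)⟩, Subtype.ext h'.symm⟩
        · exact ⟨Sum.inr ⟨u.dropPoint, word_addDefect_eq.1 (h' ▸ hu)⟩, Subtype.ext h'.symm⟩
        · exact absurd h' h
  · rw [length_isotypicComponent_resWordModule δ (cellBasis δ (w.map bar)) (pointMap δ n w)
      (fun x => ⟨x.1.addPoint, word_addPoint_eq.2 x.2⟩) ?_ (fun x => pointMap_cellBasis δ x) ?_,
      length_isotypicComponent_wordModule δ hδ hv, length_isotypicComponent_wordModule δ hδ hv]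
    · have h1 : w ≠ v.map bar ++ [Letter.a] := fun h => hw ⟨_, h⟩
      simp only [Branches, h1, false_or]
      by_cases h2 : v = w.map bar
      · subst h2
        rw [if_pos rfl, if_neg (by simp), if_pos (Or.inl rfl), add_zero]
      · rw [if_neg h2, zero_add]
        simp only [h2, false_or]
    · rintro ⟨x, hx⟩ ⟨y, hy⟩ h
      have := congrArg (fun u => u.1.dropPoint) h
      simp only [LinkState.dropPoint_addPoint] at this
      subst this; rfl
    · rintro ⟨u, hu⟩
      constructor
      · rintro ⟨x, hx⟩
        rw [← hx]; exact hpt x.1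
      · intro h
        rcases u.last_cases with h' | h' | h'
        · exact ⟨⟨u.dropPoint, word_addPoint_eq.1 (h' ▸ hu)⟩, Subtype.ext h'.symm⟩
        -- A final defect would make `w` end in `a`, which is excluded here.
        · refine absurd ⟨u.dropPoint.word.map bar, ?_⟩ hw
          rw [← hu, ← LinkState.word_addDefect, ← h']
        · exact absurd h' h

end branching

/-! ### Boundary words and the Fibonacci tree -/

section fibonacci

open Diagram

/-- Reading a word from the right: `t` is the next letter of the alternating word, a letter equal
to `t` contributes `a` and any other letter contributes `ab`. -/
def fibWord (ε : ℕ) : Letter → List Letter → List Letter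
  | _, [] => Letter.a :: List.replicate ε Letter.b
  | t, y :: x =>
    if y = t then fibWord ε (bar t) x ++ [Letter.a] else fibWord ε t x ++ [Letter.a, Letter.b]

/-- The number of letters used by the rightmost embedding into an alternating word, for a word that
is read from the right. -/
def embeddingLength : Letter → List Letter → ℕ
  | _, [] => 0
  | t, y :: x => if y = t then embeddingLength (bar t) x + 1 else embeddingLength t x + 2

theorem eq_bar_of_ne {y t : Letter} (h : y ≠ t) : y = bar t := by
  cases y <;> cases t <;> simp_all [bar]

theorem fibWord_cons (ε : ℕ) (t : Letter) (x : List Letter) :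
    fibWord ε t (t :: x) = fibWord ε (bar t) x ++ [Letter.a] := by
  rw [fibWord, if_pos rfl]

theorem fibWord_cons_bar (ε : ℕ) (t : Letter) (x : List Letter) :
    fibWord ε t (bar t :: x) = fibWord ε t x ++ [Letter.a, Letter.b] := by
  rw [fibWord, if_neg (bar_ne t)]

theorem embeddingLength_cons (t : Letter) (x : List Letter) :
    embeddingLength t (t :: x) = embeddingLength (bar t) x + 1 := by
  rw [embeddingLength, if_pos rfl]

theorem embeddingLength_cons_bar (t : Letter) (x : List Letter) :
    embeddingLength t (bar t :: x) = embeddingLength t x + 2 := by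
  rw [embeddingLength, if_neg (bar_ne t)]

/-- Only the comparison of each letter with the expected one matters, so exchanging all letters has
the same effect as exchanging the expected letter. -/
theorem fibWord_map_bar (ε : ℕ) (t : Letter) (x : List Letter) :
    fibWord ε t (x.map bar) = fibWord ε (bar t) x := by
  induction x generalizing t with
  | nil => rfl
  | cons y x ih =>
    rw [List.map_cons]
    by_cases h : y = t
    · subst h
      conv_rhs => rw [← bar_bar y, fibWord, bar_bar, if_neg (bar_ne y).symm]
      rw [fibWord_cons_bar, ih]
    · obtain rfl := eq_bar_of_ne h
      rw [fibWord_cons, bar_bar, fibWord_cons, ih, bar_bar]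

theorem embeddingLength_map_bar (t : Letter) (x : List Letter) :
    embeddingLength t (x.map bar) = embeddingLength (bar t) x := by
  induction x generalizing t with
  | nil => rfl
  | cons y x ih =>
    rw [List.map_cons]
    by_cases h : y = t
    · subst h
      conv_rhs => rw [← bar_bar y, embeddingLength, bar_bar, if_neg (bar_ne y).symm]
      rw [embeddingLength_cons_bar, ih]
    · obtain rfl := eq_bar_of_ne h
      rw [embeddingLength_cons, bar_bar, embeddingLength_cons, ih, bar_bar]

theorem length_fibWord (ε : ℕ) (t : Letter) (x : List Letter) :
    (fibWord ε t x).length = embeddingLength t x + ε + 1 := by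
  induction x generalizing t with
  | nil => simp [fibWord, embeddingLength]
  | cons y x ih =>
    by_cases h : y = t
    · subst h
      rw [fibWord_cons, embeddingLength_cons, List.length_append, ih]
      simp; omega
    · obtain rfl := eq_bar_of_ne h
      rw [fibWord_cons_bar, embeddingLength_cons_bar, List.length_append, ih]
      simp; omega

/-- The final letter tells whether the last block is `a` or `ab`, and hence whether the letter read
first is the expected one; the blocks are removed one by one. An initial `a` or `ab` is never
confused with a longer encoding, by length and last letter. -/
theorem fibWord_injective {ε ε' : ℕ} (hε : ε < 2) (hε' : ε' < 2) {t : Letter} {x x' : List Letter}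
    (h : fibWord ε t x = fibWord ε' t x') : x = x' := by
  have hnil : ∀ {ε ε' : ℕ} {t y : Letter} {x : List Letter}, ε < 2 →
      fibWord ε t [] ≠ fibWord ε' t (y :: x) := by
    intro ε ε' t y x hε h
    have hl := congrArg List.length h
    by_cases hy : y = t
    · subst hy
      rw [fibWord_cons] at h
      rw [length_fibWord, length_fibWord, embeddingLength_cons, embeddingLength] at hl
      have : ε = 1 := by omega
      subst this
      have := congrArg List.getLast? h
      simp [fibWord] at this
    · obtain rfl := eq_bar_of_ne hy
      rw [length_fibWord, length_fibWord, embeddingLength_cons_bar, embeddingLength] at hl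
      omega
  have hne : ∀ l l' : List Letter, l ++ [Letter.a] ≠ l' ++ [Letter.a, Letter.b] := by
    intro l l' h
    have := congrArg List.getLast? h
    simp at this
  induction x generalizing t x' with
  | nil =>
    cases x' with
    | nil => rfl
    | cons y x' => exact absurd h (hnil hε)
  | cons y x ih =>
    cases x' with
    | nil => exact absurd h.symm (hnil hε')
    | cons y' x' =>
      by_cases hy : y = t
      · subst hy
        by_cases hy' : y' = y
        · subst hy'
          rw [fibWord_cons, fibWord_cons, List.append_cancel_right_eq] at h
          rw [ih h]
        · obtain rfl := eq_bar_of_ne hy'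
          rw [fibWord_cons, fibWord_cons_bar] at h
          exact absurd h (hne _ _)
      · obtain rfl := eq_bar_of_ne hy
        by_cases hy' : y' = t
        · subst hy'
          rw [fibWord_cons, fibWord_cons_bar] at h
          exact absurd h.symm (hne _ _)
        · obtain rfl := eq_bar_of_ne hy'
          rw [fibWord_cons_bar, fibWord_cons_bar, List.append_cancel_right_eq] at h
          rw [ih h]

theorem noBB_concat_a {l : List Letter} :
    ¬ [Letter.b, Letter.b] <:+: l ++ [Letter.a] ↔ ¬ [Letter.b, Letter.b] <:+: l := by
  rw [List.infix_concat_iff, List.suffix_concat_iff]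
  refine not_congr ⟨?_, Or.inr⟩
  rintro ((h | ⟨t, h, -⟩) | h)
  · simp at h
  · have := congrArg List.getLast? h
    simp at this
  · exact h

/-- The appended `b` is preceded by the appended `a`, so it cannot complete a double `b`. -/
theorem noBB_concat_ab {l : List Letter} :
    ¬ [Letter.b, Letter.b] <:+: l ++ [Letter.a, Letter.b] ↔ ¬ [Letter.b, Letter.b] <:+: l := by
  rw [← noBB_concat_a (l := l),
    show l ++ [Letter.a, Letter.b] = l ++ [Letter.a] ++ [Letter.b] by simp,
    List.infix_concat_iff, List.suffix_concat_iff]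
  refine not_congr ⟨?_, Or.inr⟩
  rintro ((h | ⟨t, h, h'⟩) | h)
  · simp at h
  · obtain rfl : t = [Letter.b] := List.append_cancel_right (bs := [Letter.b]) h.symm
    obtain ⟨s, hs⟩ := h'
    have := congrArg List.getLast? hs
    simp at this
  · exact h

theorem fibWord_mem {ε : ℕ} (hε : ε < 2) (t : Letter) (x : List Letter) :
    [Letter.a] <+: fibWord ε t x ∧ ¬ [Letter.b, Letter.b] <:+: fibWord ε t x := by
  induction x generalizing t with
  | nil => interval_cases ε <;> simp [fibWord] <;> decide
  | cons y x ih =>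
    by_cases h : y = t
    · subst h
      rw [fibWord_cons, noBB_concat_a]
      exact ⟨(ih _).1.trans (List.prefix_append _ _), (ih _).2⟩
    · obtain rfl := eq_bar_of_ne h
      rw [fibWord_cons_bar, noBB_concat_ab]
      exact ⟨(ih _).1.trans (List.prefix_append _ _), (ih _).2⟩

/-- A word that starts with `a` and has no double `b` is cut into blocks `a` and `ab`. The first
block determines `ε`; the later ones say whether each letter is the expected one. -/
theorem exists_fibWord {l : List Letter} (h : [Letter.a] <+: l)
    (h' : ¬ [Letter.b, Letter.b] <:+: l) (t : Letter) : ∃ ε < 2, ∃ x, fibWord ε t x = l := by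
  induction hn : l.length using Nat.strong_induction_on generalizing l t with
  | _ n ih =>
    have hprefix : ∀ {l c}, [Letter.a] <+: l ++ [c] → l ≠ [] → [Letter.a] <+: l := by
      intro l c h hl
      rcases List.prefix_concat_iff.1 h with h | h
      · have := congrArg List.length h
        simp at this
        exact absurd this hl
      · exact h
    rcases List.eq_nil_or_concat' l with rfl | ⟨l, c, rfl⟩
    · simp at h
    · cases c with
      | a =>
        by_cases hl : l = []
        · subst hl
          exact ⟨0, by omega, [], rfl⟩
        · obtain ⟨ε, hε, x, rfl⟩ := ih l.length (by simp at hn; omega) (hprefix h hl)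
            (noBB_concat_a.1 h') (bar t) rfl
          exact ⟨ε, hε, t :: x, fibWord_cons _ _ _⟩
      | b =>
        have hl : l ≠ [] := by
          rintro rfl
          simp at h
        have hl' := hprefix h hl
        rcases List.eq_nil_or_concat' l with rfl | ⟨l, c, rfl⟩
        · exact absurd rfl hl
        · cases c with
          | b => exact absurd ⟨l, [], by simp⟩ h'
          | a =>
            by_cases hl0 : l = []
            · subst hl0
              exact ⟨1, by omega, [], rfl⟩
            · have h2 : l ++ [Letter.a] ++ [Letter.b] = l ++ [Letter.a, Letter.b] := by simp
              rw [h2, noBB_concat_ab] at h'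
              obtain ⟨ε, hε, x, rfl⟩ := ih l.length (by simp at hn; omega) (hprefix hl' hl0) h' t rfl
              exact ⟨ε, hε, bar t :: x, by rw [fibWord_cons_bar, h2]⟩

/-- An appended `a` is a new block, that is, a new letter `a` read first, after which the expected
letter is exchanged. An appended `b` turns the last block `a` into `ab`, which is the effect of
exchanging all letters. -/
theorem eq_of_fibWord_eq_concat {ε ε' : ℕ} (hε : ε < 2) (hε' : ε' < 2) {x y : List Letter}
    {c : Letter} (h : fibWord ε' Letter.a y = fibWord ε Letter.a x ++ [c]) :
    y = x.map bar ∨ y = Letter.a :: x.map bar := by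
  cases c with
  | a =>
    right
    apply fibWord_injective hε' hε (t := Letter.a)
    rw [h, fibWord_cons, fibWord_map_bar, bar_bar]
  | b =>
    left
    cases y with
    | nil =>
      have hl := congrArg List.length h
      rw [length_fibWord, List.length_append, length_fibWord, embeddingLength] at hl
      simp only [List.length_singleton] at hl
      have h1 : ε' = 1 := by omega
      subst h1
      have : fibWord 0 Letter.a [] = fibWord ε Letter.a x :=
        List.append_cancel_right (bs := [Letter.b]) h
      rw [← fibWord_injective (by omega) hε this]
      rfl
    | cons z y =>
      cases z with
      | a =>
        rw [fibWord_cons] at h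
        have := congrArg List.getLast? h
        simp at this
      | b =>
        rw [show Letter.b = bar Letter.a from rfl, fibWord_cons_bar,
          show fibWord ε' Letter.a y ++ [Letter.a, Letter.b] =
            fibWord ε' Letter.a y ++ [Letter.a] ++ [bar Letter.a] by simp [bar],
          List.append_cancel_right_eq] at h
        have : x = Letter.a :: y.map bar := by
          apply fibWord_injective hε hε' (t := Letter.a)
          rw [← h, fibWord_cons, fibWord_map_bar, bar_bar]
        rw [this, List.map_cons, List.map_map, show bar ∘ bar = id from funext bar_bar, List.map_id]
        rfl

/-- The vertex of the Fibonacci tree that belongs to a word at level `n`, for a word that is read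
from the right. -/
def levelWord (n : ℕ) (x : List Letter) : List Letter :=
  fibWord ((n - embeddingLength Letter.a x) % 2) Letter.a x

/-- One of the words is the other one with a letter appended. -/
def AppendAdj (l l' : List Letter) : Prop := (∃ c, l' = l ++ [c]) ∨ ∃ c, l = l' ++ [c]

/-- Appending `a` in either direction corresponds to the relations in which a letter is added.
Exchanging all letters toggles whether the final block is `a` or `ab`, so a final `b` appears or
disappears. The parity bit at levels `n` and `n + 1` compensates the change of the embedding length.
-/
theorem appendAdj_levelWord {n : ℕ} {x y : List Letter} (hx : embeddingLength Letter.a x ≤ n)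
    (hy : embeddingLength Letter.a y ≤ n + 1) :
    AppendAdj (levelWord n x) (levelWord (n + 1) y) ↔
      x = y.map bar ∨ y = Letter.a :: x.map bar ∨ x = Letter.a :: y.map bar := by
  have hbar : ∀ x : List Letter, (x.map bar).map bar = x := fun x => by
    rw [List.map_map, show bar ∘ bar = id from funext bar_bar, List.map_id]
  constructor
  · rintro (⟨c, h⟩ | ⟨c, h⟩)
    · rcases eq_of_fibWord_eq_concat (Nat.mod_lt _ two_pos) (Nat.mod_lt _ two_pos) h with h | h
      · left; rw [h, hbar]
      · exact Or.inr (Or.inl h)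
    · rcases eq_of_fibWord_eq_concat (Nat.mod_lt _ two_pos) (Nat.mod_lt _ two_pos) h with h | h
      · exact Or.inl h
      · exact Or.inr (Or.inr h)
  · have hm := embeddingLength_map_bar
    unfold AppendAdj levelWord
    rintro (h | rfl | rfl)
    · obtain rfl : y = x.map bar := by rw [h, hbar]
      rw [hm] at hy ⊢
      rw [fibWord_map_bar]
      cases x with
      -- For the empty word there is only the initial block, which alternates between `a` and `ab`
      -- with the parity of the level.
      | nil =>
        simp only [embeddingLength, fibWord, Nat.sub_zero]
        rcases Nat.mod_two_eq_zero_or_one n with h0 | h0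
        · left; exact ⟨Letter.b, by rw [h0, show (n + 1) % 2 = 1 by omega]; rfl⟩
        · right; exact ⟨Letter.b, by rw [h0, show (n + 1) % 2 = 0 by omega]; rfl⟩
      | cons z x =>
        cases z with
        | a =>
          have e1 : embeddingLength (bar Letter.a) (Letter.a :: x) =
            embeddingLength (bar Letter.a) x + 2 := embeddingLength_cons_bar Letter.b x
          have e2 : ∀ ε, fibWord ε (bar Letter.a) (Letter.a :: x) =
            fibWord ε (bar Letter.a) x ++ [Letter.a, Letter.b] := fun ε =>
              fibWord_cons_bar ε Letter.b x
          rw [embeddingLength_cons] at hx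
          left
          refine ⟨Letter.b, ?_⟩
          rw [e1, e2, fibWord_cons, embeddingLength_cons, List.append_assoc]
          congr 2
          omega
        | b =>
          have e1 : embeddingLength (bar Letter.a) (Letter.b :: x) =
            embeddingLength Letter.a x + 1 := embeddingLength_cons Letter.b x
          have e2 : ∀ ε, fibWord ε (bar Letter.a) (Letter.b :: x) =
            fibWord ε Letter.a x ++ [Letter.a] := fun ε => fibWord_cons ε Letter.b x
          have e3 : embeddingLength Letter.a (Letter.b :: x) =
            embeddingLength Letter.a x + 2 := embeddingLength_cons_bar Letter.a x
          have e4 : ∀ ε, fibWord ε Letter.a (Letter.b :: x) =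
            fibWord ε Letter.a x ++ [Letter.a, Letter.b] := fun ε => fibWord_cons_bar ε Letter.a x
          rw [e3] at hx
          right
          refine ⟨Letter.b, ?_⟩
          rw [e1, e2, e3, e4, List.append_assoc]
          congr 2
          omega
    · left
      refine ⟨Letter.a, ?_⟩
      rw [fibWord_cons, embeddingLength_cons, fibWord_map_bar, hm, bar_bar]
      congr 2
      omega
    · right
      refine ⟨Letter.a, ?_⟩
      rw [embeddingLength_cons, hm, bar_bar] at hx
      rw [fibWord_cons, embeddingLength_cons, fibWord_map_bar, hm, bar_bar]
      congr 2
      omega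

/-- The alternating word that starts with `t`. -/
def alternatingFrom : Letter → ℕ → List Letter
  | _, 0 => []
  | t, n + 1 => t :: alternatingFrom (bar t) n

theorem map_bar_alternatingFrom (t : Letter) (n : ℕ) :
    (alternatingFrom t n).map bar = alternatingFrom (bar t) n := by
  induction n generalizing t with
  | zero => rfl
  | succ n ih => rw [alternatingFrom, alternatingFrom, List.map_cons, ih]

theorem reverse_alternatingWord (n : ℕ) :
    (alternatingWord n).reverse = alternatingFrom Letter.a n := by
  induction n with
  | zero => simp [alternatingWord, alternatingFrom]
  | succ n ih =>
    rw [alternatingWord_succ, List.reverse_append, ← List.map_reverse, ih, map_bar_alternatingFrom]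
    rfl

/-- The greedy embedding is optimal: the expected letter is matched at once, and any other letter
must skip one place and match the next. Its length therefore decides whether a word embeds. -/
theorem sublist_alternatingFrom_iff (t : Letter) (n : ℕ) (x : List Letter) :
    x.Sublist (alternatingFrom t n) ↔ embeddingLength t x ≤ n := by
  induction n generalizing t x with
  | zero =>
    cases x with
    | nil => simp [embeddingLength]
    | cons y x =>
      rw [embeddingLength]
      split_ifs <;> simp [alternatingFrom]
  | succ n ih =>
    rw [alternatingFrom]
    cases x with
    | nil => simp [embeddingLength]
    | cons y x =>
      by_cases h : y = t
      · subst h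
        rw [List.cons_sublist_cons, ih, embeddingLength_cons]
        omega
      · obtain rfl := eq_bar_of_ne h
        rw [List.sublist_cons_iff, ih, embeddingLength_cons, bar_bar, embeddingLength_cons_bar]
        constructor
        · rintro (h' | ⟨r, h', -⟩)
          · omega
          · exact absurd (List.cons.inj h').1 h
        · intro h'
          left
          omega

theorem mem_subwords_iff {n : ℕ} {w : List Letter} :
    w ∈ subwords n ↔ embeddingLength Letter.a w.reverse ≤ n := by
  rw [← sublist_alternatingFrom_iff, ← reverse_alternatingWord, List.reverse_sublist]
  rfl

/-- Words are encoded from right to left, so after reversal a letter appended on the right is the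
letter read first, and the three branching relations are those of `appendAdj_levelWord`. -/
theorem branches_iff {n : ℕ} {v w : List Letter} (hv : v ∈ subwords n) (hw : w ∈ subwords (n + 1)) :
    Branches v w ↔ AppendAdj (levelWord n v.reverse) (levelWord (n + 1) w.reverse) := by
  rw [appendAdj_levelWord (mem_subwords_iff.1 hv) (mem_subwords_iff.1 hw), Branches]
  have h : ∀ v w : List Letter, v.reverse = Letter.a :: w.reverse.map bar ↔
      v = w.map bar ++ [Letter.a] := fun v w => by
    rw [List.map_reverse, ← List.reverse_concat', List.reverse_inj]
  rw [h, h, List.map_reverse, List.reverse_inj]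

/-- A vertex of the pascalized derooted Fibonacci tree. -/
abbrev PascalVertex (n : ℕ) : Type := GradedGraph.fibonacciTree.derooted.pascalization.V n

/-- The word of a vertex. -/
def PascalVertex.word {n : ℕ} (v : PascalVertex n) : List Letter := v.1.2.1

theorem PascalVertex.word_injective {n : ℕ} :
    Function.Injective (PascalVertex.word : PascalVertex n → List Letter) := by
  rintro ⟨⟨k, l, hl, hl'⟩, hk⟩ ⟨⟨k', l', hl1, hl1'⟩, hk'⟩ h
  obtain rfl : l = l' := h
  obtain rfl : k = k' := by omega
  rfl

open Classical in
theorem PascalVertex.edges_eq {n : ℕ} (v : PascalVertex n) (w : PascalVertex (n + 1)) :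
    GradedGraph.fibonacciTree.derooted.pascalization.edges n v w =
      if AppendAdj v.word w.word then 1 else 0 := by
  obtain ⟨⟨k, l, hl, hl'⟩, hk⟩ := v
  obtain ⟨⟨k', l', hl1, hl1'⟩, hk'⟩ := w
  change GradedGraph.edgesBetween _ ⟨k, _⟩ ⟨k', _⟩ = if AppendAdj l l' then 1 else 0
  have hex : ∀ l l' : List Letter, (∃ c, l' = l ++ [c]) ↔
      (l' = l ++ [Letter.a] ∨ l' = l ++ [Letter.b]) := fun l l' =>
    ⟨fun ⟨c, hc⟩ => by cases c; exacts [Or.inl hc, Or.inr hc], fun h => h.elim (⟨_, ·⟩) (⟨_, ·⟩)⟩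
  have hlen : ∀ {l l' : List Letter}, (∃ c, l' = l ++ [c]) → l'.length = l.length + 1 := by
    rintro l l' ⟨c, rfl⟩
    simp
  unfold GradedGraph.edgesBetween AppendAdj
  by_cases h1 : k' = k + 1
  · subst h1
    rw [dif_pos rfl]
    -- Lengths are one more than the levels of the derooted tree, so at most one of the two words
    -- can extend the other.
    have hno : ¬ ∃ c, l = l' ++ [c] := fun h => by have := hlen h; omega
    simp only [hno, or_false, hex]
    rfl
  · rw [dif_neg h1]
    have hno : ¬ ∃ c, l' = l ++ [c] := fun h => by have := hlen h; omega
    by_cases h2 : k = k' + 1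
    · subst h2
      rw [dif_pos rfl]
      simp only [hno, false_or, hex]
      rfl
    · rw [dif_neg h2, if_neg]
      rintro (h | h)
      · exact hno h
      · have := hlen h; omega

/-- The vertex of a boundary word. -/
def pascalVertex (n : ℕ) (w : subwords n) : PascalVertex n :=
  ⟨⟨embeddingLength Letter.a w.1.reverse + (n - embeddingLength Letter.a w.1.reverse) % 2,
    levelWord n w.1.reverse, length_fibWord _ _ _,
    Or.inr (fibWord_mem (Nat.mod_lt _ two_pos) _ _).1,
    (fibWord_mem (Nat.mod_lt _ two_pos) _ _).2⟩, by
      have := mem_subwords_iff.1 w.2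
      simp only [Nat.ModEq]
      omega⟩

/-- The derooted level of a code is its embedding length plus `ε`. Being at most `n` and congruent
to `n` modulo two forces `ε` to be the parity bit of `levelWord` and the embedding length to be at
most `n`, that is, the word to be a subword. -/
theorem pascalVertex_bijective (n : ℕ) : Function.Bijective (pascalVertex n) := by
  constructor
  · intro w w' h
    have h1 : levelWord n w.1.reverse = levelWord n w'.1.reverse := congrArg PascalVertex.word h
    exact Subtype.ext (List.reverse_injective
      (fibWord_injective (Nat.mod_lt _ two_pos) (Nat.mod_lt _ two_pos) h1))
  · rintro ⟨⟨k, l, hl, hl', hl''⟩, hk, hk'⟩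
    have h1 : [Letter.a] <+: l := hl'.resolve_left (by rintro rfl; simp at hl)
    obtain ⟨ε, hε, x, rfl⟩ := exists_fibWord h1 hl'' Letter.a
    rw [length_fibWord] at hl
    simp only [Nat.ModEq] at hk hk'
    refine ⟨⟨x.reverse, mem_subwords_iff.2 (by rw [List.reverse_reverse]; omega)⟩,
      PascalVertex.word_injective ?_⟩
    change levelWord n x.reverse.reverse = fibWord ε Letter.a x
    rw [List.reverse_reverse, levelWord]
    congr 1
    omega

end fibonacci

/-! ### The isomorphism of graphs -/

section classification

open Diagram

variable {δ : ℂ}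

/-- The isomorphism class of the module of a word. -/
noncomputable def wordClass (hδ : ∀ n : ℕ, IsSemisimpleRing (DiagAlg δ n)) (n : ℕ)
    (w : subwords n) : SimpleClass (DiagAlg δ n) :=
  Quotient.mk (SimpleModule.setoid (DiagAlg δ n))
    ⟨ModuleCat.of (DiagAlg δ n) (wordModule δ n w.1.length w.1),
      have := hδ n
      isSimpleModule_wordModule (loopParameter_ne_zero δ (hδ 1)) w.2⟩

/-- Injectivity is the inequivalence of the modules of words, surjectivity the fact that every
simple module is one of them. -/
theorem wordClass_bijective (hδ : ∀ n : ℕ, IsSemisimpleRing (DiagAlg δ n)) (n : ℕ) :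
    Function.Bijective (wordClass hδ n) := by
  have := hδ n
  have h0 := loopParameter_ne_zero δ (hδ 1)
  constructor
  · intro w w' h
    exact Subtype.ext (eq_of_wordModule_equiv h0 w.2 w'.2 (Quotient.exact h))
  · intro c
    induction c using Quotient.ind with
    | _ S =>
      have := S.2
      obtain ⟨w, hw, ⟨e⟩⟩ := exists_wordModule_equiv (n := n) h0 S.1
      exact ⟨⟨w, hw⟩, Quotient.sound ⟨e.symm⟩⟩

open Classical in
theorem branchingGraph_edges (hδ : ∀ n : ℕ, IsSemisimpleRing (DiagAlg δ n)) (n : ℕ)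
    (v : subwords n) (w : subwords (n + 1)) :
    (branchingGraph (DiagAlg δ) fun n => (DiagAlg.incl δ n).toRingHom).edges n
      (wordClass hδ n v) (wordClass hδ (n + 1) w) = if Branches v.1 w.1 then 1 else 0 := by
  have := hδ n
  exact length_isotypicComponent_restriction δ (loopParameter_ne_zero δ (hδ 1)) v.2 w.1

/-- The bijection between the simple modules and the vertices of the pascalization. -/
noncomputable def levelEquiv (hδ : ∀ n : ℕ, IsSemisimpleRing (DiagAlg δ n)) (n : ℕ) :
    SimpleClass (DiagAlg δ n) ≃ PascalVertex n :=
  (Equiv.ofBijective _ (wordClass_bijective hδ n)).symm.trans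
    (Equiv.ofBijective _ (pascalVertex_bijective n))

theorem levelEquiv_wordClass (hδ : ∀ n : ℕ, IsSemisimpleRing (DiagAlg δ n)) {n : ℕ}
    (w : subwords n) : levelEquiv hδ n (wordClass hδ n w) = pascalVertex n w := by
  rw [levelEquiv, Equiv.trans_apply, Equiv.ofBijective_symm_apply_apply, Equiv.ofBijective_apply]

/-- The branching graph is the pascalization of the derooted Fibonacci tree. -/
noncomputable def branchingGraphIso (hδ : ∀ n : ℕ, IsSemisimpleRing (DiagAlg δ n)) :
    GradedGraph.Iso (branchingGraph (DiagAlg δ) fun n => (DiagAlg.incl δ n).toRingHom)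
      GradedGraph.fibonacciTree.derooted.pascalization where
  toEquiv n := levelEquiv hδ n
  edges_eq n v w := by
    classical
    obtain ⟨v, rfl⟩ := (wordClass_bijective hδ n).2 v
    obtain ⟨w, rfl⟩ := (wordClass_bijective hδ (n + 1)).2 w
    rw [branchingGraph_edges]
    refine (congrArg₂ _ (levelEquiv_wordClass hδ v) (levelEquiv_wordClass hδ w)).trans ?_
    rw [PascalVertex.edges_eq]
    simp only [branches_iff v.2 w.2]
    rfl

end classification

theorem mainTheorem6 (δ : ℂ) (hδ : ∀ n : ℕ, IsSemisimpleRing (DiagAlg δ n)) :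
    (∀ n : ℕ,
      IsSimpleModule (DiagAlg δ n) (linkSub δ n 0) ∧
      (∀ d ≤ n,
        (∀ k l : ℕ, k + l = d → k ≤ (n + 1) / 2 → l ≤ n / 2 →
          (klModule δ n d k l).restrictScalars ℂ = Submodule.span ℂ (klClasses δ n d k l)) ∧
        iSupIndep (fun i : {i : ℕ × ℕ // i.1 + i.2 = d ∧ i.1 ≤ (n + 1) / 2 ∧ i.2 ≤ n / 2} =>
          klModule δ n d i.1.1 i.1.2) ∧
        (⨆ i : {i : ℕ × ℕ // i.1 + i.2 = d ∧ i.1 ≤ (n + 1) / 2 ∧ i.2 ≤ n / 2},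
          klModule δ n d i.1.1 i.1.2) = ⊤) ∧
      (∀ k l : ℕ, k ≤ (n + 1) / 2 → l ≤ n / 2 →
        (∀ w ∈ subwordsOf n k l,
          (wordModule δ n (k + l) w).restrictScalars ℂ =
            Submodule.span ℂ (wordClasses δ n (k + l) w)) ∧
        iSupIndep (fun w : subwordsOf n k l => wordModule δ n (k + l) w.1) ∧
        (⨆ w : subwordsOf n k l, wordModule δ n (k + l) w.1) = klModule δ n (k + l) k l) ∧
      (∀ w ∈ subwords n, IsSimpleModule (DiagAlg δ n) (wordModule δ n w.length w)) ∧
      (∀ w ∈ subwords n, ∀ w' ∈ subwords n,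
        Nonempty (wordModule δ n w.length w ≃ₗ[DiagAlg δ n] wordModule δ n w'.length w') →
          w = w') ∧
      (∀ (S : Type*) [AddCommGroup S] [Module (DiagAlg δ n) S],
        IsSimpleModule (DiagAlg δ n) S →
          ∃ w ∈ subwords n, Nonempty (S ≃ₗ[DiagAlg δ n] wordModule δ n w.length w))) ∧
    Nonempty (GradedGraph.Iso
      (branchingGraph (DiagAlg δ) fun n => (DiagAlg.incl δ n).toRingHom)
      GradedGraph.fibonacciTree.derooted.pascalization) := by
  -- Genericity enters beyond the semisimplicity of the level considered only through level one,
  -- which forces `δ ≠ 0`.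
  have h0 := loopParameter_ne_zero δ (hδ 1)
  refine ⟨fun n => ?_, ⟨branchingGraphIso hδ⟩⟩
  have := hδ n
  refine ⟨isSimpleModule_linkSub_zero h0, fun d _ => ⟨fun k l _ _ _ =>
      klModule_restrictScalars δ d k l, iSupIndep_klModule δ d _, iSup_klModule δ d⟩,
    fun k l _ _ => ⟨fun w _ => wordModule_restrictScalars δ (k + l) w,
      iSupIndep_wordModule δ (k + l) _, iSup_wordModule δ k l⟩,
    fun w hw => isSimpleModule_wordModule h0 hw,
    fun w hw w' hw' h => eq_of_wordModule_equiv h0 hw hw' h, ?_⟩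
  intro S _ _ hS
  exact exists_wordModule_equiv h0 S
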